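/- All graphs $G$ are finite, directed and without loops or multiple edges. $G[Y]$ is the subgraph induced by $Y\subseteq V(G)$, $G-X=G[V(G)\setminus X]$, $\mathrm{Reach}_{G-X}(S)$ is the set of vertices reachable in $G-X$ from a vertex of $S$, and *component* means strongly connected component. **The game.** In the weakly monotone shy robber game on $G$ the robber first chooses a component $R_0$ of $G$, and $C_0=\emptyset$. In round $i$, from the position $(C_i,R_i)$ (where $R_i$ is a component of $G-C_i$), the cops announce a set $C_{i+1}\subseteq V(G)$; then the robber moves to a component $R_{i+1}$ of $G-C_{i+1}$ such that $R_i$ and $R_{i+1}$ lie in the same component of $G-(C_i\cap C_{i+1})$. If there is no such component, he is captured and $R_{i+1}=\emptyset$. The cops win the play iff the robber is captured after finitely many rounds and, for all $j<i$, no vertex of $C_{j+1}\cap R_j$ belongs to $\mathrm{Reach}_{G-(C_i\cap C_{i+1})}(R_i)$. (On the graph without vertices the cops win at once.) The *weak DAG-width* of $G$ is the least $k$ such that the cops have a strategy (which may depend on the history) that only uses sets $C_{i+1}$ with $|C_{i+1}|\le k$ and wins all plays consistent with it. **Decompositions.** A *shy-monotone tree decomposition* of $G$ is a finite rooted tree $T$,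 with edges oriented away from the root $r$, together with maps $C,R:V(T)\to 2^{V(G)}$ such that, writing $ch(t)=C(t)\cap R(t)$ and $m(t)$ for the union of $ch(s)$ over all $s$ on the path from $r$ to $t$ (including $t$): 1. $R(r)=V(G)$; 2. for every edge $(t,t')$ of $T$, $R(t')$ is a component of $G[R(t)\setminus ch(t)]$; 3. for every $t$, $R(t)=ch(t)\cup\bigcup R(t')$, the union over all children $t'$ of $t$; 4. for every edge $(t,t')$ of $T$, $m(t)\cap\mathrm{Reach}_{G-(C(t)\cap C(t'))}(R(t'))=\emptyset$. Its *width* is $\max_t|C(t)|$. **Encodings.** Let $V(G)=\{0,\dots,n-1\}$. The code $\langle G\rangle$ is $1^n0$ followed by the $n^2$ bits of the adjacency matrix, and an instance $(G,k)$ is coded by $\langle G\rangle$ followed by $k$ in binary. A decomposition $D$ is coded by the word $\langle D\rangle$ that writes $T$ in bracket notation, with the bit vectors of $C(t)$ and $R(t)$ after the opening bracket of $t$. **Theorem.** Given a graph $G$ and a natural number $k$, it is in NP to decide whether $G$ has weak DAG-width at most $k$. Shy-monotone tree decompositions serve as certificates: * it is decidable in (deterministic) polynomial time whether, given $\langle G,k\rangle$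 and a word $w$, the word $w$ is the code of a shy-monotone tree decomposition of $G$ of width at most $k$; * $G$ has weak DAG-width at most $k$ if and only if $G$ has a shy-monotone tree decomposition of width at most $k$; * there is a constant $c$ such that every $G$ of weak DAG-width at most $k$ has a shy-monotone tree decomposition $D$ of width at most $k$ whose size is quadratic in the size of the graph: $|\langle D\rangle|\le c\cdot|\langle G\rangle|^2$. -/

import Mathlib

/-! ### Reachability and strong components -/

namespace WeakDagWidth

/-- `w` is reachable from `u` by a directed path of the subgraph `G[Y]` induced by `Y`. -/
def ReachIn {V : Type*} (G : Digraph V) (Y : Set V) (u w : V) : Prop :=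
  u ∈ Y ∧ Relation.ReflTransGen (fun a b => G.Adj a b ∧ b ∈ Y) u w

/-- The set of vertices reachable in `G[Y]` from some vertex of `S`. -/
def reachSet {V : Type*} (G : Digraph V) (Y S : Set V) : Set V :=
  {w | ∃ u ∈ S, ReachIn G Y u w}

/-- `K` is (the vertex set of) a strongly connected component of the induced subgraph `G[Y]`:
the class of some vertex of `Y` under mutual reachability in `G[Y]`. In particular `K ≠ ∅`. -/
def IsComponent {V : Type*} (G : Digraph V) (Y K : Set V) : Prop :=
  ∃ v ∈ Y, K = {w | ReachIn G Y v w ∧ ReachIn G Y w v}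

/-! ### The weakly monotone shy robber game -/

/-- The legal moves of the shy robber: when the cops move from `C` to `C'`, the robber may go from
his component `R` of `G - C` to a component `R'` of `G - C'` such that `R` and `R'` are contained
in the same strongly connected component of `G - (C ∩ C')`. -/
def LegalRobberMove {V : Type*} [DecidableEq V] (G : Digraph V) (C C' R R' : Finset V) : Prop :=
  R.Nonempty ∧ IsComponent G (↑C' : Set V)ᶜ ↑R' ∧
    ∃ K : Set V, IsComponent G (↑(C ∩ C') : Set V)ᶜ K ∧ ↑R ⊆ K ∧ ↑R' ⊆ K

/-- One answer of the robber. If he has no legal move, he is captured, which is recorded by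
the empty robber component. -/
def RobberMove {V : Type*} [DecidableEq V] (G : Digraph V) (C C' R R' : Finset V) : Prop :=
  LegalRobberMove G C C' R R' ∨ (R' = ∅ ∧ ¬ ∃ R'', LegalRobberMove G C C' R R'')

/-- The robber starts in a component of `G`. (If `G` has no vertex, he is captured from
the beginning.) -/
def RobberStart {V : Type*} (G : Digraph V) (R₀ : Finset V) : Prop :=
  IsComponent G Set.univ ↑R₀ ∨ (IsEmpty V ∧ R₀ = ∅)

/-- `(C 0, R 0), (C 0, C 1, R 0), (C 1, R 1), …` is a play that is consistent with
the (history dependent) cop strategy `σ`, which maps the sequence of the cop positions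
`(C 0, R 0), …, (C i, R i)` visited so far to the next placement `C (i + 1)` of the cops.
After a capture the sequence is continued by `R i = ∅`. -/
structure IsPlay {V : Type*} [DecidableEq V] (G : Digraph V)
    (σ : List (Finset V × Finset V) → Finset V) (C R : ℕ → Finset V) : Prop where
  cops_start : C 0 = ∅
  robber_start : RobberStart G (R 0)
  cops_move : ∀ i, C (i + 1) = σ ((List.range (i + 1)).map fun j => (C j, R j))
  robber_move : ∀ i, RobberMove G (C i) (C (i + 1)) (R i) (R (i + 1))

/-- The chasers of round `j`: the cops that move into the current robber component. -/
def chasers {V : Type*} [DecidableEq V] (C R : ℕ → Finset V) (j : ℕ) : Finset V :=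
  C (j + 1) ∩ R j

/-- The finite play up to the position `(C n, R n)` is weakly monotone: in no round `i` can
the robber reach, in `G - (C i ∩ C (i + 1))`, a vertex on which a chaser of an earlier round `j`
was placed. -/
def WeaklyMonotone {V : Type*} [DecidableEq V] (G : Digraph V) (C R : ℕ → Finset V) (n : ℕ) :
    Prop :=
  ∀ i < n, ∀ j < i,
    Disjoint (↑(chasers C R j) : Set V) (reachSet G (↑(C i ∩ C (i + 1)) : Set V)ᶜ ↑(R i))

/-- `k` cops have a winning strategy in the weakly monotone shy robber game on `G`: there is
a strategy that never uses more than `k` cops, such that in every play consistent with it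
the robber is captured after finitely many rounds and the play up to the capture is weakly
monotone. -/
def CopsWin {V : Type*} [DecidableEq V] (G : Digraph V) (k : ℕ) : Prop :=
  ∃ σ : List (Finset V × Finset V) → Finset V, (∀ h, (σ h).card ≤ k) ∧
    ∀ C R : ℕ → Finset V, IsPlay G σ C R → ∃ n, R n = ∅ ∧ WeaklyMonotone G C R n

/-- The weak DAG-width of a finite digraph: the least number of cops that have a winning strategy
in the weakly monotone shy robber game. (The set is non-empty, as it contains `|V|`.) -/
noncomputable def weakDagWidth {V : Type*} [Finite V] [DecidableEq V] (G : Digraph V) : ℕ :=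
  sInf {k | CopsWin G k}

/-! ### Shy-monotone tree decompositions -/

/-- A finite rooted tree (edges oriented away from the root), each node `t` of which carries
two sets `C(t)` and `R(t)` of vertices. The list contains the subtrees below the root. -/
inductive LabelledTree (V : Type) : Type where
  | node (C R : Finset V) (children : List (LabelledTree V)) : LabelledTree V

/-- The set `C(r)` at the root `r`. -/
def LabelledTree.rootC {V : Type} : LabelledTree V → Finset V
  | .node C _ _ => C

/-- The set `R(r)` at the root `r`. -/
def LabelledTree.rootR {V : Type} : LabelledTree V → Finset V
  | .node _ R _ => R

/-- The width `max {|C(t)| | t a node}`. -/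
def LabelledTree.width {V : Type} : LabelledTree V → ℕ
  | .node C _ ts => max C.card ((ts.map fun t => t.width).foldr max 0)

/-- The local conditions of a shy-monotone tree decomposition at all nodes of a (sub)tree, where
`m` is the union of the sets `ch(s) = C(s) ∩ R(s)` over the nodes `s` strictly above its root.
With `ch(t) = C(t) ∩ R(t)` and `m(t) = m ∪ ch(t)`:
* for every child `t'` of `t`, `R(t')` is a strongly connected component of `G[R(t) \ ch(t)]`;
* `R(t)` is the union of `ch(t)` and of the sets `R(t')` of all children `t'` of `t`;
* for every child `t'` of `t`, no vertex of `m(t)` is reachable from `R(t')` in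
  `G - (C(t) ∩ C(t'))`. -/
inductive ShyMonotoneBelow {V : Type} [DecidableEq V] (G : Digraph V) :
    Finset V → LabelledTree V → Prop where
  | node (m C R : Finset V) (ts : List (LabelledTree V))
      (component : ∀ t ∈ ts, IsComponent G (↑(R \ (C ∩ R)) : Set V) ↑t.rootR)
      (cover : ∀ v, v ∈ R ↔ v ∈ C ∩ R ∨ ∃ t ∈ ts, v ∈ t.rootR)
      (blocked : ∀ t ∈ ts, Disjoint (↑(m ∪ (C ∩ R)) : Set V)
        (reachSet G (↑(C ∩ t.rootC) : Set V)ᶜ ↑t.rootR))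
      (below : ∀ t ∈ ts, ShyMonotoneBelow G (m ∪ (C ∩ R)) t) :
      ShyMonotoneBelow G m (.node C R ts)

/-- `D = (T, C, R)` is a shy-monotone tree decomposition of `G`: `R(r) = V(G)` at the root `r`,
and all nodes satisfy the local conditions. -/
def IsShyMonotoneTreeDecomposition {V : Type} [DecidableEq V] (G : Digraph V)
    (D : LabelledTree V) : Prop :=
  (∀ v, v ∈ D.rootR) ∧ ShyMonotoneBelow G ∅ D

/-! ### Binary encodings -/

/-- A set of vertices as a bit vector. -/
def setCode {n : ℕ} (S : Finset (Fin n)) : List Bool :=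
  (List.finRange n).map fun i => decide (i ∈ S)

open Classical in
/-- A digraph on `Fin n` as `1ⁿ0` followed by the `n²` bits of its adjacency matrix. -/
noncomputable def graphCode {n : ℕ} (G : Digraph (Fin n)) : List Bool :=
  List.replicate n true ++ false ::
    (List.finRange n).flatMap fun i => (List.finRange n).map fun j => decide (G.Adj i j)

/-- The instance `(G, k)`: the code of `G` followed by `k` in binary. -/
noncomputable def instanceCode {n : ℕ} (G : Digraph (Fin n)) (k : ℕ) : List Bool :=
  graphCode G ++ Nat.bits k

/-- A labelled tree in bracket notation: `1` (opening bracket), the bit vectors of `C(r)` and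
`R(r)` for the root `r`, the codes of the subtrees below the root, `0` (closing bracket). -/
def treeCode {n : ℕ} : LabelledTree (Fin n) → List Bool
  | .node C R ts =>
    true :: (setCode C ++ setCode R ++ (ts.map fun t => treeCode t).flatten ++ [false])

/-- The code of a pair of binary words: the two words, separated by a third symbol. -/
def pairCode (p : List Bool × List Bool) : List (Option Bool) :=
  p.1.map some ++ none :: p.2.map some

/-! ### Polynomial time and NP -/

/-- Membership in `S` is decided by a deterministic (multi-stack) Turing machine in time
polynomial in the length of the input, where inputs are presented by `enc`. -/
def DecidableInPolyTime {α Γ : Type} (enc : α → List Γ) (S : Set α) : Prop :=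
  ∃ f : α → Bool, (∀ a, f a = true ↔ a ∈ S) ∧
    Nonempty (Turing.TM2ComputableInPolyTime enc Computability.encodeBool f)

/-- The language `L` is in NP: there are a polynomial `p` and a relation `S` decidable in polynomial
time such that `x ∈ L` iff `S` relates `x` to some word `w` with `|w| ≤ p(|x|)`. -/
def InNP (L : Set (List Bool)) : Prop :=
  ∃ (p : Polynomial ℕ) (S : Set (List Bool × List Bool)), DecidableInPolyTime pairCode S ∧
    ∀ x, x ∈ L ↔ ∃ w : List Bool, w.length ≤ p.eval x.length ∧ (x, w) ∈ S

/-! ### The problem and its certificates -/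

/-- The language of all `(G, k)` such that `G` is a finite loopless digraph of weak DAG-width
at most `k`. -/
def weakDagWidthProblem : Set (List Bool) :=
  {x | ∃ (n : ℕ) (G : Digraph (Fin n)) (k : ℕ), (∀ v, ¬ G.Adj v v) ∧
    weakDagWidth G ≤ k ∧ x = instanceCode G k}

/-- The relation between instances `(G, k)` (with `G` loopless) and shy-monotone tree
decompositions of `G` of width at most `k`. -/
def decompositionRelation : Set (List Bool × List Bool) :=
  {p | ∃ (n : ℕ) (G : Digraph (Fin n)) (k : ℕ) (D : LabelledTree (Fin n)), (∀ v, ¬ G.Adj v v) ∧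
    IsShyMonotoneTreeDecomposition G D ∧ D.width ≤ k ∧
    p = (instanceCode G k, treeCode D)}

end WeakDagWidth

/-! Let m be the set of vertices on which chasers have been placed. As long as the play is weakly
monotone, the robber's component R is a component of G - m and also of G - (C ∩ C') in each round
(`isComponent_of_separated`), so he can only choose among the components of G[R \ C']
(`legalRobberMove_iff`). The game thus becomes a game on triples (C, R, m) with an inductively
defined winning region `WinsFrom`. A winning strategy, however history dependent, puts every start
into this region, since otherwise the robber could stay outside until the supposed capture
(`winsFrom_of_copsWin`). Unfolding `WinsFrom` yields a decomposition; conversely, following the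
robber down a decomposition wins (`copsWin_of_decomposition`).

The difficulty is the size of the unfolded tree: between two moves into R the cops may make a long
series of idle moves, which only rearrange the cops that guard m against R. A guarding placement
corresponds to a separation (I, J) with guards J \ I. Separations form a lattice on which the number
of guards is modular, so steps between them can be uncrossed (`sepStep_exchange`). Consider a zigzag
of monotone chains between two separations with the fewest turning points and, subject to this, the
least total weight. If an interior turning point weighed at least as much as both its neighbours,
this peak could be exchanged for a valley, or conversely (`Exchange.valley_of_peak`), and the chains
next to it would merge. So the weights first fall and then rise, and there are at most 2n + 2 chains
(`Exchange.exists_short_zigzag`), each with at most 2n proper steps. Hence O(n²) idle moves suffice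
(`exists_short_idleMoves`). All nodes below the root that are not idle remove a vertex from R, and
the sets R of siblings are disjoint, so there are O(n) of them. With O(n) bits per node the code has
length O(n⁴), which is quadratic in the length n² + n + 1 of the graph code
(`exists_continues_of_winsFrom`).

For polynomial time, programs on finitely many stacks are compiled step by step to Turing machines
(`Prog.steps_of_exec`, `PT.computable`). The functions that they compute in polynomial time are
closed under composition, branching and size-bounded iteration (`PT.comp`, `PT.ite`, `PT.iterate`).
The verifier is a pushdown parser of the bracket word that stores, for every open node, its sets
m(t), C(t), R(t) and the part of R(t) covered so far (`checkTree_iff`). -/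

/-! ### A register language and its compilation to multi-stack Turing machines -/

namespace PolyTime

/-- The stack alphabet of all registers. -/
abbrev Sym := Option Bool

/-- Programs that manipulate finitely many stacks over the alphabet `Sym`. -/
inductive Prog (ι : Type) : Type
  | skip : Prog ι
  | push (i : ι) (b : Sym) : Prog ι
  | pop (i : ι) : Prog ι
  | seq (p q : Prog ι) : Prog ι
  | cases (i : ι) (f : Option Sym → Prog ι) : Prog ι
  | loop (i : ι) (p : Prog ι) : Prog ι

open Classical in
/-- `Exec P s t s'`: started in state `s`, the program `P` ends in state `s'` after `t` steps. -/
inductive Exec {ι : Type} : Prog ι → (ι → List Sym) → ℕ → (ι → List Sym) → Prop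
  | skip (s) : Exec .skip s 1 s
  | push (s i b) : Exec (.push i b) s 1 (Function.update s i (b :: s i))
  | pop (s i) : Exec (.pop i) s 1 (Function.update s i (s i).tail)
  | seq {p q s t s' t' s''} (hp : Exec p s t s') (hq : Exec q s' t' s'') :
      Exec (.seq p q) s (t + t') s''
  | cases {i f s t s'} (h : Exec (f (s i).head?) s t s') : Exec (.cases i f) s (t + 1) s'
  | loop_nil {i p s} (h : s i = []) : Exec (.loop i p) s 1 s
  | loop_cons {i p s t s' t' s''} (h : s i ≠ []) (hp : Exec p s t s')
      (hl : Exec (.loop i p) s' t' s'') : Exec (.loop i p) s (t + 1 + t') s''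

namespace Prog

variable {ι : Type}

/-- The labels of the machine that executes a program. -/
def Lab : Prog ι → Type
  | skip => Unit
  | push _ _ => Unit
  | pop _ => Unit
  | seq p q => Lab p ⊕ Lab q
  | cases _ f => Option (Σ o, Lab (f o))
  | loop _ p => Option (Lab p)

theorem finite_lab : ∀ p : Prog ι, Finite (Lab p)
  | skip => inferInstanceAs (Finite Unit)
  | push _ _ => inferInstanceAs (Finite Unit)
  | pop _ => inferInstanceAs (Finite Unit)
  | seq p q => by
    have := finite_lab p
    have := finite_lab q
    exact inferInstanceAs (Finite (Lab p ⊕ Lab q))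
  | cases _ f => by
    have := fun o => finite_lab (f o)
    exact inferInstanceAs (Finite (Option (Σ o, Lab (f o))))
  | loop _ p => by
    have := finite_lab p
    exact inferInstanceAs (Finite (Option (Lab p)))

/-- The label at which the execution of a program starts. -/
def entry : (p : Prog ι) → Lab p
  | skip => ()
  | push _ _ => ()
  | pop _ => ()
  | seq p _ => Sum.inl (entry p)
  | cases _ _ => (none : Option _)
  | loop _ _ => (none : Option _)

/-- The alphabets of the stacks: the stack `none` is for the output. -/
abbrev Alphabet (ι : Type) : Option ι → Type
  | none => Bool
  | some _ => Sym

open Turing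

/-- The statements of the machine for a program, with continuation `exit`. -/
def code {Λ : Type} : (p : Prog ι) → (Lab p → Λ) → Λ → Lab p →
    TM2.Stmt (Alphabet ι) Λ (Option Sym)
  | skip, _, exit, _ => .goto fun _ => exit
  | push i b, _, exit, _ => .push (some i) (fun _ => b) (.goto fun _ => exit)
  | pop i, _, exit, _ => .pop (some i) (fun v _ => v) (.goto fun _ => exit)
  | seq p q, emb, exit, l =>
    match l with
    | Sum.inl l => code p (fun l => emb (Sum.inl l)) (emb (Sum.inr (entry q))) l
    | Sum.inr l => code q (fun l => emb (Sum.inr l)) exit l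
  | cases i f, emb, exit, l =>
    match l with
    | none => .peek (some i) (fun _ o => o)
        (.goto fun v => emb (some ⟨v, entry (f v)⟩))
    | some ⟨o, l⟩ => code (f o) (fun l => emb (some ⟨o, l⟩)) exit l
  | loop i p, emb, exit, l =>
    match l with
    | none => .peek (some i) (fun _ o => o)
        (.goto fun v => if v.isSome then emb (some (entry p)) else exit)
    | some l => code p (fun l => emb (some l)) (emb none) l

/-- The stacks of the machine that correspond to a state of the registers. -/
def stk (s : ι → List Sym) (out : List Bool) : ∀ k, List (Alphabet ι k)
  | none => out
  | some i => s i

open Classical in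
theorem update_stk (s : ι → List Sym) (out : List Bool) (i : ι) (l : List Sym) :
    Function.update (stk s out) (some i) l = stk (Function.update s i l) out := by
  funext k
  cases k with
  | none => simp [stk]
  | some j =>
    by_cases h : j = i
    · subst h; simp [stk]
    · rw [Function.update_of_ne (by simpa using h)]
      simp [stk, h]

open Classical in
/-- The machine `M` goes from `a` to `b` in exactly `n` steps. -/
def Steps {Λ : Type} (M : Λ → TM2.Stmt (Alphabet ι) Λ (Option Sym)) (n : ℕ)
    (a b : TM2.Cfg (Alphabet ι) Λ (Option Sym)) : Prop :=
  (flip bind (TM2.step M))^[n] (some a) = some b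

theorem Steps.trans {Λ : Type} {M : Λ → TM2.Stmt (Alphabet ι) Λ (Option Sym)} {n m : ℕ}
    {a b c : TM2.Cfg (Alphabet ι) Λ (Option Sym)} (h : Steps M n a b) (h' : Steps M m b c) :
    Steps M (n + m) a c := by
  unfold Steps at *
  rw [Nat.add_comm, Function.iterate_add_apply, h, h']

open Classical in
theorem Steps.single {Λ : Type} {M : Λ → TM2.Stmt (Alphabet ι) Λ (Option Sym)}
    {a b : TM2.Cfg (Alphabet ι) Λ (Option Sym)} (h : TM2.step M a = some b) :
    Steps M 1 a b := h

/-- Induction on the execution. Embedding, exit label and internal state are arbitrary because a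
program is compiled as a part of a larger machine, and a loop body is re-entered with whatever
symbol the last peek has left. The number of steps is preserved exactly. -/
theorem steps_of_exec {p : Prog ι} {s s' : ι → List Sym} {t : ℕ} (h : Exec p s t s') :
    ∀ {Λ : Type} (M : Λ → TM2.Stmt (Alphabet ι) Λ (Option Sym)) (emb : Lab p → Λ) (exit : Λ)
      (_ : ∀ l, M (emb l) = code p emb exit l) (v : Option Sym) (out : List Bool),
      ∃ v', Steps M t ⟨some (emb (entry p)), v, stk s out⟩ ⟨some exit, v', stk s' out⟩ := by
  classical
  induction h with
  | skip s =>
    intro Λ M emb exit hM v out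
    refine ⟨v, Steps.single ?_⟩
    simp only [TM2.step, hM, code, TM2.stepAux]
  | push s i b =>
    intro Λ M emb exit hM v out
    refine ⟨v, Steps.single ?_⟩
    simp only [TM2.step, hM, code, TM2.stepAux]
    rw [← update_stk]; rfl
  | pop s i =>
    intro Λ M emb exit hM v out
    refine ⟨v, Steps.single ?_⟩
    simp only [TM2.step, hM, code, TM2.stepAux]
    rw [← update_stk]; rfl
  | seq hp hq ihp ihq =>
    intro Λ M emb exit hM v out
    obtain ⟨v₁, h₁⟩ := ihp M (fun l => emb (Sum.inl l)) _ (fun l => hM (Sum.inl l)) v out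
    obtain ⟨v₂, h₂⟩ := ihq M (fun l => emb (Sum.inr l)) _ (fun l => hM (Sum.inr l)) v₁ out
    exact ⟨v₂, h₁.trans h₂⟩
  | @cases i f s t s' h ih =>
    intro Λ M emb exit hM v out
    obtain ⟨v₁, h₁⟩ := ih M (fun l => emb (some ⟨_, l⟩)) exit
      (fun l => hM (some ⟨_, l⟩)) (s i).head? out
    refine ⟨v₁, ?_⟩
    rw [Nat.add_comm]
    refine Steps.trans (Steps.single ?_) h₁
    simp only [TM2.step]
    rw [hM]
    rfl
  | @loop_nil i p s h =>
    intro Λ M emb exit hM v out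
    refine ⟨none, Steps.single ?_⟩
    simp only [TM2.step]
    rw [hM]
    simp [code, entry, stk, h]
  | @loop_cons i p s t s' t' s'' h hp hl ihp ihl =>
    intro Λ M emb exit hM v out
    obtain ⟨v₁, h₁⟩ := ihp M (fun l => emb (some l)) (emb none)
      (fun l => hM (some l)) (s i).head? out
    obtain ⟨v₂, h₂⟩ := ihl M emb exit hM v₁ out
    refine ⟨v₂, ?_⟩
    rw [Nat.add_comm t 1]
    refine Steps.trans (Steps.trans (Steps.single ?_) h₁) h₂
    simp only [TM2.step]
    rw [hM]
    obtain ⟨b, l, hb⟩ := List.exists_cons_of_ne_nil h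
    simp [code, entry, stk, hb]

/-- Renaming of registers. -/
def map {ι' : Type} (e : ι → ι') : Prog ι → Prog ι'
  | skip => skip
  | push i b => push (e i) b
  | pop i => pop (e i)
  | seq p q => seq (map e p) (map e q)
  | cases i f => cases (e i) fun o => map e (f o)
  | loop i p => loop (e i) (map e p)

end Prog

theorem Exec.exists_map {ι ι' : Type} {e : ι → ι'} (he : Function.Injective e) {p : Prog ι}
    {s s' : ι → List Sym} {t : ℕ} (h : Exec p s t s') :
    ∀ S : ι' → List Sym, (∀ i, S (e i) = s i) →
      ∃ S', Exec (p.map e) S t S' ∧ (∀ i, S' (e i) = s' i) ∧ ∀ j, (∀ i, e i ≠ j) → S' j = S j := by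
  classical
  induction h with
  | skip s => exact fun S hS => ⟨S, .skip _, hS, fun _ _ => rfl⟩
  | push s i b =>
    refine fun S hS => ⟨_, .push _ _ _, fun j => ?_, fun j hj => ?_⟩
    · by_cases h : j = i
      · subst h; simp [hS]
      · simp [h, he.eq_iff, hS]
    · simp [(hj i).symm]
  | pop s i =>
    refine fun S hS => ⟨_, .pop _ _, fun j => ?_, fun j hj => ?_⟩
    · by_cases h : j = i
      · subst h; simp [hS]
      · simp [h, he.eq_iff, hS]
    · simp [(hj i).symm]
  | seq hp hq ihp ihq =>
    intro S hS
    obtain ⟨S₁, h₁, h₁', h₁''⟩ := ihp S hS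
    obtain ⟨S₂, h₂, h₂', h₂''⟩ := ihq S₁ h₁'
    exact ⟨S₂, .seq h₁ h₂, h₂', fun j hj => by rw [h₂'' j hj, h₁'' j hj]⟩
  | cases h ih =>
    intro S hS
    obtain ⟨S₁, h₁, h₁', h₁''⟩ := ih S hS
    exact ⟨S₁, .cases (by rw [hS]; exact h₁), h₁', h₁''⟩
  | loop_nil h =>
    intro S hS
    exact ⟨S, .loop_nil (by rw [hS]; exact h), hS, fun _ _ => rfl⟩
  | loop_cons h hp hl ihp ihl =>
    intro S hS
    obtain ⟨S₁, h₁, h₁', h₁''⟩ := ihp S hS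
    obtain ⟨S₂, h₂, h₂', h₂''⟩ := ihl S₁ h₁'
    exact ⟨S₂, .loop_cons (by rw [hS]; exact h) h₁ h₂, h₂',
      fun j hj => by rw [h₂'' j hj, h₁'' j hj]⟩

/-- Runs a subprogram on some registers of a larger machine. The final state S' is supplied by the
caller, so that only pointwise conditions remain to be checked. -/
theorem Exec.map {ι ι' : Type} {e : ι → ι'} (he : Function.Injective e) {p : Prog ι}
    {s s' : ι → List Sym} {t : ℕ} (h : Exec p s t s') {S S' : ι' → List Sym}
    (hS : ∀ i, S (e i) = s i) (hS' : ∀ i, S' (e i) = s' i)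
    (hfix : ∀ j, (∀ i, e i ≠ j) → S' j = S j) : Exec (p.map e) S t S' := by
  obtain ⟨T, hT, hT', hT''⟩ := h.exists_map he S hS
  convert hT using 1
  funext j
  by_cases hj : ∃ i, e i = j
  · obtain ⟨i, rfl⟩ := hj
    rw [hS', hT']
  · push Not at hj
    rw [hfix j hj, hT'' j hj]

/-- A step pushes at most one symbol. Hence running time bounds output size, which is what lets
polynomial time bounds compose. -/
theorem Exec.sum_length_le {ι : Type} [Fintype ι] {p : Prog ι} {s s' : ι → List Sym} {t : ℕ}
    (h : Exec p s t s') : ∑ i, (s' i).length ≤ ∑ i, (s i).length + t := by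
  classical
  have key : ∀ (s : ι → List Sym) (i : ι) (l : List Sym), l.length ≤ (s i).length + 1 →
      ∑ j, (Function.update s i l j).length ≤ ∑ j, (s j).length + 1 := by
    intro s i l hl
    rw [← Finset.add_sum_erase _ _ (Finset.mem_univ i),
      ← Finset.add_sum_erase _ (fun j => (s j).length) (Finset.mem_univ i),
      Finset.sum_congr rfl (g := fun j => (s j).length)]
    · simp; omega
    · intro j hj
      rw [Function.update_of_ne (Finset.ne_of_mem_erase hj)]
  induction h with
  | skip s => simp
  | push s i b => exact le_trans (le_of_eq (by congr!)) (key s i (b :: s i) (by simp))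
  | pop s i => exact le_trans (le_of_eq (by congr!)) (key s i (s i).tail (by simp; omega))
  | seq hp hq ihp ihq => omega
  | cases h ih => omega
  | loop_nil h => omega
  | loop_cons h hp hl ihp ihl => omega

theorem Exec.loop_cons' {ι : Type} {i : ι} {p : Prog ι} {s s' s'' : ι → List Sym} {t t' t'' : ℕ}
    (h : s i ≠ []) (hp : Exec p s t s') (hl : Exec (.loop i p) s' t' s'')
    (ht : t'' = t + 1 + t') : Exec (.loop i p) s t'' s'' := ht ▸ Exec.loop_cons h hp hl

end PolyTime

/-! ### Functions computable in polynomial time by register programs -/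

namespace PolyTime

open Polynomial

theorem eval_mono (p : ℕ[X]) {m n : ℕ} (h : m ≤ n) : p.eval m ≤ p.eval n := by
  induction p using Polynomial.induction_on' with
  | add p q hp hq => simpa using add_le_add hp hq
  | monomial k a => simpa using Nat.mul_le_mul_left a (Nat.pow_le_pow_left h k)

/-- A type whose elements are stored in finitely many registers. -/
class Reg (α : Type) where
  ι : Type
  [fin : Fintype ι]
  enc : α → ι → List Sym

attribute [reducible] Reg.fin
attribute [instance] Reg.fin

/-- A type whose elements are stored in a single register. -/
class Reg1 (α : Type) where
  enc1 : α → List Sym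

open Reg Reg1

instance Reg1.toReg {α : Type} [Reg1 α] : Reg α := ⟨Unit, fun a _ => enc1 a⟩

instance Reg.prod {α β : Type} [Reg α] [Reg β] : Reg (α × β) :=
  ⟨ι α ⊕ ι β, fun a => Sum.elim (enc a.1) (enc a.2)⟩

instance : Reg1 Bool := ⟨fun b => [some b]⟩
instance : Reg1 ℕ := ⟨fun n => List.replicate n (some true)⟩
instance : Reg1 (List Bool) := ⟨fun l => l.map some⟩
instance : Reg1 (List Sym) := ⟨fun l => l⟩

/-- The number of symbols used to store an element. -/
def size {α : Type} [Reg α] (a : α) : ℕ := ∑ i, (enc a i).length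

theorem size_prod {α β : Type} [Reg α] [Reg β] (a : α × β) : size a = size a.1 + size a.2 := by
  simp only [size]
  exact Fintype.sum_sum_type _

theorem size_reg1 {α : Type} [Reg1 α] (a : α) : size a = (enc1 a).length := by
  change ∑ _i : Unit, (enc1 a).length = _
  simp

theorem size_nat (n : ℕ) : size n = n := by simp [size_reg1, enc1]
theorem size_bool (b : Bool) : size b = 1 := by simp [size_reg1, enc1]
theorem size_list (l : List Bool) : size l = l.length := by simp [size_reg1, enc1]
theorem size_raw (l : List Sym) : size l = l.length := by simp [size_reg1, enc1]

theorem length_enc_le {α : Type} [Reg α] (a : α) (i : ι α) : (enc a i).length ≤ size a :=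
  Finset.single_le_sum (f := fun i => (enc a i).length) (fun _ _ => Nat.zero_le _)
    (Finset.mem_univ i)

/-- The state in which all registers are empty. -/
abbrev noReg {κ : Type} : κ → List Sym := fun _ => []

/-- A state that consists of three groups of registers. -/
abbrev st {ι₁ ι₂ κ : Type} (x : ι₁ → List Sym) (y : ι₂ → List Sym) (z : κ → List Sym) :
    ι₁ ⊕ ι₂ ⊕ κ → List Sym := Sum.elim x (Sum.elim y z)

/-- `f` is computable in polynomial time: a program with additional registers `κ` writes `f a`
to the output registers, keeps the input, and leaves the additional registers empty. -/
def PT {α β : Type} [Reg α] [Reg β] (f : α → β) : Prop :=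
  ∃ (κ : Type) (_ : Finite κ) (P : Prog (ι α ⊕ ι β ⊕ κ)) (p : ℕ[X]), ∀ a, ∃ t ≤ p.eval (size a),
    Exec P (st (enc a) noReg noReg) t (st (enc a) (enc (f a)) noReg)

variable {α β γ δ : Type} [Reg α] [Reg β] [Reg γ] [Reg δ]

theorem PT.size_le {f : α → β} (hf : PT f) : ∃ q : ℕ[X], ∀ a, size (f a) ≤ q.eval (size a) := by
  obtain ⟨κ, _, P, p, h⟩ := hf
  have := Fintype.ofFinite κ
  refine ⟨X + p, fun a => ?_⟩
  obtain ⟨t, ht, hE⟩ := h a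
  have := hE.sum_length_le
  simp only [Fintype.sum_sum_type, Sum.elim_inl, Sum.elim_inr, List.length_nil,
    Finset.sum_const_zero] at this
  simp only [eval_add, eval_X]
  change ∑ i, (enc (f a) i).length ≤ (∑ i, (enc a i).length) + _
  change _ ≤ eval (size a) p at ht
  omega

/-! #### Copying and clearing registers -/

/-- Copies register `0` to register `1`, using the empty register `2`. -/
def copy3 : Prog (Fin 3) :=
  .seq (.loop 0 (.cases 0 fun o => o.elim .skip fun b => .seq (.pop 0) (.push 2 b)))
    (.loop 2 (.cases 2 fun o => o.elim .skip fun b => .seq (.pop 2) (.seq (.push 0 b) (.push 1 b))))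

theorem exec_copy3 (l : List Sym) : Exec copy3 ![l, [], []] (9 * l.length + 2) ![l, l, []] := by
  -- Per symbol, draining into register 2 costs 4 steps and refilling costs 5, counting loop test,
  -- case distinction, pops and pushes; this is the constant 9. The two reversals cancel.
  have h₁ : ∀ l m : List Sym, Exec (.loop 0 (.cases 0 fun o => o.elim .skip fun b =>
      .seq (.pop 0) (.push 2 b))) ![l, [], m] (4 * l.length + 1) ![[], [], l.reverse ++ m] := by
    intro l
    induction l with
    | nil => exact fun m => .loop_nil rfl
    | cons b l ih =>
      intro m
      have := ih (b :: m)
      refine .loop_cons' (t := 3) (by simp) (.cases (.seq (.pop _ _) (.push _ _ _))) ?_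
        (t' := 4 * l.length + 1) (by simp; ring)
      convert this using 1
      · funext i; fin_cases i <;> simp [Function.update]
      · simp
  have h₂ : ∀ m l x : List Sym, Exec (.loop 2 (.cases 2 fun o => o.elim .skip fun b =>
      .seq (.pop 2) (.seq (.push 0 b) (.push 1 b)))) ![l, x, m] (5 * m.length + 1)
      ![m.reverse ++ l, m.reverse ++ x, []] := by
    intro m
    induction m with
    | nil => exact fun l x => .loop_nil rfl
    | cons b m ih =>
      intro l x
      have := ih (b :: l) (b :: x)
      refine .loop_cons' (t := 4) (by simp)
        (.cases (.seq (.pop _ _) (.seq (.push _ _ _) (.push _ _ _)))) ?_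
        (t' := 5 * m.length + 1) (by simp; ring)
      convert this using 1
      · funext i; fin_cases i <;> simp [Function.update]
      · simp
  have := Exec.seq (h₁ l []) (h₂ (l.reverse ++ []) [] [])
  simp only [List.append_nil, List.reverse_reverse, List.length_reverse] at this
  rw [show 9 * l.length + 2 = 4 * l.length + 1 + (5 * l.length + 1) by ring]
  exact this

/-- Copies the registers `e j`, `j ∈ js`, to the registers `j`. -/
def copyList {ι₁ ι₂ : Type} (e : ι₂ → ι₁) : List ι₂ → Prog (ι₁ ⊕ ι₂ ⊕ Unit)
  | [] => .skip
  | j :: js => .seq (copy3.map ![.inl (e j), .inr (.inl j), .inr (.inr ())]) (copyList e js)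

open Classical in
theorem exec_copyList {ι₁ ι₂ : Type} (e : ι₂ → ι₁) (x : ι₁ → List Sym) (N : ℕ)
    (hN : ∀ i, (x i).length ≤ N) : ∀ (js : List ι₂), js.Nodup → ∀ y : ι₂ → List Sym,
    (∀ j ∈ js, y j = []) → ∃ t ≤ js.length * (9 * N + 2) + 1,
      Exec (copyList e js) (st x y noReg) t
        (st x (fun j => if j ∈ js then x (e j) else y j) noReg)
  | [], _, y, _ => ⟨1, by simp, by simpa [copyList] using Exec.skip (st x y noReg)⟩
  | j :: js, hjs, y, hy => by
    obtain ⟨hj, hjs⟩ := List.nodup_cons.1 hjs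
    obtain ⟨t, ht, hE⟩ := exec_copyList e x N hN js hjs (Function.update y j (x (e j)))
      fun i hi => by
        rw [Function.update_of_ne (by rintro rfl; exact hj hi)]
        exact hy i (by simp [hi])
    have hS : (fun i => if i ∈ js then x (e i) else Function.update y j (x (e j)) i) =
        fun i => if i ∈ j :: js then x (e i) else y i := by
      funext i
      by_cases h : i = j
      · subst h; simp
      · simp [h]
    rw [hS] at hE
    refine ⟨(9 * (x (e j)).length + 2) + t, ?_,
      .seq (Exec.map ?_ (exec_copy3 (x (e j))) ?_ ?_ ?_) hE⟩
    · have := hN (e j)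
      simp only [List.length_cons]
      nlinarith
    · intro a b
      fin_cases a <;> fin_cases b <;> simp
    · intro i
      fin_cases i <;> simp [hy]
    · intro i
      fin_cases i <;> simp
    · intro i hi
      have h1 := hi 1
      rcases i with i | i | i
      · rfl
      · simp at h1
        simp [Ne.symm h1]
      · rfl

theorem exec_copy {ι₁ ι₂ : Type} [Fintype ι₂] (e : ι₂ → ι₁) (x : ι₁ → List Sym) (N : ℕ)
    (hN : ∀ i, (x i).length ≤ N) : ∃ t ≤ Fintype.card ι₂ * (9 * N + 2) + 1,
      Exec (copyList e (Finset.univ : Finset ι₂).toList) (st x noReg noReg) t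
        (st x (fun j => x (e j)) noReg) := by
  classical
  obtain ⟨t, ht, hE⟩ := exec_copyList e x N hN (Finset.univ : Finset ι₂).toList
    (Finset.nodup_toList _) noReg fun _ _ => rfl
  exact ⟨t, by simpa using ht, by simpa using hE⟩

/-- Clears the registers in a list. -/
def clearList {ι₁ : Type} : List ι₁ → Prog ι₁
  | [] => .skip
  | j :: js => .seq (.loop j (.pop j)) (clearList js)

open Classical in
theorem exec_clearLoop {ι₁ : Type} (j : ι₁) : ∀ (l : List Sym) (s : ι₁ → List Sym), s j = l →
    Exec (.loop j (.pop j)) s (2 * l.length + 1) (Function.update s j [])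
  | [], s, h => by
    rw [show Function.update s j [] = s by rw [← h, Function.update_eq_self]]
    exact .loop_nil h
  | b :: l, s, h => by
    have := exec_clearLoop j l (Function.update s j l) (by simp)
    refine .loop_cons' (by simp [h]) (.pop _ _) ?_ (t' := 2 * l.length + 1) (by simp; ring)
    convert this using 1
    · simp [h]
    · simp

open Classical in
theorem exec_clearList {ι₁ : Type} (N : ℕ) : ∀ (js : List ι₁) (x : ι₁ → List Sym),
    (∀ i, (x i).length ≤ N) → ∃ t ≤ js.length * (2 * N + 1) + 1,
      Exec (clearList js) x t (fun j => if j ∈ js then [] else x j)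
  | [], x, _ => ⟨1, by simp, by simpa [clearList] using Exec.skip x⟩
  | j :: js, x, hN => by
    obtain ⟨t, ht, hE⟩ := exec_clearList N js (Function.update x j []) fun i => by
      by_cases h : i = j
      · subst h; simp
      · simpa [h] using hN i
    have hS : (fun i => if i ∈ js then [] else Function.update x j [] i) =
        fun i => if i ∈ j :: js then [] else x i := by
      funext i
      by_cases h : i = j
      · subst h; simp
      · simp [h]
    rw [hS] at hE
    refine ⟨_ + t, ?_, .seq (exec_clearLoop j _ x rfl) hE⟩
    have := hN j
    simp only [List.length_cons]
    nlinarith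

/-- Clears all registers. -/
noncomputable def clearAll (ι₁ : Type) [Fintype ι₁] : Prog ι₁ := clearList Finset.univ.toList

theorem exec_clearAll {ι₁ : Type} [Fintype ι₁] (N : ℕ) (x : ι₁ → List Sym)
    (hN : ∀ i, (x i).length ≤ N) :
    ∃ t ≤ Fintype.card ι₁ * (2 * N + 1) + 1, Exec (clearAll ι₁) x t noReg := by
  classical
  obtain ⟨t, ht, hE⟩ := exec_clearList N (Finset.univ : Finset ι₁).toList x hN
  exact ⟨t, by simpa using ht, by simpa [clearAll] using hE⟩

/-! #### Closure properties -/

theorem PT.of_copy {f : α → β} (e : ι β → ι α) (h : ∀ a j, enc (f a) j = enc a (e j)) : PT f := by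
  refine ⟨Unit, inferInstance, copyList e Finset.univ.toList,
    C (Fintype.card (ι β)) * (9 * X + 2) + 1, fun a => ?_⟩
  obtain ⟨t, ht, hE⟩ := exec_copy e (enc a) (size a) (length_enc_le a)
  refine ⟨t, by simpa using ht, ?_⟩
  convert hE using 3
  exact h a _

theorem PT.id : PT (fun a : α => a) := .of_copy (fun j => j) fun _ _ => rfl
theorem PT.fst : PT (fun a : α × β => a.1) := .of_copy Sum.inl fun _ _ => rfl
theorem PT.snd : PT (fun a : α × β => a.2) := .of_copy Sum.inr fun _ _ => rfl

/-- The intermediate value lives in auxiliary registers and is erased at the end. Its size, which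
governs the time of the second program, is polynomial by `PT.size_le`. -/
theorem PT.comp {g : β → γ} {f : α → β} (hg : PT g) (hf : PT f) : PT (fun a => g (f a)) := by
  obtain ⟨q, hq⟩ := hf.size_le
  obtain ⟨κ₁, _, P₁, p₁, h₁⟩ := hf
  obtain ⟨κ₂, _, P₂, p₂, h₂⟩ := hg
  let e₁ : ι α ⊕ ι β ⊕ κ₁ → ι α ⊕ ι γ ⊕ (ι β ⊕ κ₁ ⊕ κ₂) :=
    Sum.elim .inl (Sum.elim (fun i => .inr (.inr (.inl i))) fun i => .inr (.inr (.inr (.inl i))))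
  let e₂ : ι β ⊕ ι γ ⊕ κ₂ → ι α ⊕ ι γ ⊕ (ι β ⊕ κ₁ ⊕ κ₂) :=
    Sum.elim (fun i => .inr (.inr (.inl i)))
      (Sum.elim (fun i => .inr (.inl i)) fun i => .inr (.inr (.inr (.inr i))))
  let e₃ : ι β → ι α ⊕ ι γ ⊕ (ι β ⊕ κ₁ ⊕ κ₂) := fun i => .inr (.inr (.inl i))
  refine ⟨ι β ⊕ κ₁ ⊕ κ₂, inferInstance,
    .seq (P₁.map e₁) (.seq (P₂.map e₂) ((clearAll (ι β)).map e₃)),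
    p₁ + (p₂.comp q + (C (Fintype.card (ι β)) * (2 * q + 1) + 1)), fun a => ?_⟩
  obtain ⟨t₁, ht₁, hE₁⟩ := h₁ a
  obtain ⟨t₂, ht₂, hE₂⟩ := h₂ (f a)
  obtain ⟨t₃, ht₃, hE₃⟩ := exec_clearAll (size (f a)) (enc (f a)) (length_enc_le (f a))
  refine ⟨t₁ + (t₂ + t₃), ?_, .seq (Exec.map (S' := st (enc a) noReg (st (enc (f a)) noReg noReg))
    ?_ hE₁ ?_ ?_ ?_) (.seq
    (Exec.map (S' := st (enc a) (enc (g (f a))) (st (enc (f a)) noReg noReg)) ?_ hE₂ ?_ ?_ ?_)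
    (Exec.map ?_ hE₃ ?_ ?_ ?_))⟩
  · have h := eval_mono p₂ (hq a)
    have h' := Nat.mul_le_mul_left (Fintype.card (ι β)) (Nat.mul_le_mul_left 2 (hq a))
    simp only [eval_add, eval_mul, eval_comp, eval_C, eval_one, eval_ofNat]
    nlinarith
  · rintro (i | i | i) (j | j | j) h <;> simp_all [e₁]
  · rintro (i | i | i) <;> rfl
  · rintro (i | i | i) <;> rfl
  · rintro (i | i | i | i | i) h <;> first | rfl | exact absurd rfl (h (.inr (.inl i)))
  · rintro (i | i | i) (j | j | j) h <;> simp_all [e₂]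
  · rintro (i | i | i) <;> rfl
  · rintro (i | i | i) <;> rfl
  · rintro (i | i | i | i | i) h <;> first | rfl | exact absurd rfl (h (.inr (.inl i)))
  · intro i j h; simpa [e₃] using h
  · intro i; rfl
  · intro i; rfl
  · rintro (i | i | i | i | i) h <;> first | rfl | exact absurd rfl (h i)

theorem PT.pair {f : α → β} {g : α → γ} (hf : PT f) (hg : PT g) : PT (fun a => (f a, g a)) := by
  obtain ⟨κ₁, _, P₁, p₁, h₁⟩ := hf
  obtain ⟨κ₂, _, P₂, p₂, h₂⟩ := hg
  let e₁ : ι α ⊕ ι β ⊕ κ₁ → ι α ⊕ (ι β ⊕ ι γ) ⊕ (κ₁ ⊕ κ₂) :=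
    Sum.elim .inl (Sum.elim (fun i => .inr (.inl (.inl i))) fun i => .inr (.inr (.inl i)))
  let e₂ : ι α ⊕ ι γ ⊕ κ₂ → ι α ⊕ (ι β ⊕ ι γ) ⊕ (κ₁ ⊕ κ₂) :=
    Sum.elim .inl (Sum.elim (fun i => .inr (.inl (.inr i))) fun i => .inr (.inr (.inr i)))
  refine ⟨κ₁ ⊕ κ₂, inferInstance, .seq (P₁.map e₁) (P₂.map e₂), p₁ + p₂, fun a => ?_⟩
  obtain ⟨t₁, ht₁, hE₁⟩ := h₁ a
  obtain ⟨t₂, ht₂, hE₂⟩ := h₂ a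
  refine ⟨t₁ + t₂, ?_, .seq (Exec.map
    (S' := st (enc a) (Sum.elim (enc (f a)) noReg) (Sum.elim noReg noReg)) ?_ hE₁ ?_ ?_ ?_)
    (Exec.map ?_ hE₂ ?_ ?_ ?_)⟩
  · simp only [eval_add]; omega
  · rintro (i | i | i) (j | j | j) h <;> simp_all [e₁]
  · rintro (i | i | i) <;> rfl
  · rintro (i | i | i) <;> rfl
  · rintro (i | (i | i) | i | i) h <;> first | rfl | exact absurd rfl (h (.inr (.inl i)))
  · rintro (i | i | i) (j | j | j) h <;> simp_all [e₂]
  · rintro (i | i | i) <;> rfl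
  · rintro (i | i | i) <;> rfl
  · rintro (i | (i | i) | i | i) h <;> first | rfl | exact absurd rfl (h (.inr (.inl i)))

open Classical in
theorem PT.ite {c : α → Bool} {f g : α → β} (hc : PT c) (hf : PT f) (hg : PT g) :
    PT (fun a => if c a then f a else g a) := by
  obtain ⟨κ₀, _, P₀, p₀, h₀⟩ := hc
  obtain ⟨κ₁, _, P₁, p₁, h₁⟩ := hf
  obtain ⟨κ₂, _, P₂, p₂, h₂⟩ := hg
  let e₀ : ι α ⊕ Unit ⊕ κ₀ → ι α ⊕ ι β ⊕ (Unit ⊕ κ₀ ⊕ κ₁ ⊕ κ₂) :=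
    Sum.elim .inl (Sum.elim (fun i => .inr (.inr (.inl i))) fun i => .inr (.inr (.inr (.inl i))))
  let e₁ : ι α ⊕ ι β ⊕ κ₁ → ι α ⊕ ι β ⊕ (Unit ⊕ κ₀ ⊕ κ₁ ⊕ κ₂) :=
    Sum.elim .inl (Sum.elim (fun i => .inr (.inl i)) fun i => .inr (.inr (.inr (.inr (.inl i)))))
  let e₂ : ι α ⊕ ι β ⊕ κ₂ → ι α ⊕ ι β ⊕ (Unit ⊕ κ₀ ⊕ κ₁ ⊕ κ₂) :=
    Sum.elim .inl (Sum.elim (fun i => .inr (.inl i)) fun i => .inr (.inr (.inr (.inr (.inr i)))))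
  refine ⟨Unit ⊕ κ₀ ⊕ κ₁ ⊕ κ₂, inferInstance,
    -- The bit of the condition is popped before either branch runs, so that the branches start and
    -- end with empty auxiliary registers.
    .seq (P₀.map e₀) (.cases (.inr (.inr (.inl ()))) fun o => .seq (.pop (.inr (.inr (.inl ()))))
      (if o = some (some true) then P₁.map e₁ else P₂.map e₂)),
    p₀ + (p₁ + p₂ + 2), fun a => ?_⟩
  obtain ⟨t₀, ht₀, hE₀⟩ := h₀ a
  obtain ⟨t₁, ht₁, hE₁⟩ := h₁ a
  obtain ⟨t₂, ht₂, hE₂⟩ := h₂ a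
  have H₀ : Exec (P₀.map e₀) (st (enc a) (noReg : ι β → _) noReg) t₀
      (st (enc a) noReg (st (enc (c a)) noReg noReg)) := by
    refine Exec.map ?_ hE₀ ?_ ?_ ?_
    · rintro (i | i | i) (j | j | j) h <;> simp_all [e₀]
    · rintro (i | i | i) <;> rfl
    · rintro (i | i | i) <;> rfl
    · rintro (i | i | i | i | i | i) h <;> first | rfl | exact absurd rfl (h (.inr (.inl i)))
  have H₁ : Exec (P₁.map e₁) (st (enc a) noReg (st noReg noReg noReg)) t₁
      (st (enc a) (enc (f a)) (st noReg noReg noReg)) := by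
    refine Exec.map ?_ hE₁ ?_ ?_ ?_
    · rintro (i | i | i) (j | j | j) h <;> simp_all [e₁]
    · rintro (i | i | i) <;> rfl
    · rintro (i | i | i) <;> rfl
    · rintro (i | i | i | i | i | i) h <;> first | rfl | exact absurd rfl (h (.inr (.inl i)))
  have H₂ : Exec (P₂.map e₂) (st (enc a) noReg (st noReg noReg noReg)) t₂
      (st (enc a) (enc (g a)) (st noReg noReg noReg)) := by
    refine Exec.map ?_ hE₂ ?_ ?_ ?_
    · rintro (i | i | i) (j | j | j) h <;> simp_all [e₂]
    · rintro (i | i | i) <;> rfl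
    · rintro (i | i | i) <;> rfl
    · rintro (i | i | i | i | i | i) h <;> first | rfl | exact absurd rfl (h (.inr (.inl i)))
  have hnil : (st noReg noReg noReg : Unit ⊕ κ₀ ⊕ (κ₁ ⊕ κ₂) → List Sym) = noReg := by
    funext i; rcases i with i | i | i | i <;> rfl
  have hpop : Function.update (st (enc a) (noReg : ι β → _)
      (st (enc (c a)) (noReg : κ₀ → _) (noReg : κ₁ ⊕ κ₂ → _))) (.inr (.inr (.inl ()))) [] =
      st (enc a) noReg (st noReg noReg noReg) := by
    funext i
    rcases i with i | i | i | i | i <;> first | rfl | exact Function.update_self ..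
  have key : ∀ b t, c a = b → Exec (if b then P₁.map e₁ else P₂.map e₂)
      (st (enc a) noReg (st noReg noReg noReg)) t
      (st (enc a) (enc (if c a then f a else g a)) (st noReg noReg noReg)) →
      Exec (.cases (.inr (.inr (.inl ()))) fun o => .seq (.pop (.inr (.inr (.inl ()))))
      (if o = some (some true) then P₁.map e₁ else P₂.map e₂))
      (st (enc a) noReg (st (enc (c a)) noReg noReg)) (1 + t + 1)
      (st (enc a) (enc (if c a then f a else g a)) noReg) := by
    intro b t hb hE
    refine .cases (.seq (.pop _ _) ?_)
    convert hE using 1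
    · subst hb; cases c a <;> simp [enc, enc1]
    · refine Eq.trans ?_ hpop
      congr!
    · rw [hnil]
  by_cases hb : c a = true
  · refine ⟨t₀ + (1 + t₁ + 1), ?_, .seq H₀ (key true t₁ hb (by simpa [hb] using H₁))⟩
    simp only [eval_add, eval_ofNat]; omega
  · refine ⟨t₀ + (1 + t₂ + 1), ?_, .seq H₀ (key false t₂ (by simpa using hb)
      (by simpa [hb] using H₂))⟩
    simp only [eval_add, eval_ofNat]; omega

end PolyTime

/-! ### Bounded iteration, primitive functions, and Turing machines -/

namespace PolyTime

open Polynomial Reg Reg1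

variable {α β γ δ : Type} [Reg α] [Reg β] [Reg γ] [Reg δ]

-- The counter register is filled with the code of `n a` and loses one symbol per round. The bound
-- `q` on all iterates is essential: a polynomial-time step may double the size, and then its
-- iterates grow exponentially.
open Classical in
theorem PT.iterate {ν : Type} [Reg1 ν] {n : α → ν} {init : α → β} {step : α × β → β} (hn : PT n) (hinit : PT init)
    (hstep : PT step) (q : ℕ[X])
    (hq : ∀ a i, i ≤ (enc1 (n a)).length → size ((fun b => step (a, b))^[i] (init a)) ≤ q.eval (size a)) :
    PT (fun a => (fun b => step (a, b))^[(enc1 (n a)).length] (init a)) := by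
  obtain ⟨r, hr⟩ := hn.size_le
  obtain ⟨κ₀, _, P₀, p₀, h₀⟩ := hn
  obtain ⟨κ₁, _, P₁, p₁, h₁⟩ := hinit
  obtain ⟨κ₂, _, P₂, p₂, h₂⟩ := hstep
  let e₀ : ι α ⊕ Unit ⊕ κ₀ → ι α ⊕ ι β ⊕ (Unit ⊕ ι β ⊕ κ₀ ⊕ κ₁ ⊕ κ₂ ⊕ Unit) :=
    Sum.elim .inl (Sum.elim (fun i => .inr (.inr (.inl i)))
      fun i => .inr (.inr (.inr (.inr (.inl i)))))
  let e₁ : ι α ⊕ ι β ⊕ κ₁ → ι α ⊕ ι β ⊕ (Unit ⊕ ι β ⊕ κ₀ ⊕ κ₁ ⊕ κ₂ ⊕ Unit) :=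
    Sum.elim .inl (Sum.elim (fun i => .inr (.inl i))
      fun i => .inr (.inr (.inr (.inr (.inr (.inl i))))))
  let e₂ : (ι α ⊕ ι β) ⊕ ι β ⊕ κ₂ → ι α ⊕ ι β ⊕ (Unit ⊕ ι β ⊕ κ₀ ⊕ κ₁ ⊕ κ₂ ⊕ Unit) :=
    Sum.elim (Sum.elim .inl fun i => .inr (.inl i)) (Sum.elim (fun i => .inr (.inr (.inr (.inl i))))
      fun i => .inr (.inr (.inr (.inr (.inr (.inr (.inl i)))))))
  let e₃ : ι β → ι α ⊕ ι β ⊕ (Unit ⊕ ι β ⊕ κ₀ ⊕ κ₁ ⊕ κ₂ ⊕ Unit) := fun i => .inr (.inl i)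
  let e₄ : ι β ⊕ ι β ⊕ Unit → ι α ⊕ ι β ⊕ (Unit ⊕ ι β ⊕ κ₀ ⊕ κ₁ ⊕ κ₂ ⊕ Unit) :=
    Sum.elim (fun i => .inr (.inr (.inr (.inl i)))) (Sum.elim (fun i => .inr (.inl i))
      fun i => .inr (.inr (.inr (.inr (.inr (.inr (.inr i)))))))
  let e₅ : ι β → ι α ⊕ ι β ⊕ (Unit ⊕ ι β ⊕ κ₀ ⊕ κ₁ ⊕ κ₂ ⊕ Unit) := fun i => .inr (.inr (.inr (.inl i)))
  let N : ι α ⊕ ι β ⊕ (Unit ⊕ ι β ⊕ κ₀ ⊕ κ₁ ⊕ κ₂ ⊕ Unit) := .inr (.inr (.inl ()))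
  let S : (ι α → List Sym) → (ι β → List Sym) → (Unit → List Sym) → (ι β → List Sym) →
      ι α ⊕ ι β ⊕ (Unit ⊕ ι β ⊕ κ₀ ⊕ κ₁ ⊕ κ₂ ⊕ Unit) → List Sym := fun x y m y' => st x y (st m y' noReg)
  have hS0 : ∀ x y, S x y noReg noReg = st x y noReg := by
    intro x y
    funext i
    rcases i with i | i | i | i | i <;> rfl
  -- The new value is computed into a second group of registers; then the old value is erased, the
  -- new one copied back, and the second group emptied for the next round.
  let body : Prog (ι α ⊕ ι β ⊕ (Unit ⊕ ι β ⊕ κ₀ ⊕ κ₁ ⊕ κ₂ ⊕ Unit)) := .seq (.pop N) (.seq (P₂.map e₂) (.seq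
    ((clearAll (ι β)).map e₃) (.seq ((copyList (fun i => i) Finset.univ.toList).map e₄)
      ((clearAll (ι β)).map e₅))))
  let B : ℕ[X] := p₂.comp (X + q) + (C (Fintype.card (ι β)) * (2 * q + 1) + 1) +
    (C (Fintype.card (ι β)) * (9 * q + 2) + 1) + (C (Fintype.card (ι β)) * (2 * q + 1) + 1) + 1
  have hbody : ∀ a b c m, size b ≤ q.eval (size a) → size (step (a, b)) ≤ q.eval (size a) →
      ∃ t ≤ B.eval (size a), Exec body (S (enc a) (enc b) (fun _ => c :: m) noReg) t
        (S (enc a) (enc (step (a, b))) (fun _ => m) noReg) := by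
    intro a b c m hb hb'
    obtain ⟨t₂, ht₂, hE₂⟩ := h₂ (a, b)
    obtain ⟨t₃, ht₃, hE₃⟩ := exec_clearAll (size b) (enc b) (length_enc_le b)
    obtain ⟨t₄, ht₄, hE₄⟩ := exec_copy (fun i => i) (enc (step (a, b))) _
      (length_enc_le (step (a, b)))
    obtain ⟨t₅, ht₅, hE₅⟩ := exec_clearAll _ _ (length_enc_le (step (a, b)))
    have hpop : Exec (.pop N) (S (enc a) (enc b) (fun _ => c :: m) noReg) 1
        (S (enc a) (enc b) (fun _ => m) noReg) := by
      have := Exec.pop (S (enc a) (enc b) (fun _ => c :: m) noReg) N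
      convert this using 1
      funext i
      rcases i with i | i | ⟨⟩ | i | i | i | i | i <;>
        simp [S, N]
    refine ⟨1 + (t₂ + (t₃ + (t₄ + t₅))), ?_, .seq hpop (.seq
      (Exec.map (S' := S (enc a) (enc b) (fun _ => m) (enc (step (a, b)))) ?_ hE₂ ?_ ?_ ?_) (.seq
      (Exec.map (S' := S (enc a) noReg (fun _ => m) (enc (step (a, b)))) ?_ hE₃ ?_ ?_ ?_) (.seq
      (Exec.map (S' := S (enc a) (enc (step (a, b))) (fun _ => m) (enc (step (a, b)))) ?_ hE₄ ?_ ?_ ?_)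
      (Exec.map ?_ hE₅ ?_ ?_ ?_))))⟩
    · have h := eval_mono p₂ (m := size (a, b)) (n := size a + q.eval (size a))
        ((size_prod _).le.trans (by dsimp only; omega))
      have h3 := Nat.mul_le_mul_left (Fintype.card (ι β)) (Nat.mul_le_mul_left 2 hb)
      have h4 := Nat.mul_le_mul_left (Fintype.card (ι β)) (Nat.mul_le_mul_left 9 hb')
      have h5 := Nat.mul_le_mul_left (Fintype.card (ι β)) (Nat.mul_le_mul_left 2 hb')
      simp only [B, eval_add, eval_mul, eval_comp, eval_C, eval_one, eval_ofNat, eval_X]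
      nlinarith
    · rintro ((i | i) | i | i) ((j | j) | j | j) h <;> cases h <;> rfl
    · rintro ((i | i) | i | i) <;> rfl
    · rintro ((i | i) | i | i) <;> rfl
    · rintro (i | i | i | i | i) h <;> first | rfl | exact absurd rfl (h (.inr (.inl i)))
    · intro i j h; simpa [e₃] using h
    · intro i; rfl
    · intro i; rfl
    · rintro (i | i | i | i | i) h <;> first | rfl | exact absurd rfl (h i)
    · rintro (i | i | i) (j | j | j) h <;> cases h <;> rfl
    · rintro (i | i | i) <;> rfl
    · rintro (i | i | i) <;> rfl
    · rintro (i | i | i | i | i) h <;> first | rfl | exact absurd rfl (h (.inr (.inl i)))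
    · intro i j h; simpa [e₅] using h
    · intro i; rfl
    · intro i; rfl
    · rintro (i | i | i | i | i) h <;> first | rfl | exact absurd rfl (h i)
  have hloop : ∀ a m i, i + m.length = (enc1 (n a)).length →
      ∃ t ≤ m.length * (B.eval (size a) + 1) + 1, Exec (.loop N body)
      (S (enc a) (enc ((fun b => step (a, b))^[i] (init a))) (fun _ => m) noReg) t
      (S (enc a) (enc ((fun b => step (a, b))^[(enc1 (n a)).length] (init a))) noReg noReg) := by
    intro a m
    induction m with
    | nil =>
      intro i hi
      rw [← hi]
      exact ⟨1, by simp, .loop_nil rfl⟩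
    | cons c m ih =>
      intro i hi
      rw [List.length_cons] at hi
      obtain ⟨t', ht', hE'⟩ := ih (i + 1) (by omega)
      have hb := hq a i (by omega)
      have hb' := hq a (i + 1) (by omega)
      rw [Function.iterate_succ_apply'] at hb' hE'
      obtain ⟨t, ht, hE⟩ := hbody a _ c m hb hb'
      refine ⟨t + 1 + t', by rw [List.length_cons]; nlinarith, .loop_cons ?_ hE hE'⟩
      simp [S, N]
  refine ⟨Unit ⊕ ι β ⊕ κ₀ ⊕ κ₁ ⊕ κ₂ ⊕ Unit, inferInstance, .seq (P₀.map e₀) (.seq (P₁.map e₁) (.loop N body)),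
    p₀ + p₁ + (r * (B + 1) + 1), fun a => ?_⟩
  obtain ⟨t₀, ht₀, hE₀⟩ := h₀ a
  obtain ⟨t₁, ht₁, hE₁⟩ := h₁ a
  obtain ⟨t₂, ht₂, hE₂⟩ := hloop a (enc1 (n a)) 0 (by simp)
  refine ⟨t₀ + (t₁ + t₂), ?_, .seq
    (Exec.map (S' := S (enc a) noReg (enc (n a)) noReg) ?_ hE₀ ?_ ?_ ?_)
    (.seq (Exec.map (S' := S (enc a) (enc (init a)) (enc (n a)) noReg) ?_ hE₁ ?_ ?_ ?_) ?_)⟩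
  · have h := hr a
    rw [size_reg1] at h
    have := Nat.mul_le_mul_right (B.eval (size a) + 1) h
    simp only [eval_add, eval_mul, eval_one]
    omega
  · rintro (i | i | i) (j | j | j) h <;> cases h <;> rfl
  · rintro (i | i | i) <;> rfl
  · rintro (i | i | i) <;> rfl
  · rintro (i | i | i | i | i) h <;> first | rfl | exact absurd rfl (h (.inr (.inl i)))
  · rintro (i | i | i) (j | j | j) h <;> cases h <;> rfl
  · rintro (i | i | i) <;> rfl
  · rintro (i | i | i) <;> rfl
  · rintro (i | i | i | i | i) h <;> first | rfl | exact absurd rfl (h (.inr (.inl i)))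
  · rw [← hS0]
    exact hE₂

/-! #### Primitive functions on single registers -/

theorem PT.const_nil {β' : Type} [Reg1 β'] {f : α → β'} (h : ∀ a, enc1 (f a) = []) : PT f := by
  refine ⟨Empty, inferInstance, .skip, 1, fun a => ⟨1, by simp, ?_⟩⟩
  convert Exec.skip _ using 3
  funext i
  exact h a

-- Only the codes are compared, and `f` and `g` may have different types. This one fact yields
-- Boolean constants, the successor and `cons`.
open Classical in
theorem PT.of_push {β' γ' : Type} [Reg1 β'] [Reg1 γ'] {f : α → β'} {g : α → γ'} (b : Sym)
    (hf : PT f) (h : ∀ a, enc1 (g a) = b :: enc1 (f a)) : PT g := by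
  obtain ⟨κ, _, P, p, hP⟩ := hf
  refine ⟨κ, inferInstance, .seq P (.push (.inr (.inl ())) b), p + 1, fun a => ?_⟩
  obtain ⟨t, ht, hE⟩ := hP a
  refine ⟨t + 1, by simpa using ht, .seq hE ?_⟩
  convert Exec.push _ _ _ using 1
  funext i
  rcases i with i | i | i
  · simp
  · rw [show i = (() : Unit) from rfl]
    simp [enc, h]
  · simp

open Classical in
theorem PT.of_pop {β' γ' : Type} [Reg1 β'] [Reg1 γ'] {f : α → β'} {g : α → γ'}
    (hf : PT f) (h : ∀ a, enc1 (g a) = (enc1 (f a)).tail) : PT g := by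
  obtain ⟨κ, _, P, p, hP⟩ := hf
  refine ⟨κ, inferInstance, .seq P (.pop (.inr (.inl ()))), p + 1, fun a => ?_⟩
  obtain ⟨t, ht, hE⟩ := hP a
  refine ⟨t + 1, by simpa using ht, .seq hE ?_⟩
  convert Exec.pop _ _ using 1
  funext i
  rcases i with i | i | i
  · simp
  · rw [show i = (() : Unit) from rfl]
    simp [enc, h]
  · simp

open Classical in
theorem PT.head {β' : Type} [Reg1 β'] {f : α → β'} (hf : PT f) (h : Option Sym → Bool) :
    PT (fun a => h (enc1 (f a)).head?) := by
  refine PT.comp (g := fun b : β' => h (enc1 b).head?) ?_ hf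
  refine ⟨Empty, inferInstance, .cases (.inl ()) fun o => .push (.inr (.inl ())) (some (h o)),
    2, fun a => ⟨1 + 1, by simp, .cases ?_⟩⟩
  convert Exec.push _ _ _ using 1
  funext i
  rcases i with i | i | i
  · simp
  · rw [show i = (() : Unit) from rfl]
    simp [enc, enc1]
  · simp

/-! #### Turing machines -/

-- A halting configuration has all stacks except the output empty and the internal state reset. So
-- the program is followed by a loop that clears the input and by a statement that moves the answer
-- bit to the output stack.
open Turing Computability in
theorem PT.computable {f : List Sym → Bool} (hf : PT f) {α : Type} (e : α → List Sym) :
    Nonempty (TM2ComputableInPolyTime e encodeBool fun a => f (e a)) := by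
  classical
  obtain ⟨κ, _, P, p, hP⟩ := hf
  have := Fintype.ofFinite κ
  let Q : Prog (Unit ⊕ Unit ⊕ κ) := .seq P (.loop (.inl ()) (.pop (.inl ())))
  have := Q.finite_lab
  have := Fintype.ofFinite Q.Lab
  let tm : FinTM2 :=
    { K := Option (Unit ⊕ Unit ⊕ κ)
      kDecidableEq := @Option.instDecidableEq _ fun a b => Classical.propDecidable (a = b)
      k₀ := some (.inl ())
      k₁ := none
      Γ := Prog.Alphabet _
      Λ := Option Q.Lab
      main := some Q.entry
      σ := Option Sym
      initialState := none
      Γk₀Fin := inferInstanceAs (Fintype (Option Bool))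
      m := fun l => match l with
        | some l => Q.code some none l
        | none => .pop (some (.inr (.inl ()))) (fun _ o => o)
            (.push none (fun v => decide (v = some (some true))) (.load (fun _ => none) .halt)) }
  -- The summand 2X + 2 pays for clearing the input (2|input| + 1 steps) and for the transfer of the
  -- answer.
  have key : ∀ a, ∃ n ≤ (p + (2 * X + 2)).eval (e a).length,
      (flip bind tm.step)^[n] (some (initList tm (e a))) = some (haltList tm [f (e a)]) := by
    intro a
    obtain ⟨t, ht, hE⟩ := hP (e a)
    have hE' : Exec Q (st (enc (e a)) noReg noReg) (t + (2 * (e a).length + 1))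
        (st noReg (enc (f (e a))) noReg) := by
      refine .seq hE ?_
      convert exec_clearLoop (ι₁ := Unit ⊕ Unit ⊕ κ) (.inl ()) (e a)
        (st (enc (e a)) (enc (f (e a))) noReg) rfl using 1
      funext i
      rcases i with ⟨⟩ | i | i <;> simp
    obtain ⟨v, hv⟩ := Prog.steps_of_exec hE' tm.m some none (fun _ => rfl) none []
    have hlast : Prog.Steps tm.m 1 ⟨some none, v, Prog.stk (st noReg (enc (f (e a))) noReg) []⟩
        ⟨none, none, Prog.stk noReg [f (e a)]⟩ := by
      refine Prog.Steps.single ?_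
      simp only [TM2.step, tm, TM2.stepAux, Option.some.injEq, TM2.Cfg.mk.injEq, true_and]
      funext k
      rcases k with _ | i | ⟨⟩ | i <;>
        simp [Prog.stk, Function.update, enc, enc1]
    refine ⟨t + (2 * (e a).length + 1) + 1, ?_, ?_⟩
    · rw [size_raw] at ht
      simp only [eval_add, eval_mul, eval_ofNat, eval_X]
      omega
    · have hinit : initList tm (e a) =
          ⟨some (some Q.entry), none, Prog.stk (st (enc (e a)) noReg noReg) []⟩ := by
        unfold initList
        congr 1
        funext k
        rcases k with _ | ⟨⟩ | i | i <;>
          first | exact (dif_pos rfl).trans rfl | exact dif_neg (by simp [tm])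
      have hhalt : haltList tm [f (e a)] = ⟨none, none, Prog.stk noReg [f (e a)]⟩ := by
        unfold haltList
        congr 1
        funext k
        rcases k with _ | ⟨⟩ | i | i <;>
          first | exact (dif_pos rfl).trans rfl | exact dif_neg (by simp [tm])
      rw [hinit, hhalt]
      exact hv.trans hlast
  refine ⟨⟨⟨tm, Equiv.refl _, Equiv.refl _⟩, p + (2 * X + 2), fun a =>
    ⟨⟨(key a).choose, ?_⟩, (key a).choose_spec.1⟩⟩⟩
  have h₀ : List.map (Equiv.refl (tm.Γ tm.k₀)).invFun (e a) = e a := List.map_id _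
  have h₁ : List.map (Equiv.refl (tm.Γ tm.k₁)).invFun [f (e a)] = [f (e a)] := List.map_id _
  change (flip bind tm.step)^[_] (some (initList tm (List.map (Equiv.refl _).invFun (e a)))) =
    some (haltList tm (List.map (Equiv.refl _).invFun [f (e a)]))
  rw [h₀, h₁]
  exact (key a).choose_spec.2

end PolyTime

/-! ### A library of functions computable in polynomial time -/

namespace PolyTime

open Polynomial Reg Reg1

variable {α β γ δ : Type} [Reg α] [Reg β] [Reg γ] [Reg δ]

theorem PT.fst' {f : α → β × γ} (hf : PT f) : PT (fun a => (f a).1) := PT.fst.comp hf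
theorem PT.snd' {f : α → β × γ} (hf : PT f) : PT (fun a => (f a).2) := PT.snd.comp hf

/-- Growth by an additive amount that depends only on the parameter `a` keeps all iterates
polynomial; this is the form in which iteration is mostly used. -/
theorem PT.iterate_of_size_le {ν : Type} [Reg1 ν] {n : α → ν} {init : α → β} {step : α → β → β}
    (hn : PT n) (hinit : PT init) (hstep : PT (fun x : α × β => step x.1 x.2)) (q : ℕ[X])
    (hq : ∀ a b, size (step a b) ≤ size b + q.eval (size a)) :
    PT (fun a => (step a)^[(enc1 (n a)).length] (init a)) := by
  obtain ⟨r, hr⟩ := hn.size_le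
  obtain ⟨p, hp⟩ := hinit.size_le
  refine PT.iterate (step := fun x : α × β => step x.1 x.2) hn hinit hstep (p + r * q) ?_
  intro a i hi
  have key : ∀ i, size ((step a)^[i] (init a)) ≤ p.eval (size a) + i * q.eval (size a) := by
    intro i
    induction i with
    | zero => simpa using hp a
    | succ i ih =>
      rw [Function.iterate_succ_apply']
      have := hq a ((step a)^[i] (init a))
      nlinarith
  refine (key i).trans ?_
  have h := hr a
  rw [size_reg1] at h
  simp only [eval_add, eval_mul]
  have := Nat.mul_le_mul_right (q.eval (size a)) (hi.trans h)
  omega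

/-! #### Booleans and natural numbers -/

theorem PT.bool (b : Bool) : PT (fun _ : α => b) :=
  .of_push (some b) (.const_nil (f := fun _ => ([] : List Sym)) fun _ => rfl) fun _ => rfl

theorem PT.not {f : α → Bool} (hf : PT f) : PT (fun a => !f a) := by
  convert PT.ite hf (.bool false) (.bool true) using 2 with a
  cases f a <;> rfl

theorem PT.and {f g : α → Bool} (hf : PT f) (hg : PT g) : PT (fun a => f a && g a) := by
  convert PT.ite hf hg (.bool false) using 2 with a
  cases f a <;> rfl

theorem PT.or {f g : α → Bool} (hf : PT f) (hg : PT g) : PT (fun a => f a || g a) := by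
  convert PT.ite hf (.bool true) hg using 2 with a
  cases f a <;> rfl

theorem PT.beq {f g : α → Bool} (hf : PT f) (hg : PT g) : PT (fun a => f a == g a) := by
  convert PT.ite hf hg hg.not using 2 with a
  cases f a <;> cases g a <;> rfl

theorem PT.zero : PT (fun _ : α => 0) := .const_nil fun _ => rfl

theorem PT.succ {f : α → ℕ} (hf : PT f) : PT (fun a => f a + 1) :=
  .of_push (some true) hf fun _ => List.replicate_succ

theorem PT.pred {f : α → ℕ} (hf : PT f) : PT (fun a => f a - 1) :=
  .of_pop hf fun a => by simp [enc1]

theorem PT.isZero {f : α → ℕ} (hf : PT f) : PT (fun a => f a == 0) := by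
  convert hf.head (fun o => o.isNone) using 2 with a
  cases f a <;> simp [enc1, List.replicate_succ]

theorem PT.add {f g : α → ℕ} (hf : PT f) (hg : PT g) : PT (fun a => f a + g a) := by
  convert PT.iterate_of_size_le (step := fun _ m => m + 1) hg hf (.succ .snd) 1
    (fun a b => by simp [size_nat]) using 2 with a
  simp [enc1]

theorem PT.sub {f g : α → ℕ} (hf : PT f) (hg : PT g) : PT (fun a => f a - g a) := by
  convert PT.iterate_of_size_le (step := fun _ m => m - 1) hg hf (.pred .snd) 1
    (fun a b => by simp [size_nat]; omega) using 2 with a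
  have : ∀ (n m : ℕ), (fun m => m - 1)^[n] m = m - n := fun n m => Nat.pred_iterate m n
  simp [enc1, this]

theorem PT.mul {f g : α → ℕ} (hf : PT f) (hg : PT g) : PT (fun a => f a * g a) := by
  obtain ⟨q, hq⟩ := hf.size_le
  convert PT.iterate_of_size_le (step := fun a m => m + f a) hg .zero (.add .snd (hf.comp .fst)) q
    (fun a b => by have := hq a; simp only [size_nat] at *; omega) using 2 with a
  simp [enc1, mul_comm]

theorem PT.ble {f g : α → ℕ} (hf : PT f) (hg : PT g) : PT (fun a => decide (f a ≤ g a)) := by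
  convert (hf.sub hg).isZero using 2 with a
  rw [Bool.eq_iff_iff]
  simp [Nat.sub_eq_zero_iff_le]

theorem PT.beqNat {f g : α → ℕ} (hf : PT f) (hg : PT g) : PT (fun a => decide (f a = g a)) := by
  convert (hf.ble hg).and (hg.ble hf) using 2 with a
  rw [← Bool.decide_and, decide_eq_decide]
  omega

/-! #### Lists -/

theorem PT.nil : PT (fun _ : α => ([] : List Bool)) := .const_nil fun _ => rfl

theorem PT.cons {f : α → Bool} {g : α → List Bool} (hf : PT f) (hg : PT g) :
    PT (fun a => f a :: g a) := by
  convert PT.ite hf (.of_push (g := fun a => true :: g a) (some true) hg fun _ => rfl)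
    (.of_push (g := fun a => false :: g a) (some false) hg fun _ => rfl) using 2 with a
  cases f a <;> rfl

theorem PT.tail {f : α → List Bool} (hf : PT f) : PT (fun a => (f a).tail) :=
  .of_pop hf fun a => by simp [enc1]

theorem PT.headD {f : α → List Bool} (hf : PT f) : PT (fun a => (f a).headD false) := by
  convert hf.head (fun o => o == some (some true)) using 2 with a
  rcases f a with _ | ⟨_ | _, l⟩ <;> rfl

theorem PT.isEmpty {f : α → List Bool} (hf : PT f) : PT (fun a => (f a).isEmpty) := by
  convert hf.head (fun o => o.isNone) using 2 with a
  cases f a <;> rfl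

theorem PT.drop {n : α → ℕ} {f : α → List Bool} (hn : PT n) (hf : PT f) :
    PT (fun a => (f a).drop (n a)) := by
  convert PT.iterate_of_size_le (step := fun _ (l : List Bool) => l.tail) hn hf (.tail .snd) 0
    (fun a b => by simp [size_list]) using 2 with a
  have : ∀ (n : ℕ) (l : List Bool), List.tail^[n] l = l.drop n := by
    intro n
    induction n with
    | zero => simp
    | succ n ih => intro l; simp [ih]
  simp [enc1, this]

theorem PT.getD {n : α → ℕ} {f : α → List Bool} (hn : PT n) (hf : PT f) :
    PT (fun a => (f a).getD (n a) false) := by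
  convert (hn.drop hf).headD using 2 with a
  rw [List.headD_eq_head?_getD, List.head?_drop, List.getD_eq_getElem?_getD]

theorem PT.foldl {f : α → List Bool} {init : α → β} {step : α → β → Bool → β}
    (hf : PT f) (hinit : PT init) (hstep : PT (fun x : α × β × Bool => step x.1 x.2.1 x.2.2))
    (q : ℕ[X]) (hq : ∀ a b x, size (step a b x) ≤ size b + q.eval (size a)) :
    PT (fun a => (f a).foldl (step a) (init a)) := by
  have h := PT.iterate_of_size_le (α := α)
    (step := fun a (s : List Bool × β) => (s.1.tail, step a s.2 (s.1.headD false))) hf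
    (hf.pair hinit) (.pair (.tail (.fst' .snd)) (hstep.comp (.pair .fst (.pair (.snd' .snd)
      (.headD (.fst' .snd)))))) q
    (fun a b => by
      have := hq a b.2 (b.1.headD false)
      simp only [size_prod, size_list, List.length_tail]
      omega)
  convert h.snd' using 2 with a
  have : ∀ (l : List Bool) (b : β),
      ((fun (s : List Bool × β) => (s.1.tail, step a s.2 (s.1.headD false)))^[l.length] (l, b)) =
        ([], l.foldl (step a) b) := by
    intro l
    induction l with
    | nil => simp
    | cons x l ih => intro b; exact ih _
  simp only [enc1, List.length_map, this]

theorem PT.length {f : α → List Bool} (hf : PT f) : PT (fun a => (f a).length) := by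
  convert PT.iterate_of_size_le (step := fun _ m => m + 1) hf .zero (.succ .snd) 1
    (fun a b => by simp [size_nat]) using 2 with a
  simp [enc1]

theorem PT.count {f : α → List Bool} (hf : PT f) : PT (fun a => (f a).count true) := by
  have h := PT.foldl (step := fun _ m x => if x then m + 1 else m) hf .zero
    (.ite (.snd' .snd) (.succ (.fst' .snd)) (.fst' .snd)) 1
    (fun a b x => by cases x <;> simp [size_nat])
  convert h using 2 with a
  have : ∀ (l : List Bool) (m : ℕ),
      l.foldl (fun m x => if x then m + 1 else m) m = m + l.count true := by
    intro l
    induction l with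
    | nil => simp
    | cons x l ih => intro b; cases x <;> simp [ih] ; ring
  simp [this]

theorem PT.reverse {f : α → List Bool} (hf : PT f) : PT (fun a => (f a).reverse) := by
  have h := PT.foldl (step := fun _ l x => x :: l) hf .nil (.cons (.snd' .snd) (.fst' .snd)) 1
    (fun a b x => by simp [size_list])
  convert h using 2 with a
  simp

theorem PT.append {f g : α → List Bool} (hf : PT f) (hg : PT g) : PT (fun a => f a ++ g a) := by
  have h := PT.foldl (step := fun _ l x => x :: l) hf.reverse hg (.cons (.snd' .snd) (.fst' .snd)) 1
    (fun a b x => by simp [size_list])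
  convert h using 2 with a
  simp

theorem PT.take {n : α → ℕ} {f : α → List Bool} (hn : PT n) (hf : PT f) :
    PT (fun a => (f a).take (n a)) := by
  have h := (PT.drop (hf.length.sub hn) hf.reverse).reverse
  convert h using 2 with a
  rw [List.drop_reverse, List.reverse_reverse]
  rcases le_total (n a) (f a).length with h | h
  · rw [Nat.sub_sub_self h]
  · rw [Nat.sub_eq_zero_of_le h, List.take_of_length_le h, Nat.sub_zero, List.take_length]

/-! #### Bounded quantifiers and comprehension -/

/-- The bit vector of length `n` with entries `p i`. -/
def tab (n : ℕ) (p : ℕ → Bool) : List Bool := (List.range n).map p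

/-- Bounded universal quantification. -/
def ball (n : ℕ) (p : ℕ → Bool) : Bool := (List.range n).all p

/-- Bounded existential quantification. -/
def bex (n : ℕ) (p : ℕ → Bool) : Bool := (List.range n).any p

theorem PT.tab {n : α → ℕ} {p : α → ℕ → Bool} (hn : PT n) (hp : PT (fun x : α × ℕ => p x.1 x.2)) :
    PT (fun a => tab (n a) (p a)) := by
  have h := PT.iterate_of_size_le (α := α)
    (step := fun a (s : ℕ × List Bool) => (s.1 + 1, p a s.1 :: s.2)) hn (.pair .zero .nil)
    (.pair (.succ (.fst' .snd)) (.cons (hp.comp (.pair .fst (.fst' .snd))) (.snd' .snd))) 2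
    (fun a b => by simp [size_prod, size_list, size_nat]; omega)
  convert h.snd'.reverse using 2 with a
  have : ∀ n, (fun (s : ℕ × List Bool) => (s.1 + 1, p a s.1 :: s.2))^[n] (0, []) =
      (n, ((List.range n).map (p a)).reverse) := by
    intro n
    induction n with
    | zero => simp
    | succ n ih => rw [Function.iterate_succ_apply', ih, List.range_succ]; simp
  simp [enc1, this, PolyTime.tab]

theorem PT.ball {n : α → ℕ} {p : α → ℕ → Bool} (hn : PT n) (hp : PT (fun x : α × ℕ => p x.1 x.2)) :
    PT (fun a => ball (n a) (p a)) := by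
  have h := PT.iterate_of_size_le (α := α)
    (step := fun a (s : ℕ × Bool) => (s.1 + 1, s.2 && p a s.1)) hn (.pair .zero (.bool true))
    (.pair (.succ (.fst' .snd)) (.and (.snd' .snd) (hp.comp (.pair .fst (.fst' .snd))))) 1
    (fun a b => by simp [size_prod, size_bool, size_nat])
  convert h.snd' using 2 with a
  have : ∀ n, (fun (s : ℕ × Bool) => (s.1 + 1, s.2 && p a s.1))^[n] (0, true) =
      (n, (List.range n).all (p a)) := by
    intro n
    induction n with
    | zero => simp
    | succ n ih => rw [Function.iterate_succ_apply', ih, List.range_succ]; simp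
  simp [enc1, this, PolyTime.ball]

theorem PT.bex {n : α → ℕ} {p : α → ℕ → Bool} (hn : PT n) (hp : PT (fun x : α × ℕ => p x.1 x.2)) :
    PT (fun a => bex (n a) (p a)) := by
  convert (PT.ball (p := fun a i => !p a i) hn hp.not).not using 2 with a
  simp [PolyTime.bex, PolyTime.ball, List.any_eq_not_all_not]

@[simp] theorem length_tab (n : ℕ) (p : ℕ → Bool) : (tab n p).length = n := by simp [tab]

@[simp] theorem getD_tab {n : ℕ} (p : ℕ → Bool) {i : ℕ} (hi : i < n) :
    (tab n p).getD i false = p i := by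
  simp [tab, hi, List.getD_eq_getElem?_getD]

@[simp] theorem ball_iff {n : ℕ} {p : ℕ → Bool} : ball n p = true ↔ ∀ i < n, p i = true := by
  simp [ball]

@[simp] theorem bex_iff {n : ℕ} {p : ℕ → Bool} : bex n p = true ↔ ∃ i < n, p i = true := by
  simp [bex]

end PolyTime

/-! ### The verification algorithm -/

namespace WeakDagWidth

open PolyTime Polynomial

variable {α : Type} [Reg α]

/-- The `i`-th bit of a word, `false` beyond its end. -/
abbrev bit (l : List Bool) (i : ℕ) : Bool := l.getD i false

/-- One round of breadth-first search in the subgraph induced by `Y`. -/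
def nextBits (n : ℕ) (M Y S : List Bool) : List Bool :=
  tab n fun w => bit S w || (bit Y w && bex n fun u => bit S u && bit M (u * n + w))

/-- The vertices reachable from `S` in the subgraph induced by `Y`. -/
def reachBits (n : ℕ) (M Y S : List Bool) : List Bool :=
  (nextBits n M Y)^[n] (tab n fun v => bit S v && bit Y v)

/-- The singleton `{v}`. -/
def singleBits (n v : ℕ) : List Bool := tab n fun i => decide (i = v)

/-- Is `K` a strong component of the subgraph induced by `Y`? -/
def componentBits (n : ℕ) (M Y K : List Bool) : Bool :=
  bex n fun v => bit Y v && ball n fun w => bit K w ==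
    (bit (reachBits n M Y (singleBits n v)) w && bit (reachBits n M Y (singleBits n w)) v)

/-- Is `m` unreachable from `R'` when the vertices in `C` and `C'` are removed? -/
def blockedBits (n : ℕ) (M m C C' R' : List Bool) : Bool :=
  ball n fun w => !(bit m w &&
    bit (reachBits n M (tab n fun i => !(bit C i && bit C' i)) R') w)

/-- The minimum of `N` and the number with the given binary digits. -/
def cappedValue (N : ℕ) (l : List Bool) : ℕ :=
  l.reverse.foldl (fun m b => if decide (m + m + (if b then 1 else 0) ≤ N) then
    m + m + (if b then 1 else 0) else N) 0

/-- The stacks with the sets `m(t)`, `C(t)`, `R(t)` and the part of `R(t)` covered so far, for all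
nodes `t` on the path from the root to the current node. -/
abbrev Stacks := List Bool × List Bool × List Bool × List Bool

/-- The state of the algorithm: remaining input, depth of the current node, stacks, and whether all
tests have been passed so far. -/
abbrev CheckState := List Bool × ℕ × Stacks × Bool

/-- The conditions on a child labelled `C`, `R` of the current node. -/
def childBits (n : ℕ) (M : List Bool) (k : ℕ) (s : Stacks) (C R : List Bool) : Bool :=
  decide (C.count true ≤ k) &&
    (componentBits n M (tab n fun i => bit s.2.2.1 i && !bit s.2.1 i) R &&
      blockedBits n M s.1 s.2.1 C R)

/-- Enter a child labelled `C`, `R` of the current node. -/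
def pushStacks (n : ℕ) (s : Stacks) (C R : List Bool) : Stacks :=
  (tab n (fun i => bit s.1 i || (bit C i && bit R i)) ++ s.1, C ++ s.2.1, R ++ s.2.2.1,
    tab n (fun i => bit C i && bit R i) ++
      (tab n (fun i => bit s.2.2.2 i || bit R i) ++ s.2.2.2.drop n))

/-- Leave the current node. -/
def popStacks (n : ℕ) (s : Stacks) : Stacks :=
  (s.1.drop n, s.2.1.drop n, s.2.2.1.drop n, s.2.2.2.drop n)

/-- Read an opening bracket with its labels. -/
def openStep (n : ℕ) (M : List Bool) (k : ℕ) (s : CheckState) : CheckState :=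
  (s.1.tail.drop (n + n), s.2.1 + 1,
    pushStacks n s.2.2.1 (s.1.tail.take n) ((s.1.tail.drop n).take n),
    s.2.2.2 && (decide (n + n ≤ s.1.tail.length) && (!(s.2.1 == 0) &&
      childBits n M k s.2.2.1 (s.1.tail.take n) ((s.1.tail.drop n).take n))))

/-- Read a closing bracket. -/
def closeStep (n : ℕ) (s : CheckState) : CheckState :=
  (s.1.tail, s.2.1 - 1, popStacks n s.2.2.1, s.2.2.2 && (!(s.2.1 == 0) &&
    ball n fun i => bit s.2.2.1.2.2.2 i == bit s.2.2.1.2.2.1 i))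

/-- One step of the algorithm. -/
def checkStep (n : ℕ) (M : List Bool) (k : ℕ) (s : CheckState) : CheckState :=
  if s.1.isEmpty then s else if s.1.headD false then openStep n M k s else closeStep n s

/-- The state after reading the root. -/
def checkInit (n k : ℕ) (w : List Bool) : CheckState :=
  (w.tail.drop (n + n), 1,
    (tab n fun i => bit (w.tail.take n) i && bit ((w.tail.drop n).take n) i, w.tail.take n,
      (w.tail.drop n).take n,
      tab n fun i => bit (w.tail.take n) i && bit ((w.tail.drop n).take n) i),
    w.headD false && (decide (n + n ≤ w.tail.length) &&
      ((ball n fun i => bit ((w.tail.drop n).take n) i) &&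
        decide ((w.tail.take n).count true ≤ k))))

/-- Has the input been read completely, with success? -/
def accepting (s : CheckState) : Bool := s.2.2.2 && (s.1.isEmpty && s.2.1 == 0)

/-- Is `w` the code of a shy-monotone tree decomposition of width at most `k`? -/
def checkTree (n : ℕ) (M : List Bool) (k : ℕ) (w : List Bool) : Bool :=
  accepting ((checkStep n M k)^[w.length] (checkInit n k w))

/-- The number of leading ones. -/
def leadingOnes (x : List Bool) : ℕ :=
  ((fun s : List Bool × ℕ => if s.1.headD false then (s.1.tail, s.2 + 1) else s)^[x.length]
    (x, 0)).2

/-- The part of an instance that contains the adjacency matrix. -/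
def matrixPart (x : List Bool) : List Bool :=
  (x.drop (leadingOnes x + 1)).take (leadingOnes x * leadingOnes x)

/-- The part of an instance that contains the number `k`. -/
def numberPart (x : List Bool) : List Bool :=
  (x.drop (leadingOnes x + 1)).drop (leadingOnes x * leadingOnes x)

/-- Is `x` the code of an instance? -/
def checkInstance (x : List Bool) : Bool :=
  decide (leadingOnes x + 1 + leadingOnes x * leadingOnes x ≤ x.length) &&
    (((numberPart x).isEmpty || (numberPart x).reverse.headD false) &&
      ball (leadingOnes x) fun i => !bit (matrixPart x) (i * leadingOnes x + i))

/-- Do `x` and `w` encode an instance and a suitable decomposition? -/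
def checkPair (x w : List Bool) : Bool :=
  checkInstance x &&
    checkTree (leadingOnes x) (matrixPart x) (cappedValue (leadingOnes x) (numberPart x)) w

/-- Splits a word at the first separator (the first component is reversed). -/
def splitWord (l : List Sym) : List Sym × List Bool :=
  (fun s : List Sym × List Bool =>
    if s.1.head? == some (some true) then (s.1.tail, true :: s.2)
    else if s.1.head? == some (some false) then (s.1.tail, false :: s.2) else s)^[l.length] (l, [])

/-- The verification algorithm. -/
def checkWord (l : List Sym) : Bool :=
  checkPair (splitWord l).2.reverse (splitWord (splitWord l).1.tail).2.reverse

/-! ### The verification algorithm runs in polynomial time -/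

theorem _root_.PolyTime.PT.bit {l : α → List Bool} {i : α → ℕ} (hl : PT l) (hi : PT i) :
    PT (fun a => bit (l a) (i a)) := hi.getD hl

theorem _root_.PolyTime.PT.nextBits {n : α → ℕ} {M Y S : α → List Bool} (hn : PT n) (hM : PT M) (hY : PT Y)
    (hS : PT S) : PT (fun a => nextBits (n a) (M a) (Y a) (S a)) := by
  have hn' := hn.comp (PT.fst (β := ℕ))
  have hM' := hM.comp ((PT.fst (β := ℕ)).comp (PT.fst (β := ℕ)))
  refine PT.tab hn (.or (.bit (hS.comp .fst) .snd) (.and (.bit (hY.comp .fst) .snd)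
    (.bex (p := fun (a : α × ℕ) u => WeakDagWidth.bit (S a.1) u &&
      WeakDagWidth.bit (M a.1) (u * n a.1 + a.2)) hn' (.and (.bit (hS.comp (.fst' .fst)) .snd)
      (.bit hM' (.add (.mul .snd (hn'.comp .fst)) (.snd' .fst)))))))

theorem _root_.PolyTime.PT.reachBits {n : α → ℕ} {M Y S : α → List Bool} (hn : PT n) (hM : PT M) (hY : PT Y)
    (hS : PT S) : PT (fun a => reachBits (n a) (M a) (Y a) (S a)) := by
  obtain ⟨q, hq⟩ := hn.size_le
  have h := PT.iterate (β := List Bool)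
    (step := fun a => WeakDagWidth.nextBits (n a.1) (M a.1) (Y a.1) a.2) hn
    (.tab hn (p := fun a v => WeakDagWidth.bit (S a) v && WeakDagWidth.bit (Y a) v)
      (.and (.bit (hS.comp .fst) .snd) (.bit (hY.comp .fst) .snd)))
    (.nextBits (hn.comp .fst) (hM.comp .fst) (hY.comp .fst) .snd) q ?_
  · convert h using 2 with a
    simp [WeakDagWidth.reachBits, Reg1.enc1]
  -- Every iterate is a bit vector of length exactly n, so the search needs no bound beyond n
  -- itself.
  · intro a i _
    refine le_trans (le_of_eq ?_) (hq a)
    cases i with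
    | zero => simp [size_list, size_nat]
    | succ i =>
      rw [Function.iterate_succ_apply']
      simp [size_list, size_nat, WeakDagWidth.nextBits]

theorem _root_.PolyTime.PT.singleBits {n v : α → ℕ} (hn : PT n) (hv : PT v) :
    PT (fun a => singleBits (n a) (v a)) :=
  .tab hn (.beqNat .snd (hv.comp .fst))

theorem _root_.PolyTime.PT.componentBits {n : α → ℕ} {M Y K : α → List Bool} (hn : PT n) (hM : PT M) (hY : PT Y)
    (hK : PT K) : PT (fun a => componentBits (n a) (M a) (Y a) (K a)) := by
  have h1 : PT (fun a : α × ℕ => a.1) := .fst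
  have h2 : PT (fun a : (α × ℕ) × ℕ => a.1.1) := .fst' .fst
  refine PT.bex hn (.and (.bit (hY.comp .fst) .snd) (.ball (p := fun (a : α × ℕ) w =>
    WeakDagWidth.bit (K a.1) w == (WeakDagWidth.bit (WeakDagWidth.reachBits (n a.1) (M a.1) (Y a.1)
      (WeakDagWidth.singleBits (n a.1) a.2)) w && WeakDagWidth.bit
      (WeakDagWidth.reachBits (n a.1) (M a.1) (Y a.1) (WeakDagWidth.singleBits (n a.1) w)) a.2))
    (hn.comp h1) (.beq (.bit (hK.comp h2) .snd) (.and
      (.bit (.reachBits (hn.comp h2) (hM.comp h2) (hY.comp h2) (.singleBits (hn.comp h2)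
        (.snd' .fst))) .snd)
      (.bit (.reachBits (hn.comp h2) (hM.comp h2) (hY.comp h2) (.singleBits (hn.comp h2) .snd))
        (.snd' .fst))))))

theorem _root_.PolyTime.PT.blockedBits {n : α → ℕ} {M m C C' R' : α → List Bool} (hn : PT n) (hM : PT M)
    (hm : PT m) (hC : PT C) (hC' : PT C') (hR' : PT R') :
    PT (fun a => blockedBits (n a) (M a) (m a) (C a) (C' a) (R' a)) := by
  have h1 : PT (fun a : α × ℕ => a.1) := .fst
  have h2 : PT (fun a : (α × ℕ) × ℕ => a.1.1) := .fst' .fst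
  refine PT.ball hn (.not (.and (.bit (hm.comp h1) .snd) (.bit (.reachBits (hn.comp h1) (hM.comp h1)
    (.tab (p := fun (a : α × ℕ) i => !(WeakDagWidth.bit (C a.1) i && WeakDagWidth.bit (C' a.1) i))
      (hn.comp h1) (.not (.and (.bit (hC.comp h2) .snd) (.bit (hC'.comp h2) .snd))))
    (hR'.comp h1)) .snd)))

/-- Registers store numbers in unary, whereas k comes in binary and may be exponential in its
length. The cap N keeps every intermediate value small. -/
theorem _root_.PolyTime.PT.cappedValue {N : α → ℕ} {l : α → List Bool} (hN : PT N) (hl : PT l) :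
    PT (fun a => cappedValue (N a) (l a)) := by
  obtain ⟨q, hq⟩ := hN.size_le
  have hx : PT (fun x : α × ℕ × Bool => x.2.1 + x.2.1 + (if x.2.2 then 1 else 0)) :=
    .add (.add (.fst' .snd) (.fst' .snd)) (.ite (.snd' .snd) (.succ .zero) .zero)
  refine PT.foldl (step := fun a m b => if decide (m + m + (if b then 1 else 0) ≤ N a) then
    m + m + (if b then 1 else 0) else N a) hl.reverse .zero
    (.ite (.ble hx (hN.comp .fst)) hx (hN.comp .fst)) q ?_
  intro a m b
  have := hq a
  rw [size_nat] at this
  simp only [size_nat]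
  generalize m + m + (if b then 1 else 0) = z
  split <;> simp_all <;> omega

theorem _root_.PolyTime.PT.childBits {n k : α → ℕ} {M C R : α → List Bool} {s : α → Stacks} (hn : PT n) (hM : PT M)
    (hk : PT k) (hs : PT s) (hC : PT C) (hR : PT R) :
    PT (fun a => childBits (n a) (M a) (k a) (s a) (C a) (R a)) := by
  refine .and (.ble hC.count hk) (.and (.componentBits hn hM (.tab (p := fun a i =>
    WeakDagWidth.bit (s a).2.2.1 i && !WeakDagWidth.bit (s a).2.1 i) hn (.and (.bit (.fst' (.snd' (.snd'
      (hs.comp .fst)))) .snd) (.not (.bit (.fst' (.snd' (hs.comp .fst))) .snd)))) hR)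
    (.blockedBits hn hM hs.fst' hs.snd'.fst' hC hR))

theorem _root_.PolyTime.PT.pushStacks {n : α → ℕ} {C R : α → List Bool} {s : α → Stacks} (hn : PT n)
    (hs : PT s) (hC : PT C) (hR : PT R) : PT (fun a => pushStacks (n a) (s a) (C a) (R a)) := by
  have h1 : PT (fun a : α × ℕ => a.1) := .fst
  have hCR : PT (fun a : α × ℕ => WeakDagWidth.bit (C a.1) a.2 && WeakDagWidth.bit (R a.1) a.2) :=
    .and (.bit (hC.comp .fst) .snd) (.bit (hR.comp .fst) .snd)
  exact .pair (.append (.tab (p := fun a i => WeakDagWidth.bit (s a).1 i ||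
      (WeakDagWidth.bit (C a) i && WeakDagWidth.bit (R a) i)) hn
      (.or (.bit (.fst' (hs.comp h1)) .snd) hCR)) hs.fst')
    (.pair (.append hC hs.snd'.fst') (.pair (.append hR hs.snd'.snd'.fst')
      (.append (.tab (p := fun a i => WeakDagWidth.bit (C a) i && WeakDagWidth.bit (R a) i) hn hCR)
        (.append (.tab (p := fun a i => WeakDagWidth.bit (s a).2.2.2 i || WeakDagWidth.bit (R a) i) hn
          (.or (.bit (.snd' (.snd' (.snd' (hs.comp h1)))) .snd) (.bit (hR.comp h1) .snd)))
          (.drop hn hs.snd'.snd'.snd')))))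

theorem _root_.PolyTime.PT.popStacks {n : α → ℕ} {s : α → Stacks} (hn : PT n) (hs : PT s) :
    PT (fun a => popStacks (n a) (s a)) :=
  .pair (.drop hn hs.fst') (.pair (.drop hn hs.snd'.fst') (.pair (.drop hn hs.snd'.snd'.fst')
    (.drop hn hs.snd'.snd'.snd')))

theorem _root_.PolyTime.PT.openStep {n k : α → ℕ} {M : α → List Bool} {s : α → CheckState} (hn : PT n) (hM : PT M)
    (hk : PT k) (hs : PT s) : PT (fun a => openStep (n a) (M a) (k a) (s a)) := by
  have hC := hn.take hs.fst'.tail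
  have hR := hn.take (hn.drop hs.fst'.tail)
  exact .pair (.drop (.add hn hn) hs.fst'.tail) (.pair (.succ hs.snd'.fst')
    (.pair (.pushStacks hn hs.snd'.snd'.fst' hC hR) (.and hs.snd'.snd'.snd'
      (.and (.ble (.add hn hn) hs.fst'.tail.length) (.and hs.snd'.fst'.isZero.not
        (.childBits hn hM hk hs.snd'.snd'.fst' hC hR))))))

theorem _root_.PolyTime.PT.closeStep {n : α → ℕ} {s : α → CheckState} (hn : PT n) (hs : PT s) :
    PT (fun a => closeStep (n a) (s a)) := by
  have hs' := hs.comp (PT.fst (β := ℕ))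
  exact .pair hs.fst'.tail (.pair (.pred hs.snd'.fst') (.pair (.popStacks hn hs.snd'.snd'.fst')
    (.and hs.snd'.snd'.snd' (.and hs.snd'.fst'.isZero.not (.ball (p := fun a i =>
      WeakDagWidth.bit (s a).2.2.1.2.2.2 i == WeakDagWidth.bit (s a).2.2.1.2.2.1 i) hn
      (.beq (.bit hs'.snd'.snd'.fst'.snd'.snd'.snd' .snd)
        (.bit hs'.snd'.snd'.fst'.snd'.snd'.fst' .snd)))))))

theorem _root_.PolyTime.PT.checkStep {n k : α → ℕ} {M : α → List Bool} {s : α → CheckState} (hn : PT n) (hM : PT M)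
    (hk : PT k) (hs : PT s) : PT (fun a => checkStep (n a) (M a) (k a) (s a)) :=
  .ite hs.fst'.isEmpty hs (.ite hs.fst'.headD (.openStep hn hM hk hs) (.closeStep hn hs))

theorem _root_.PolyTime.PT.checkInit {n k : α → ℕ} {w : α → List Bool} (hn : PT n) (hk : PT k) (hw : PT w) :
    PT (fun a => checkInit (n a) (k a) (w a)) := by
  have hC := hn.take hw.tail
  have hR := hn.take (hn.drop hw.tail)
  have hCR : PT (fun a => PolyTime.tab (n a) fun i => WeakDagWidth.bit ((w a).tail.take (n a)) i &&
      WeakDagWidth.bit (((w a).tail.drop (n a)).take (n a)) i) :=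
    .tab hn (.and (.bit (hC.comp .fst) .snd) (.bit (hR.comp .fst) .snd))
  exact .pair (.drop (.add hn hn) hw.tail) (.pair (.succ .zero) (.pair
    (.pair hCR (.pair hC (.pair hR hCR))) (.and hw.headD (.and (.ble (.add hn hn) hw.tail.length)
      (.and (.ball (p := fun a i => WeakDagWidth.bit (((w a).tail.drop (n a)).take (n a)) i) hn
        (.bit (hR.comp .fst) .snd)) (.ble hC.count hk))))))

theorem size_checkState (s : CheckState) : size s = s.1.length + s.2.1 + s.2.2.1.1.length +
    s.2.2.1.2.1.length + s.2.2.1.2.2.1.length + s.2.2.1.2.2.2.length + 1 := by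
  simp only [size_prod, size_list, size_nat, size_bool]
  ring

/-- The worst case is an opening bracket: the stacks of m, C and R gain at most n bits each, the
stack of covered parts at most 2n, and the depth grows by one. -/
theorem size_checkStep_le (n : ℕ) (M : List Bool) (k : ℕ) (s : CheckState) :
    size (checkStep n M k s) ≤ size s + (5 * n + 1) := by
  rw [size_checkState, size_checkState]
  unfold checkStep
  split
  · omega
  split
  · simp only [openStep, pushStacks, List.length_append, length_tab, List.length_drop,
      List.length_take, List.length_tail]
    omega
  · simp only [closeStep, popStacks, List.length_drop, List.length_tail]
    omega

theorem _root_.PolyTime.PT.checkTree {n k : α → ℕ} {M w : α → List Bool} (hn : PT n) (hM : PT M)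
    (hk : PT k) (hw : PT w) : PT (fun a => checkTree (n a) (M a) (k a) (w a)) := by
  obtain ⟨q, hq⟩ := hn.size_le
  have h := PT.iterate_of_size_le
    (step := fun a (s : CheckState) => WeakDagWidth.checkStep (n a) (M a) (k a) s) hw
    (.checkInit hn hk hw) (.checkStep (hn.comp .fst) (hM.comp .fst) (hk.comp .fst) .snd) (5 * q + 1)
    (fun a s => by
      refine (size_checkStep_le _ _ _ _).trans ?_
      have := hq a
      rw [size_nat] at this
      simp only [eval_add, eval_mul, eval_ofNat, eval_one]
      omega)
  convert h.snd'.snd'.snd'.and (h.fst'.isEmpty.and h.snd'.fst'.isZero) using 2 with a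
  simp [WeakDagWidth.checkTree, accepting, Reg1.enc1]

theorem _root_.PolyTime.PT.leadingOnes {x : α → List Bool} (hx : PT x) : PT (fun a => leadingOnes (x a)) := by
  have h := PT.iterate_of_size_le
    (step := fun _ (s : List Bool × ℕ) => if s.1.headD false then (s.1.tail, s.2 + 1) else s) hx
    (.pair hx .zero) (.ite (.headD (.fst' .snd))
      (.pair (.tail (.fst' .snd)) (.succ (.snd' .snd))) .snd) 1
    (fun a s => by
      split <;> simp only [size_prod, size_list, size_nat, List.length_tail, eval_one] <;> omega)
  convert h.snd' using 2 with a
  simp [WeakDagWidth.leadingOnes, Reg1.enc1]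

theorem _root_.PolyTime.PT.matrixPart {x : α → List Bool} (hx : PT x) : PT (fun a => matrixPart (x a)) :=
  .take (.mul (.leadingOnes hx) (.leadingOnes hx)) (.drop (.succ (.leadingOnes hx)) hx)

theorem _root_.PolyTime.PT.numberPart {x : α → List Bool} (hx : PT x) : PT (fun a => numberPart (x a)) :=
  .drop (.mul (.leadingOnes hx) (.leadingOnes hx)) (.drop (.succ (.leadingOnes hx)) hx)

theorem _root_.PolyTime.PT.checkInstance {x : α → List Bool} (hx : PT x) : PT (fun a => checkInstance (x a)) := by
  have hn := PT.leadingOnes hx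
  have h1 := hn.comp (PT.fst (β := ℕ))
  exact .and (.ble (.add hn.succ (.mul hn hn)) hx.length)
    (.and (.or (PT.numberPart hx).isEmpty (PT.numberPart hx).reverse.headD)
      (.ball (p := fun a i => !WeakDagWidth.bit (WeakDagWidth.matrixPart (x a))
        (i * WeakDagWidth.leadingOnes (x a) + i)) hn
        (.not (.bit ((PT.matrixPart hx).comp .fst) (.add (.mul .snd h1) .snd)))))

theorem _root_.PolyTime.PT.checkPair {x w : α → List Bool} (hx : PT x) (hw : PT w) :
    PT (fun a => checkPair (x a) (w a)) :=
  .and (.checkInstance hx) (.checkTree (.leadingOnes hx) (.matrixPart hx)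
    (.cappedValue (.leadingOnes hx) (.numberPart hx)) hw)

theorem _root_.PolyTime.PT.rawTail {f : α → List Sym} (hf : PT f) : PT (fun a => (f a).tail) :=
  .of_pop hf fun _ => rfl

theorem _root_.PolyTime.PT.splitWord {f : α → List Sym} (hf : PT f) : PT (fun a => splitWord (f a)) := by
  have hhead : ∀ b, PT (fun x : α × List Sym × List Bool => x.2.1.head? == some (some b)) :=
    fun b => PT.head (PT.fst' .snd) fun o => o == some (some b)
  exact PT.iterate_of_size_le (step := fun _ (s : List Sym × List Bool) =>
    if s.1.head? == some (some true) then (s.1.tail, true :: s.2)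
    else if s.1.head? == some (some false) then (s.1.tail, false :: s.2) else s) hf
    (.pair hf .nil) (.ite (hhead true) (.pair (.rawTail (.fst' .snd)) (.cons (.bool true) (.snd' .snd)))
      (.ite (hhead false) (.pair (.rawTail (.fst' .snd)) (.cons (.bool false) (.snd' .snd))) .snd)) 1
    (fun a s => by
      split
      · simp only [size_prod, size_list, size_raw, List.length_tail, List.length_cons, eval_one]
        omega
      split
      · simp only [size_prod, size_list, size_raw, List.length_tail, List.length_cons, eval_one]
        omega
      · omega)

theorem _root_.PolyTime.PT.checkWord : PT checkWord :=
  .checkPair (.reverse (.snd' (.splitWord .id)))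
    (.reverse (.snd' (.splitWord (.rawTail (.fst' (.splitWord .id))))))

end WeakDagWidth

/-! ### Correctness of the verification algorithm -/

namespace WeakDagWidth

open PolyTime

variable {n : ℕ} {G : Digraph (Fin n)} {M : List Bool}

/-- The set of vertices given by a bit vector. -/
def bitSet (n : ℕ) (l : List Bool) : Finset (Fin n) := Finset.univ.filter fun i => bit l i = true

@[simp] theorem mem_bitSet {l : List Bool} {i : Fin n} : i ∈ bitSet n l ↔ bit l i = true := by
  simp [bitSet]

@[simp] theorem length_setCode (S : Finset (Fin n)) : (setCode S).length = n := by simp [setCode]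

theorem bit_setCode_append (S : Finset (Fin n)) (l : List Bool) (i : Fin n) :
    bit (setCode S ++ l) i = decide (i ∈ S) := by
  simp [bit, setCode, List.getD_eq_getElem?_getD, List.getElem?_append]

theorem bit_setCode (S : Finset (Fin n)) (i : Fin n) : bit (setCode S) i = decide (i ∈ S) := by
  simpa using bit_setCode_append S [] i

@[simp] theorem bitSet_setCode (S : Finset (Fin n)) : bitSet n (setCode S) = S := by
  ext i; simp [-List.getD_eq_getElem?_getD, bit_setCode]

@[simp] theorem bitSet_setCode_append (S : Finset (Fin n)) (l : List Bool) :
    bitSet n (setCode S ++ l) = S := by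
  ext i; simp [-List.getD_eq_getElem?_getD, bit_setCode_append]

theorem eq_setCode {l : List Bool} {S : Finset (Fin n)} (hl : l.length = n)
    (h : ∀ i : Fin n, bit l i = decide (i ∈ S)) : l = setCode S := by
  refine List.ext_getElem (by simp [hl]) fun i h₁ h₂ => ?_
  have h3 := h ⟨i, hl ▸ h₁⟩
  rw [← bit_setCode] at h3
  rw [bit, bit, List.getD_eq_getElem _ _ h₁, List.getD_eq_getElem _ _ h₂] at h3
  exact h3

theorem eq_setCode_bitSet {l : List Bool} (hl : l.length = n) : l = setCode (bitSet n l) :=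
  eq_setCode hl fun i => by simp

theorem tab_eq_setCode {p : ℕ → Bool} {S : Finset (Fin n)} (h : ∀ i : Fin n, p i = decide (i ∈ S)) :
    tab n p = setCode S :=
  eq_setCode (by simp) fun i => by rw [bit, getD_tab _ i.2, h]

theorem count_setCode (S : Finset (Fin n)) : (setCode S).count true = S.card := by
  have h : ∀ l : List (Fin n), l.Nodup →
      (l.map fun i => decide (i ∈ S)).count true = (l.toFinset ∩ S).card := by
    intro l
    induction l with
    | nil => simp
    | cons a l ih =>
      intro hl
      obtain ⟨ha, hl⟩ := List.nodup_cons.1 hl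
      rw [List.map_cons, List.count_cons, ih hl, List.toFinset_cons]
      by_cases haS : a ∈ S
      · rw [Finset.insert_inter_of_mem haS, Finset.card_insert_of_notMem (by simp [ha])]
        simp [haS]
      · rw [Finset.insert_inter_of_notMem haS]
        simp [haS]
  rw [setCode, h _ (List.nodup_finRange n)]
  congr 1
  ext i
  simp

theorem take_setCode_append (S : Finset (Fin n)) (l : List Bool) :
    (setCode S ++ l).take n = setCode S := List.take_left' (by simp)

theorem drop_setCode_append (S : Finset (Fin n)) (l : List Bool) :
    (setCode S ++ l).drop n = l := List.drop_left' (by simp)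

theorem ball_fin {p : ℕ → Bool} : ball n p = true ↔ ∀ i : Fin n, p i = true := by
  rw [ball_iff]
  exact ⟨fun h i => h i i.2, fun h i hi => h ⟨i, hi⟩⟩

theorem bex_fin {p : ℕ → Bool} : bex n p = true ↔ ∃ i : Fin n, p i = true := by
  rw [bex_iff]
  exact ⟨fun ⟨i, hi, h⟩ => ⟨⟨i, hi⟩, h⟩, fun ⟨i, h⟩ => ⟨i, i.2, h⟩⟩

/-- `M` is the adjacency matrix of `G`. -/
def IsMatrix (G : Digraph (Fin n)) (M : List Bool) : Prop :=
  ∀ i j : Fin n, bit M (i * n + j) = true ↔ G.Adj i j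

theorem mem_nextBits (hM : IsMatrix G M) (Y S : List Bool) (w : Fin n) :
    w ∈ bitSet n (nextBits n M Y S) ↔
      w ∈ bitSet n S ∨ w ∈ bitSet n Y ∧ ∃ u ∈ bitSet n S, G.Adj u w := by
  rw [mem_bitSet, bit, nextBits, getD_tab _ w.2]
  simp only [Bool.or_eq_true, Bool.and_eq_true, bex_fin, hM _ _, mem_bitSet]

theorem mem_bitSet_reachBits (hM : IsMatrix G M) (Y S : List Bool) (w : Fin n) :
    w ∈ bitSet n (reachBits n M Y S) ↔ w ∈ reachSet G ↑(bitSet n Y) ↑(bitSet n S) := by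
  let T : ℕ → List Bool := fun i => (nextBits n M Y)^[i] (tab n fun v => bit S v && bit Y v)
  have hT : ∀ i, T (i + 1) = nextBits n M Y (T i) := fun i => Function.iterate_succ_apply' ..
  have h0 : ∀ v, v ∈ bitSet n (T 0) ↔ v ∈ bitSet n S ∧ v ∈ bitSet n Y := by
    intro v
    rw [mem_bitSet, bit]
    simp only [T, Function.iterate_zero, id]
    rw [getD_tab _ v.2]
    simp only [Bool.and_eq_true, mem_bitSet]
  have hmono : ∀ i, bitSet n (T i) ⊆ bitSet n (T (i + 1)) := by
    intro i v hv
    rw [hT, mem_nextBits hM]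
    exact .inl hv
  -- Each round either adds a vertex or the search has stopped for good. With only n vertices, it
  -- has stopped after n rounds.
  have hfix : ∀ i, bitSet n (T (i + 1)) = bitSet n (T i) ∨ i + 1 ≤ (bitSet n (T (i + 1))).card := by
    have hstep : ∀ i, bitSet n (T (i + 1)) = bitSet n (T i) ∨
        (bitSet n (T i)).card + 1 ≤ (bitSet n (T (i + 1))).card := by
      intro i
      by_cases h : bitSet n (T (i + 1)) = bitSet n (T i)
      · exact .inl h
      · exact .inr (Finset.card_lt_card ((hmono i).ssubset_of_ne (Ne.symm h)))
    intro i
    induction i with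
    | zero => rcases hstep 0 with h | h <;> [exact .inl h; exact .inr (by omega)]
    | succ i ih =>
      rcases ih with h | h
      · left
        ext v
        rw [hT, mem_nextBits hM, h, ← mem_nextBits hM, ← hT, h]
      · rcases hstep (i + 1) with h' | h' <;> [exact .inl h'; exact .inr (by omega)]
  have hn : bitSet n (T (n + 1)) = bitSet n (T n) := by
    rcases hfix n with h | h
    · exact h
    · have := (bitSet n (T (n + 1))).card_le_univ
      simp at this
      omega
  change w ∈ bitSet n (T n) ↔ _
  constructor
  · suffices ∀ i w, w ∈ bitSet n (T i) → w ∈ reachSet G ↑(bitSet n Y) ↑(bitSet n S) from this n w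
    intro i
    induction i with
    | zero =>
      intro w hw
      rw [h0] at hw
      exact ⟨w, hw.1, hw.2, .refl⟩
    | succ i ih =>
      intro w hw
      rw [hT, mem_nextBits hM] at hw
      rcases hw with hw | ⟨hwY, u, hu, huw⟩
      · exact ih w hw
      · obtain ⟨s, hs, hsY, hsu⟩ := ih u hu
        exact ⟨s, hs, hsY, hsu.tail ⟨huw, hwY⟩⟩
  · rintro ⟨u, huS, huY, huw⟩
    have hle : ∀ i, bitSet n (T 0) ⊆ bitSet n (T i) := by
      intro i
      induction i with
      | zero => exact subset_rfl
      | succ i ih => exact ih.trans (hmono i)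
    induction huw with
    | refl => exact hle n ((h0 u).2 ⟨huS, huY⟩)
    | tail _ h ih =>
      rw [← hn, hT, mem_nextBits hM]
      exact .inr ⟨h.2, _, ih, h.1⟩

theorem bitSet_singleBits (v : Fin n) : bitSet n (singleBits n v) = {v} := by
  ext i
  rw [mem_bitSet, bit, singleBits, getD_tab _ i.2]
  simp [Fin.ext_iff]

theorem componentBits_iff (hM : IsMatrix G M) (Y K : List Bool) :
    componentBits n M Y K = true ↔ IsComponent G ↑(bitSet n Y) ↑(bitSet n K) := by
  have h : ∀ v w : Fin n, bit (reachBits n M Y (singleBits n v)) w = true ↔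
      ReachIn G ↑(bitSet n Y) v w := by
    intro v w
    rw [← mem_bitSet, mem_bitSet_reachBits hM, bitSet_singleBits]
    simp [reachSet]
  rw [componentBits, bex_fin]
  simp only [Bool.and_eq_true, ball_fin, beq_iff_eq]
  refine exists_congr fun v => and_congr (by simp) ?_
  rw [Set.ext_iff]
  refine forall_congr' fun w => ?_
  rw [Finset.mem_coe, Set.mem_ofPred_eq, ← h, ← h, mem_bitSet, ← Bool.and_eq_true,
    Bool.eq_iff_iff]

theorem blockedBits_iff (hM : IsMatrix G M) (m C C' R' : List Bool) :
    blockedBits n M m C C' R' = true ↔ Disjoint (↑(bitSet n m) : Set (Fin n))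
      (reachSet G (↑(bitSet n C ∩ bitSet n C') : Set (Fin n))ᶜ ↑(bitSet n R')) := by
  have h : (↑(bitSet n (tab n fun i => !(bit C i && bit C' i))) : Set (Fin n)) =
      (↑(bitSet n C ∩ bitSet n C') : Set (Fin n))ᶜ := by
    ext i
    rw [Finset.mem_coe, mem_bitSet, bit, getD_tab _ i.2, Set.mem_compl_iff, Finset.mem_coe,
      Finset.mem_inter, mem_bitSet, mem_bitSet, ← Bool.and_eq_true]
    cases bit C i && bit C' i <;> simp
  rw [blockedBits, ball_fin, Set.disjoint_left]
  refine forall_congr' fun w => ?_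
  rw [← h, ← mem_bitSet_reachBits hM, mem_bitSet, Finset.mem_coe, mem_bitSet]
  cases bit m w <;> simp

/-! ### The invariant of the parser: stacks as lists of frames -/

/-- The sets of a node on the path from the root to the current node. -/
structure Frame (n : ℕ) where
  m : Finset (Fin n)
  C : Finset (Fin n)
  R : Finset (Fin n)
  A : Finset (Fin n)

/-- The stacks that represent the nodes on the path from the root to the current node. -/
def stacksOf (fs : List (Frame n)) : Stacks :=
  (fs.flatMap fun f => setCode f.m, fs.flatMap fun f => setCode f.C,
    fs.flatMap fun f => setCode f.R, fs.flatMap fun f => setCode f.A)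

/-- The state of the algorithm for given nodes on the path from the root to the current node. -/
def stateOf (r : List Bool) (fs : List (Frame n)) (ok : Bool) : CheckState :=
  (r, fs.length, stacksOf fs, ok)

/-- The conditions on a child labelled `C`, `R`. -/
def ChildOK (G : Digraph (Fin n)) (k : ℕ) (f : Frame n) (C R : Finset (Fin n)) : Prop :=
  C.card ≤ k ∧ IsComponent G (↑(f.R \ (f.C ∩ f.R)) : Set (Fin n)) ↑R ∧
    Disjoint (↑f.m : Set (Fin n)) (reachSet G (↑(f.C ∩ C) : Set (Fin n))ᶜ ↑R)

theorem childBits_iff (hM : IsMatrix G M) (k : ℕ) (f : Frame n) (fs : List (Frame n))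
    (C R : Finset (Fin n)) :
    childBits n M k (stacksOf (f :: fs)) (setCode C) (setCode R) = true ↔ ChildOK G k f C R := by
  have hY : tab n (fun i => bit (stacksOf (f :: fs)).2.2.1 i && !bit (stacksOf (f :: fs)).2.1 i) =
      setCode (f.R \ (f.C ∩ f.R)) := by
    refine tab_eq_setCode fun i => ?_
    simp only [stacksOf, List.flatMap_cons]
    rw [bit_setCode_append, bit_setCode_append]
    by_cases h1 : i ∈ f.R <;> by_cases h2 : i ∈ f.C <;> simp [h1, h2]
  rw [childBits, hY, Bool.and_eq_true, Bool.and_eq_true, componentBits_iff hM, blockedBits_iff hM,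
    decide_eq_true_iff, count_setCode]
  simp only [stacksOf, List.flatMap_cons, bitSet_setCode, bitSet_setCode_append, ChildOK]

/-- A child's set is credited to the parent's covered part as soon as the child is opened, and the
child's own covered part starts as C ∩ R. The closing bracket then only has to compare A with R. -/
theorem pushStacks_eq (f : Frame n) (fs : List (Frame n)) (C R : Finset (Fin n)) :
    pushStacks n (stacksOf (f :: fs)) (setCode C) (setCode R) =
      stacksOf (⟨f.m ∪ C ∩ R, C, R, C ∩ R⟩ :: { f with A := f.A ∪ R } :: fs) := by
  have h1 : tab n (fun i => bit (stacksOf (f :: fs)).1 i || (bit (setCode C) i &&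
      bit (setCode R) i)) = setCode (f.m ∪ C ∩ R) := tab_eq_setCode fun i => by
    simp only [stacksOf, List.flatMap_cons]
    rw [bit_setCode_append, bit_setCode, bit_setCode]
    by_cases h1 : i ∈ f.m <;> simp [h1]
  have h2 : tab n (fun i => bit (setCode C) i && bit (setCode R) i) = setCode (C ∩ R) :=
    tab_eq_setCode fun i => by
      rw [bit_setCode, bit_setCode]
      simp
  have h3 : tab n (fun i => bit (stacksOf (f :: fs)).2.2.2 i || bit (setCode R) i) =
      setCode (f.A ∪ R) := tab_eq_setCode fun i => by
    simp only [stacksOf, List.flatMap_cons]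
    rw [bit_setCode_append, bit_setCode]
    by_cases h1 : i ∈ f.A <;> simp [h1]
  rw [pushStacks, h1, h2, h3]
  simp only [stacksOf, List.flatMap_cons, drop_setCode_append]

theorem popStacks_eq (f : Frame n) (fs : List (Frame n)) :
    popStacks n (stacksOf (f :: fs)) = stacksOf fs := by
  simp only [popStacks, stacksOf, List.flatMap_cons, drop_setCode_append]

open Classical in
theorem checkStep_open (hM : IsMatrix G M) (k : ℕ) (f : Frame n) (fs : List (Frame n))
    (C R : Finset (Fin n)) (r : List Bool) :
    checkStep n M k (stateOf (true :: (setCode C ++ (setCode R ++ r))) (f :: fs) true) =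
      stateOf r (⟨f.m ∪ C ∩ R, C, R, C ∩ R⟩ :: { f with A := f.A ∪ R } :: fs)
        (decide (ChildOK G k f C R)) := by
  have h : (setCode C ++ (setCode R ++ r)).drop (n + n) = r := by
    rw [← List.drop_drop, drop_setCode_append, drop_setCode_append]
  simp only [checkStep, stateOf, List.isEmpty_cons, List.headD_cons, if_true, openStep,
    List.tail_cons, take_setCode_append, drop_setCode_append, pushStacks_eq, h, Bool.false_eq_true,
    if_false]
  congr 3
  rw [Bool.eq_iff_iff]
  simp [childBits_iff hM]

theorem checkStep_close (k : ℕ) (f : Frame n) (fs : List (Frame n)) (r : List Bool) :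
    checkStep n M k (stateOf (false :: r) (f :: fs) true) = stateOf r fs (decide (f.A = f.R)) := by
  simp only [checkStep, stateOf, List.isEmpty_cons, List.headD_cons, closeStep,
    List.tail_cons, popStacks_eq, Bool.false_eq_true, if_false]
  congr 3
  rw [Bool.eq_iff_iff, Bool.and_eq_true, Bool.and_eq_true, ball_fin, decide_eq_true_iff,
    Finset.ext_iff]
  simp only [stacksOf, List.flatMap_cons, beq_iff_eq]
  simp only [bit_setCode_append, decide_eq_decide]
  simp

theorem checkStep_nil (k : ℕ) (fs : List (Frame n)) (ok : Bool) :
    checkStep n M k (stateOf [] fs ok) = stateOf [] fs ok := rfl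

/-- The final verdict after `j` further steps. -/
def verdict (n : ℕ) (M : List Bool) (k j : ℕ) (s : CheckState) : Bool :=
  accepting ((checkStep n M k)^[j] s)

theorem verdict_succ (k j : ℕ) (s : CheckState) :
    verdict n M k (j + 1) s = verdict n M k j (checkStep n M k s) := by
  simp [verdict]

/-- The flag is only ever conjoined with further tests, so a failed test is final. -/
theorem verdict_of_not_ok (k j : ℕ) (s : CheckState) (h : s.2.2.2 = false) :
    verdict n M k j s = false := by
  induction j generalizing s with
  | zero => simp [verdict, accepting, h]
  | succ j ih =>
    rw [verdict_succ]
    refine ih _ ?_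
    unfold checkStep
    split
    · exact h
    split
    · simp [openStep, h]
    · simp [closeStep, h]

/-- Once the root is closed the depth is 0 and any further bracket fails, so an accepted word codes
a single tree. The depth is counted separately from the stacks because for n = 0 the stacks are
empty words. -/
theorem verdict_no_frame (k j : ℕ) {r : List Bool}
    (h : verdict n M k j (stateOf r ([] : List (Frame n)) true) = true) : r = [] := by
  by_contra hr
  obtain ⟨b, r, rfl⟩ := List.exists_cons_of_ne_nil hr
  cases j with
  | zero => simp [verdict, accepting, stateOf] at h
  | succ j =>
    rw [verdict_succ, verdict_of_not_ok] at h
    · simp at h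
    · cases b <;> simp [checkStep, stateOf, openStep, closeStep]

/-- The conditions on the subtrees below a node. -/
def SubtreesOK (G : Digraph (Fin n)) (k : ℕ) (f : Frame n) (ts : List (LabelledTree (Fin n))) :
    Prop :=
  ∀ t ∈ ts, ChildOK G k f t.rootC t.rootR ∧ ShyMonotoneBelow G f.m t ∧ t.width ≤ k

theorem foldr_max_le {l : List ℕ} {k : ℕ} : l.foldr max 0 ≤ k ↔ ∀ a ∈ l, a ≤ k := by
  induction l with
  | nil => simp
  | cons a l ih => simp [ih]

theorem width_node_le {V : Type} {C R : Finset V} {ts : List (LabelledTree V)} {k : ℕ} :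
    (LabelledTree.node C R ts).width ≤ k ↔ C.card ≤ k ∧ ∀ t ∈ ts, t.width ≤ k := by
  rw [LabelledTree.width, max_le_iff, foldr_max_le]
  simp

theorem shyMonotoneBelow_node_iff {V : Type} [DecidableEq V] {G : Digraph V} {m C R : Finset V}
    {ts : List (LabelledTree V)} : ShyMonotoneBelow G m (.node C R ts) ↔
      (∀ t ∈ ts, IsComponent G (↑(R \ (C ∩ R)) : Set V) ↑t.rootR) ∧
      (∀ v, v ∈ R ↔ v ∈ C ∩ R ∨ ∃ t ∈ ts, v ∈ t.rootR) ∧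
      (∀ t ∈ ts, Disjoint (↑(m ∪ (C ∩ R)) : Set V)
        (reachSet G (↑(C ∩ t.rootC) : Set V)ᶜ ↑t.rootR)) ∧
      ∀ t ∈ ts, ShyMonotoneBelow G (m ∪ (C ∩ R)) t :=
  ⟨fun h => by cases h with | node _ _ _ _ h1 h2 h3 h4 => exact ⟨h1, h2, h3, h4⟩,
    fun ⟨h1, h2, h3, h4⟩ => .node _ _ _ _ h1 h2 h3 h4⟩

/-- Regroups the recursive definition in the way the parser tests it: all conditions on the children
are seen from the frame of their parent. The bound on |C(t')| in `ChildOK` is implied by the width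
of t'. -/
theorem node_ok_iff {k : ℕ} {m C R : Finset (Fin n)} {ts : List (LabelledTree (Fin n))} :
    ShyMonotoneBelow G m (.node C R ts) ∧ (LabelledTree.node C R ts).width ≤ k ↔
      C.card ≤ k ∧ SubtreesOK G k ⟨m ∪ C ∩ R, C, R, C ∩ R⟩ ts ∧
      ∀ v, v ∈ R ↔ v ∈ C ∩ R ∨ ∃ t ∈ ts, v ∈ t.rootR := by
  rw [shyMonotoneBelow_node_iff, width_node_le]
  constructor
  · rintro ⟨⟨h1, h2, h3, h4⟩, h5, h6⟩
    refine ⟨h5, fun t ht => ⟨⟨?_, h1 t ht, h3 t ht⟩, h4 t ht, h6 t ht⟩, h2⟩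
    have := h6 t ht
    cases t with
    | node C R ts => exact (width_node_le.1 this).1
  · rintro ⟨h1, h2, h3⟩
    exact ⟨⟨fun t ht => (h2 t ht).1.2.1, h3, fun t ht => (h2 t ht).1.2.2,
      fun t ht => (h2 t ht).2.1⟩, h1, fun t ht => (h2 t ht).2.2⟩

theorem treeCode_node (C R : Finset (Fin n)) (ts : List (LabelledTree (Fin n))) (r : List Bool) :
    treeCode (.node C R ts) ++ r =
      true :: (setCode C ++ (setCode R ++ ((ts.map treeCode).flatten ++ false :: r))) := by
  simp [treeCode]

-- Strong induction on the number of remaining steps. After an opening bracket the hypothesis is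
-- applied twice: to the forest inside the new node, and then to its remaining siblings. The second
-- use is possible because the conclusion provides a strictly smaller number of steps.
open Classical in
theorem verdict_sound (hM : IsMatrix G M) (k j : ℕ) : ∀ (r : List Bool) (f : Frame n)
    (fs : List (Frame n)), verdict n M k j (stateOf r (f :: fs) true) = true →
    ∃ ts r', r = (ts.map treeCode).flatten ++ false :: r' ∧ SubtreesOK G k f ts ∧
      (∀ v, v ∈ f.R ↔ v ∈ f.A ∨ ∃ t ∈ ts, v ∈ t.rootR) ∧
      ∃ j' < j, verdict n M k j' (stateOf r' fs true) = true := by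
  induction j using Nat.strong_induction_on with
  | _ j ih =>
  intro r f fs h
  rcases j with _ | j
  · simp [verdict, accepting, stateOf] at h
  rw [verdict_succ] at h
  rcases r with _ | ⟨b, r⟩
  -- At the end of the input the state no longer changes, and the induction hypothesis would find a
  -- closing bracket in the empty word.
  · rw [checkStep_nil] at h
    obtain ⟨ts, r', h', _⟩ := ih j (by omega) _ _ _ h
    simp at h'
  cases b with
  | false =>
    rw [checkStep_close] at h
    have hA : f.A = f.R := by
      by_contra hA
      rw [verdict_of_not_ok _ _ _ (by simp [stateOf, hA])] at h
      simp at h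
    rw [decide_eq_true hA] at h
    exact ⟨[], r, by simp, by simp [SubtreesOK], by simp [hA], j, by omega, h⟩
  | true =>
    have hlen : n + n ≤ r.length := by
      by_contra hlen
      rw [verdict_of_not_ok] at h
      · simp at h
      · simp [checkStep, stateOf, openStep, hlen]
    obtain ⟨C, hC⟩ : ∃ C : Finset (Fin n), r.take n = setCode C :=
      ⟨_, eq_setCode_bitSet (by simp; omega)⟩
    obtain ⟨R, hR⟩ : ∃ R : Finset (Fin n), (r.drop n).take n = setCode R :=
      ⟨_, eq_setCode_bitSet (by simp; omega)⟩
    obtain ⟨r₁, rfl⟩ : ∃ r₁, r = setCode C ++ (setCode R ++ r₁) :=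
      ⟨(r.drop n).drop n, by rw [← hC, ← hR, List.take_append_drop, List.take_append_drop]⟩
    rw [checkStep_open hM] at h
    have hok : ChildOK G k f C R := by
      by_contra hok
      rw [verdict_of_not_ok _ _ _ (by simp [stateOf, hok])] at h
      simp at h
    rw [decide_eq_true hok] at h
    obtain ⟨ts₁, r₂, hr₁, hts₁, hR₁, j₁, hj₁, h₁⟩ := ih j (by omega) _ _ _ h
    obtain ⟨ts₂, r₃, hr₂, hts₂, hR₂, j₂, hj₂, h₂⟩ := ih j₁ (by omega) _ _ _ h₁
    refine ⟨.node C R ts₁ :: ts₂, r₃, ?_, ?_, ?_, j₂, by omega, h₂⟩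
    · rw [List.map_cons, List.flatten_cons, List.append_assoc, ← hr₂, treeCode_node, ← hr₁]
    · have hnode := node_ok_iff.2 ⟨hok.1, hts₁, hR₁⟩
      intro t ht
      rcases List.mem_cons.1 ht with rfl | ht
      · exact ⟨hok, hnode⟩
      · exact hts₂ t ht
    · intro v
      rw [hR₂ v]
      simp [LabelledTree.rootR, or_assoc]

/-- The algorithm accepts the code of the subtree `t` below a node with `m(t) = m`. -/
def Accepts (G : Digraph (Fin n)) (M : List Bool) (k : ℕ) (m : Finset (Fin n))
    (t : LabelledTree (Fin n)) : Prop :=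
  ∀ (f : Frame n) (fs : List (Frame n)) (r : List Bool), f.m = m → t.width ≤ k →
    ChildOK G k f t.rootC t.rootR → ∃ j ≤ (treeCode t).length,
      (checkStep n M k)^[j] (stateOf (treeCode t ++ r) (f :: fs) true) =
        stateOf r ({ f with A := f.A ∪ t.rootR } :: fs) true

/-- Acceptance of the single subtrees is a hypothesis, so that the lemma can be used both inside the
induction on trees and at the root. -/
theorem steps_subtrees (k : ℕ) : ∀ (us : List (LabelledTree (Fin n)))
    (g : Frame n) (gs : List (Frame n)) (r : List Bool), (∀ u ∈ us, Accepts G M k g.m u) →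
    SubtreesOK G k g us → ∃ (j : ℕ) (A : Finset (Fin n)), j ≤ (us.map treeCode).flatten.length ∧
      (∀ v, v ∈ A ↔ v ∈ g.A ∨ ∃ u ∈ us, v ∈ u.rootR) ∧
      (checkStep n M k)^[j] (stateOf ((us.map treeCode).flatten ++ r) (g :: gs) true) =
        stateOf r ({ g with A := A } :: gs) true
  | [], g, gs, r, _, _ => ⟨0, g.A, by simp, by simp, by simp⟩
  | u :: us, g, gs, r, hacc, hok => by
    have hu := hok u (by simp)
    obtain ⟨j, hj, hj'⟩ := hacc u (by simp) g gs ((us.map treeCode).flatten ++ r) rfl hu.2.2 hu.1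
    obtain ⟨i, A, hi, hA, hi'⟩ := steps_subtrees k us { g with A := g.A ∪ u.rootR } gs r
      (fun v hv => hacc v (by simp [hv])) (fun v hv => hok v (by simp [hv]))
    refine ⟨i + j, A, ?_, ?_, ?_⟩
    · simp only [List.map_cons, List.flatten_cons, List.length_append]
      omega
    · intro v
      rw [hA]
      simp [or_assoc]
    · rw [Function.iterate_add_apply, List.map_cons, List.flatten_cons, List.append_assoc, hj', hi']

open Classical in
theorem accepts_of_shyMonotoneBelow (hM : IsMatrix G M) (k : ℕ) {m : Finset (Fin n)}
    {t : LabelledTree (Fin n)} (ht : ShyMonotoneBelow G m t) : Accepts G M k m t := by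
  induction ht with
  | node m C R ts h1 h2 h3 h4 ih =>
  rintro f fs r rfl hw hok
  have hts := (node_ok_iff.1 ⟨.node _ _ _ _ h1 h2 h3 h4, hw⟩).2.1
  obtain ⟨j, A, hj, hA, hj'⟩ := steps_subtrees k ts ⟨f.m ∪ C ∩ R, C, R, C ∩ R⟩
    ({ f with A := f.A ∪ R } :: fs) (false :: r) ih hts
  refine ⟨1 + (j + 1), ?_, ?_⟩
  · have := congrArg List.length (treeCode_node C R ts [])
    simp only [List.length_cons, List.length_append, List.length_nil] at this
    omega
  · rw [Nat.add_comm 1, Nat.add_comm j, Function.iterate_add_apply, Function.iterate_add_apply,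
      Function.iterate_one, treeCode_node, checkStep_open hM,
      decide_eq_true (show ChildOK G k f C R from hok), hj', checkStep_close, decide_eq_true]
    · rfl
    · ext v
      rw [hA, h2]

open Classical in
theorem checkTree_iff (hM : IsMatrix G M) (k : ℕ) (w : List Bool) :
    checkTree n M k w = true ↔ ∃ D : LabelledTree (Fin n),
      IsShyMonotoneTreeDecomposition G D ∧ D.width ≤ k ∧ w = treeCode D := by
  have hinit : ∀ (C R : Finset (Fin n)) (r : List Bool),
      checkInit n k (true :: (setCode C ++ (setCode R ++ r))) =
        stateOf r [⟨∅ ∪ C ∩ R, C, R, C ∩ R⟩] (decide ((∀ v, v ∈ R) ∧ C.card ≤ k)) := by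
    intro C R r
    have h : (setCode C ++ (setCode R ++ r)).drop (n + n) = r := by
      rw [← List.drop_drop, drop_setCode_append, drop_setCode_append]
    have h2 : tab n (fun i => bit (setCode C) i && bit (setCode R) i) = setCode (C ∩ R) :=
      tab_eq_setCode fun i => by
        rw [bit_setCode, bit_setCode]
        simp
    simp only [checkInit, List.tail_cons, take_setCode_append, drop_setCode_append, h, h2, stateOf,
      stacksOf, List.flatMap_cons, List.flatMap_nil, List.append_nil, Finset.empty_union,
      List.length_singleton, List.headD_cons]
    congr 3
    rw [Bool.eq_iff_iff]
    simp only [Bool.and_eq_true, decide_eq_true_iff, ball_fin, bit_setCode, count_setCode]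
    simp
  constructor
  · intro h
    have hok : (checkInit n k w).2.2.2 = true := by
      by_contra hok
      have := verdict_of_not_ok (n := n) (M := M) k w.length _ (Bool.eq_false_iff.2 hok)
      rw [verdict] at this
      rw [checkTree, this] at h
      simp at h
    rcases w with _ | ⟨b, w⟩
    · simp [checkInit] at hok
    obtain rfl : b = true := by
      simp only [checkInit, Bool.and_eq_true] at hok
      exact hok.1
    have hlen : n + n ≤ w.length := by
      simp only [checkInit, Bool.and_eq_true, List.tail_cons] at hok
      exact of_decide_eq_true hok.2.1
    obtain ⟨C, hC⟩ : ∃ C : Finset (Fin n), w.take n = setCode C :=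
      ⟨_, eq_setCode_bitSet (by simp; omega)⟩
    obtain ⟨R, hR⟩ : ∃ R : Finset (Fin n), (w.drop n).take n = setCode R :=
      ⟨_, eq_setCode_bitSet (by simp; omega)⟩
    obtain ⟨r₁, rfl⟩ : ∃ r₁, w = setCode C ++ (setCode R ++ r₁) :=
      ⟨(w.drop n).drop n, by rw [← hC, ← hR, List.take_append_drop, List.take_append_drop]⟩
    rw [hinit] at hok
    have hok' : (∀ v, v ∈ R) ∧ C.card ≤ k := by simpa [stateOf] using hok
    rw [checkTree, hinit, decide_eq_true hok'] at h
    obtain ⟨ts, r', hr, hts, hcover, j, -, hj⟩ := verdict_sound hM k _ _ _ _ h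
    have hr' := verdict_no_frame k j hj
    subst hr'
    have := node_ok_iff.2 ⟨hok'.2, hts, hcover⟩
    refine ⟨.node C R ts, ⟨hok'.1, this.1⟩, this.2, ?_⟩
    have := treeCode_node C R ts []
    rw [List.append_nil] at this
    rw [this, hr]
  · rintro ⟨D, ⟨hV, hD⟩, hw, rfl⟩
    rcases D with ⟨C, R, ts⟩
    obtain ⟨hC, hts, hcover⟩ := node_ok_iff.1 ⟨hD, hw⟩
    obtain ⟨j, A, hj, hA, hj'⟩ := steps_subtrees k ts ⟨∅ ∪ C ∩ R, C, R, C ∩ R⟩ [] [false]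
      (fun t ht => accepts_of_shyMonotoneBelow hM k (hts t ht).2.1) hts
    have hcode := treeCode_node C R ts []
    rw [List.append_nil] at hcode
    have hlen := congrArg List.length hcode
    simp only [List.length_cons, List.length_append, List.length_nil] at hlen
    obtain ⟨i, hi⟩ : ∃ i, (treeCode (.node C R ts)).length = i + (1 + j) :=
      ⟨(treeCode (.node C R ts)).length - (1 + j), by omega⟩
    -- The root is read by `checkInit`, and every later step on nonempty input consumes at least a
    -- bracket. So |w| steps suffice, and the surplus steps leave the final state unchanged.
    have hfix : (checkStep n M k)^[i] (stateOf ([] : List Bool) ([] : List (Frame n)) true) =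
        stateOf [] [] true := Function.iterate_fixed (checkStep_nil k [] true) i
    rw [checkTree, hi, hcode, hinit, decide_eq_true ⟨hV, hC⟩, Function.iterate_add_apply,
      Function.iterate_add_apply, hj', Function.iterate_one, checkStep_close, decide_eq_true, hfix]
    · simp [accepting, stateOf]
    · ext v
      rw [hA, hcover]

end WeakDagWidth

/-! ### Decoding of instances and pairs -/

namespace WeakDagWidth

open PolyTime

variable {n : ℕ}

theorem leadingOnes_eq (n : ℕ) {r : List Bool} (hr : r.headD false = false) :
    leadingOnes (List.replicate n true ++ r) = n := by
  have key : ∀ n i c, (fun s : List Bool × ℕ => if s.1.headD false then (s.1.tail, s.2 + 1) else s)^[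
      n + i] (List.replicate n true ++ r, c) = (r, c + n) := by
    intro n
    induction n with
    | zero =>
      intro i c
      rw [Nat.zero_add]
      exact Function.iterate_fixed (by simp only [List.replicate_zero, List.nil_append, hr]; rfl) i
    | succ n ih =>
      intro i c
      rw [Nat.add_right_comm, Function.iterate_succ_apply]
      have := ih i (c + 1)
      rw [Nat.add_right_comm] at this
      exact this
  simp only [leadingOnes, List.length_append, List.length_replicate, key, Nat.zero_add]

theorem exists_leadingOnes : ∀ x : List Bool,
    ∃ n r, x = List.replicate n true ++ r ∧ r.headD false = false
  | [] => ⟨0, [], rfl, rfl⟩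
  | false :: x => ⟨0, false :: x, rfl, rfl⟩
  | true :: x => by
    obtain ⟨n, r, rfl, hr⟩ := exists_leadingOnes x
    exact ⟨n + 1, r, rfl, hr⟩

open Classical in
/-- The adjacency matrix of a graph. -/
noncomputable def matrixCode (G : Digraph (Fin n)) : List Bool :=
  (List.finRange n).flatMap fun i => (List.finRange n).map fun j => decide (G.Adj i j)

theorem length_flatMap_const {α β : Type} (f : α → List β) (n : ℕ) (hf : ∀ a, (f a).length = n) :
    ∀ l : List α, (l.flatMap f).length = l.length * n
  | [] => by simp
  | a :: l => by
    rw [List.flatMap_cons, List.length_append, hf, length_flatMap_const f n hf l, List.length_cons]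
    ring

theorem getElem?_flatMap_const {α β : Type} (f : α → List β) (n : ℕ) (hf : ∀ a, (f a).length = n)
    {j : ℕ} (hj : j < n) : ∀ (l : List α) (i : ℕ) (a : α), l[i]? = some a →
    (l.flatMap f)[i * n + j]? = (f a)[j]?
  | [], i, a, h => by simp at h
  | b :: l, 0, a, h => by
    obtain rfl : b = a := by simpa using h
    simp [List.flatMap_cons, List.getElem?_append, hf, hj]
  | b :: l, i + 1, a, h => by
    rw [List.flatMap_cons, List.getElem?_append_right (by rw [hf]; nlinarith), hf,
      ← getElem?_flatMap_const f n hf hj l i a (by simpa using h)]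
    congr 1
    rw [Nat.succ_mul]
    omega

theorem length_matrixCode (G : Digraph (Fin n)) : (matrixCode G).length = n * n := by
  rw [matrixCode, length_flatMap_const _ n (fun _ => by simp)]
  simp

theorem isMatrix_matrixCode (G : Digraph (Fin n)) : IsMatrix G (matrixCode G) := by
  intro i j
  rw [bit, List.getD_eq_getElem?_getD, matrixCode,
    getElem?_flatMap_const _ n (fun _ => by simp) j.2 _ i i (by simp)]
  simp

/-- The word itself has to be recovered from the decoded graph, not only the adjacency relation. The
length condition excludes stray bits. -/
theorem IsMatrix.eq_matrixCode {G : Digraph (Fin n)} {M : List Bool} (h : IsMatrix G M)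
    (hM : M.length = n * n) : M = matrixCode G := by
  refine List.ext_getElem (by rw [hM, length_matrixCode]) fun k h₁ h₂ => ?_
  rw [hM] at h₁
  have hn : 0 < n := Nat.pos_of_ne_zero (by rintro rfl; simp at h₁)
  have h3 := (h ⟨k / n, Nat.div_lt_of_lt_mul h₁⟩ ⟨k % n, Nat.mod_lt _ hn⟩).trans
    (isMatrix_matrixCode G ⟨k / n, Nat.div_lt_of_lt_mul h₁⟩ ⟨k % n, Nat.mod_lt _ hn⟩).symm
  simp only [Nat.div_add_mod'] at h3
  rw [← Bool.eq_iff_iff, bit, bit, List.getD_eq_getElem _ _ (by omega),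
    List.getD_eq_getElem _ _ h₂] at h3
  exact h3

/-- The number with the given binary digits. -/
def bitsValue (l : List Bool) : ℕ := l.foldr Nat.bit 0

theorem bitsValue_bits (k : ℕ) : bitsValue k.bits = k := by
  induction k using Nat.binaryRec' with
  | zero => simp [bitsValue]
  | bit b m h ih =>
    rw [Nat.bits_append_bit m b h]
    change Nat.bit b (bitsValue m.bits) = _
    rw [ih]

theorem reverse_headD_cons {b : Bool} {l : List Bool} (h : l ≠ []) :
    (b :: l).reverse.headD false = l.reverse.headD false := by
  obtain ⟨a, m, hm⟩ := List.exists_cons_of_ne_nil (List.reverse_ne_nil_iff.2 h)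
  rw [List.reverse_cons, hm]
  rfl

theorem isEmpty_or_head_cons {b : Bool} {l : List Bool} (h : l ≠ []) :
    ((b :: l).isEmpty || (b :: l).reverse.headD false) =
      (l.isEmpty || l.reverse.headD false) := by
  rw [reverse_headD_cons h]
  cases l with
  | nil => exact absurd rfl h
  | cons => rfl

/-- `Nat.bits` lists the digits from the lowest to the highest, so a nonempty numeral ends with 1.
Conversely, a word that is empty or ends with 1 is the numeral of its value. -/
theorem canonical_iff (l : List Bool) :
    (l.isEmpty || l.reverse.headD false) = true ↔ ∃ k, l = Nat.bits k := by
  constructor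
  · intro h
    refine ⟨bitsValue l, ?_⟩
    induction l with
    | nil => simp [bitsValue]
    | cons b l ih =>
      by_cases hl : l = []
      · subst hl
        have hb : b = true := h
        subst hb
        simp [bitsValue]
      · rw [isEmpty_or_head_cons hl] at h
        have hb : bitsValue l = 0 → b = true := fun h0 => by
          have := ih h
          rw [h0, Nat.zero_bits] at this
          exact absurd this hl
        change b :: l = (Nat.bit b (bitsValue l)).bits
        rw [Nat.bits_append_bit _ _ hb, ← ih h]
  · rintro ⟨k, rfl⟩
    induction k using Nat.binaryRec' with
    | zero => simp
    | bit b m h ih =>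
      rw [Nat.bits_append_bit m b h]
      by_cases hl : m.bits = []
      · have : m = 0 := by rw [← bitsValue_bits m, hl]; rfl
        rw [hl, h this]
        rfl
      · rwa [isEmpty_or_head_cons hl]

/-- Capping is compatible with Horner's scheme: min(N, 2 min(N, x) + b) = min(N, 2x + b). -/
theorem cappedValue_eq (N : ℕ) (l : List Bool) : cappedValue N l = min N (bitsValue l) := by
  rw [cappedValue, List.foldl_reverse]
  induction l with
  | nil => simp [bitsValue]
  | cons b l ih =>
    rw [List.foldr_cons, ih]
    have : bitsValue (b :: l) = 2 * bitsValue l + (if b then 1 else 0) := by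
      cases b <;> simp [bitsValue, Nat.bit]
    rw [this]
    simp only [decide_eq_true_iff]
    split_ifs <;> omega

/-- No bag has more than n vertices; hence testing against min(n, k) is the same as testing against
k. -/
theorem width_le_card {n : ℕ} : ∀ D : LabelledTree (Fin n), D.width ≤ n
  | .node C R ts => width_node_le.2 ⟨by simpa using C.card_le_univ, fun t _ => width_le_card t⟩

theorem instanceCode_eq (G : Digraph (Fin n)) (k : ℕ) : instanceCode G k =
    List.replicate n true ++ false :: (matrixCode G ++ Nat.bits k) := by
  simp [instanceCode, graphCode, matrixCode]

theorem parts_eq (n : ℕ) {M K : List Bool} (hM : M.length = n * n) :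
    leadingOnes (List.replicate n true ++ false :: (M ++ K)) = n ∧
      matrixPart (List.replicate n true ++ false :: (M ++ K)) = M ∧
      numberPart (List.replicate n true ++ false :: (M ++ K)) = K := by
  have h := leadingOnes_eq n (r := false :: (M ++ K)) rfl
  have h' : (List.replicate n true ++ false :: (M ++ K)).drop (n + 1) = M ++ K := by
    rw [← List.drop_drop, List.drop_left' (by simp)]
    rfl
  refine ⟨h, ?_, ?_⟩
  · rw [matrixPart, h, h', List.take_left' hM]
  · rw [numberPart, h, h', List.drop_left' hM]

theorem checkPair_iff (x w : List Bool) :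
    checkPair x w = true ↔ (x, w) ∈ decompositionRelation := by
  constructor
  · intro h
    rw [checkPair, Bool.and_eq_true] at h
    obtain ⟨h₁, h₂⟩ := h
    rw [checkInstance, Bool.and_eq_true, Bool.and_eq_true, canonical_iff, decide_eq_true_iff] at h₁
    obtain ⟨hlen, ⟨k, hk⟩, hloop⟩ := h₁
    obtain ⟨n, r, rfl, hr⟩ := exists_leadingOnes x
    have hn := leadingOnes_eq n hr
    rw [hn] at hlen
    simp only [List.length_append, List.length_replicate] at hlen
    rcases r with _ | ⟨b, r⟩
    · simp at hlen
      omega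
    obtain rfl : b = false := hr
    simp only [List.length_cons] at hlen
    obtain ⟨M, K, hM, rfl⟩ : ∃ M K : List Bool, M.length = n * n ∧ r = M ++ K :=
      ⟨r.take (n * n), r.drop (n * n), by simp; omega, (List.take_append_drop _ _).symm⟩
    obtain ⟨-, hMp, hKp⟩ := parts_eq n (M := M) (K := K) hM
    rw [hn, hMp] at hloop h₂
    rw [hKp] at h₂ hk
    subst hk
    let G : Digraph (Fin n) := ⟨fun i j => bit M (i * n + j) = true⟩
    have hG : IsMatrix G M := fun _ _ => Iff.rfl
    rw [cappedValue_eq, bitsValue_bits, checkTree_iff hG] at h₂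
    obtain ⟨D, hD, hw, rfl⟩ := h₂
    refine ⟨n, G, k, D, ?_, hD, hw.trans (min_le_right _ _), ?_⟩
    · intro v hv
      have := ball_fin.1 hloop v
      rw [hG v v |>.2 hv] at this
      simp at this
    · rw [instanceCode_eq, ← hG.eq_matrixCode hM]
  · rintro ⟨n, G, k, D, hloop, hD, hw, h⟩
    obtain ⟨rfl, rfl⟩ := Prod.mk.inj h
    obtain ⟨h₁, h₂, h₃⟩ := parts_eq n (K := Nat.bits k) (length_matrixCode G)
    rw [instanceCode_eq, checkPair, checkInstance, h₁, h₂, h₃, Bool.and_eq_true, Bool.and_eq_true,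
      Bool.and_eq_true, canonical_iff, cappedValue_eq, bitsValue_bits, ball_fin,
      checkTree_iff (isMatrix_matrixCode G)]
    refine ⟨⟨?_, ⟨k, rfl⟩, fun i => ?_⟩, D, hD, le_min (width_le_card D) hw, rfl⟩
    · simp [length_matrixCode]
      omega
    · have := (isMatrix_matrixCode G i i).not.2 (hloop i)
      simpa using this

theorem splitWord_eq (x : List Bool) {r : List Sym} (hr : ∀ b, r.head? ≠ some (some b)) :
    splitWord (x.map some ++ r) = (r, x.reverse) := by
  have key : ∀ (x : List Bool) (i : ℕ) (acc : List Bool), (fun s : List Sym × List Bool =>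
      if s.1.head? == some (some true) then (s.1.tail, true :: s.2)
      else if s.1.head? == some (some false) then (s.1.tail, false :: s.2) else s)^[x.length + i]
      (x.map some ++ r, acc) = (r, x.reverse ++ acc) := by
    intro x
    induction x with
    | nil =>
      intro i acc
      rw [List.length_nil, Nat.zero_add]
      exact Function.iterate_fixed (by simp [hr]) i
    | cons b x ih =>
      intro i acc
      rw [List.length_cons, Nat.add_right_comm, Function.iterate_succ_apply]
      have := ih i (b :: acc)
      cases b <;> simpa using this
  have := key x r.length []
  simpa [splitWord] using this

theorem checkWord_pairCode (x w : List Bool) : checkWord (pairCode (x, w)) = checkPair x w := by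
  have h₁ : splitWord (pairCode (x, w)) = (none :: w.map some, x.reverse) :=
    splitWord_eq x (by simp)
  have h₂ : splitWord (w.map some) = ([], w.reverse) := by
    have := splitWord_eq w (r := []) (by simp)
    rwa [List.append_nil] at this
  rw [checkWord, h₁, List.tail_cons, h₂, List.reverse_reverse, List.reverse_reverse]

theorem decidable_decompositionRelation : DecidableInPolyTime pairCode decompositionRelation :=
  ⟨fun p => checkWord (pairCode p), fun ⟨x, w⟩ => by
    change checkWord (pairCode (x, w)) = true ↔ _
    rw [checkWord_pairCode, checkPair_iff],
    PT.checkWord.computable pairCode⟩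

end WeakDagWidth

/-! ### Short separator chains -/

namespace SeparatorChain

open Relation

/-- A relation `S` of upward steps in a lattice that is compatible with a weight `w`: steps can be
projected below (above) an element of locally minimal weight. -/
structure Exchange {L : Type*} [Lattice L] (w : L → ℕ) (S : L → L → Prop) : Prop where
  le : ∀ {p q}, S p q → p ≤ q
  inf : ∀ {p q} (d), S p q → (∀ z, p ⊔ d ≤ z → z ≤ q ⊔ d → w d ≤ w z) → S (p ⊓ d) (q ⊓ d)
  sup : ∀ {p q} (d), S p q → (∀ z, p ⊓ d ≤ z → z ≤ q ⊓ d → w d ≤ w z) → S (p ⊔ d) (q ⊔ d)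

variable {L : Type*} [Lattice L] {w : L → ℕ} {S : L → L → Prop}

theorem Exchange.dual (h : Exchange w S) :
    Exchange (L := Lᵒᵈ) (fun p => w (OrderDual.ofDual p))
      (fun p q => S (OrderDual.ofDual q) (OrderDual.ofDual p)) where
  le hpq := h.le hpq
  inf d hpq hz := h.sup (OrderDual.ofDual d) hpq fun z h₁ h₂ => hz (OrderDual.toDual z) h₂ h₁
  sup d hpq hz := h.inf (OrderDual.ofDual d) hpq fun z h₁ h₂ => hz (OrderDual.toDual z) h₂ h₁

theorem Exchange.le_of_chain (h : Exchange w S) {p q : L} (hpq : ReflTransGen S p q) : p ≤ q := by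
  induction hpq with
  | refl => exact le_rfl
  | tail _ h₂ ih => exact ih.trans (h.le h₂)

/-- Each step p → q is projected on its own. The interval from p ⊔ a to q ⊔ a lies inside the one
from b ⊔ a to t ⊔ a, so the minimality of `w a` is inherited. -/
theorem Exchange.chain_inf (h : Exchange w S) {b t a : L} (hbt : ReflTransGen S b t)
    (hw : ∀ z, b ⊔ a ≤ z → z ≤ t ⊔ a → w a ≤ w z) : ReflTransGen S (b ⊓ a) (t ⊓ a) := by
  induction hbt with
  | refl => exact .refl
  | @tail p q h₁ h₂ ih =>
    have hbp := h.le_of_chain h₁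
    have hpq := h.le h₂
    refine (ih fun z hz hz' => hw z hz (hz'.trans (sup_le_sup_right hpq _))).tail
      (h.inf a h₂ fun z hz hz' => hw z ((sup_le_sup_right hbp _).trans hz) hz')

/-- At a peak `t` between `a` and `b` whose weight is minimal among all possible peaks and
at least the weights of `a` and `b`, there is also a valley between `a` and `b`. -/
theorem Exchange.valley_of_peak (h : Exchange w S) {a b t : L} (ha : ReflTransGen S a t)
    (hb : ReflTransGen S b t)
    (hmin : ∀ y, ReflTransGen S a y → ReflTransGen S b y → w t ≤ w y)
    (hwa : w a ≤ w t) (hwb : w b ≤ w t) :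
    ∃ d, ReflTransGen S d a ∧ ReflTransGen S d b := by
  have hat := h.le_of_chain ha
  have hbt := h.le_of_chain hb
  -- Let y be lightest between a ⊔ b and t. Projecting the two chains below y shows that y is a
  -- possible peak too, so by the choice of t nothing in this interval is lighter than t.
  obtain ⟨y, ⟨hy₁, hy₂⟩, hy⟩ : ∃ y, (a ⊔ b ≤ y ∧ y ≤ t) ∧
      ∀ z, a ⊔ b ≤ z → z ≤ t → w y ≤ w z := by
    obtain ⟨y, hy, hmin⟩ := WellFounded.has_min (InvImage.wf w Nat.lt_wfRel.wf)
      {y | a ⊔ b ≤ y ∧ y ≤ t} ⟨t, sup_le hat hbt, le_rfl⟩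
    exact ⟨y, hy, fun z h₁ h₂ => not_lt.1 (hmin z ⟨h₁, h₂⟩)⟩
  have hay := le_sup_left.trans hy₁
  have hby := le_sup_right.trans hy₁
  have key : ∀ c, c ≤ y → ReflTransGen S c t → ReflTransGen S c y := fun c hc hct => by
    have := h.chain_inf (a := y) hct fun z hz hz' =>
      hy z (hy₁.trans (le_sup_right.trans hz)) (hz'.trans (sup_le le_rfl hy₂))
    rwa [inf_of_le_left hc, inf_of_le_right hy₂] at this
  have ht : ∀ z, a ⊔ b ≤ z → z ≤ t → w t ≤ w z := fun z h₁ h₂ =>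
    (hmin y (key a hay ha) (key b hby hb)).trans (hy z h₁ h₂)
  -- Now a and b are at most as heavy as everything in the interval. So the chain from b to t can be
  -- projected below a, where it runs from a ⊓ b to a, and likewise with a and b exchanged.
  refine ⟨a ⊓ b, ?_, ?_⟩
  · have := h.chain_inf (a := a) hb fun z hz hz' =>
      hwa.trans (ht z (sup_comm b a ▸ hz) (hz'.trans (sup_le le_rfl hat)))
    rwa [inf_of_le_right hat, inf_comm] at this
  · have := h.chain_inf (a := b) ha fun z hz hz' =>
      hwb.trans (ht z hz (hz'.trans (sup_le le_rfl hbt)))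
    rwa [inf_of_le_right hbt] at this

theorem chain_dual {X : Type*} {S : X → X → Prop} {p q : X} :
    ReflTransGen (α := Xᵒᵈ) (fun p q => S (OrderDual.ofDual q) (OrderDual.ofDual p))
      (OrderDual.toDual p) (OrderDual.toDual q) ↔ ReflTransGen S q p :=
  reflTransGen_swap

theorem Exchange.peak_of_valley (h : Exchange w S) {a b t : L} (ha : ReflTransGen S t a)
    (hb : ReflTransGen S t b)
    (hmin : ∀ y, ReflTransGen S y a → ReflTransGen S y b → w t ≤ w y)
    (hwa : w a ≤ w t) (hwb : w b ≤ w t) :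
    ∃ d, ReflTransGen S a d ∧ ReflTransGen S b d := by
  obtain ⟨d, h₁, h₂⟩ := h.dual.valley_of_peak (a := OrderDual.toDual a) (b := OrderDual.toDual b)
    (t := OrderDual.toDual t) (chain_dual.2 ha) (chain_dual.2 hb)
    (fun y h₁ h₂ => hmin (OrderDual.ofDual y) (chain_dual.1 h₁) (chain_dual.1 h₂)) hwa hwb
  exact ⟨OrderDual.ofDual d, chain_dual.1 h₁, chain_dual.1 h₂⟩

/-! ### Zigzags of monotone chains -/

/-- `a` and `b` are the ends of a monotone chain of steps. -/
def Joined {X : Type*} (S : X → X → Prop) (a b : X) : Prop := ReflTransGen S a b ∨ ReflTransGen S b a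

/-- `T 0, …, T h` is a sequence of turning points. -/
def Zigzag {X : Type*} (S : X → X → Prop) (T : ℕ → X) (h : ℕ) : Prop :=
  ∀ i < h, Joined S (T i) (T (i + 1))

theorem Zigzag.remove {X : Type*} {S : X → X → Prop} {T : ℕ → X} {h i : ℕ}
    (hT : Zigzag S T (h + 1))
    (hi : i < h) (hJ : Joined S (T i) (T (i + 2))) :
    ∃ T', Zigzag S T' h ∧ T' 0 = T 0 ∧ T' h = T (h + 1) := by
  refine ⟨fun j => if j ≤ i then T j else T (j + 1), fun j hj => ?_, by simp, ?_⟩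
  · rcases lt_trichotomy j i with hji | rfl | hji
    · simpa [hji.le, Nat.succ_le_of_lt hji] using hT j (by omega)
    · simpa using hJ
    · simpa [hji.not_ge, show ¬ j + 1 ≤ i by omega] using hT (j + 1) (by omega)
  · simp [show ¬ h ≤ i by omega]

theorem Zigzag.update {X : Type*} {S : X → X → Prop} {T : ℕ → X} {h i : ℕ}
    (hT : Zigzag S T h) {d : X}
    (h₁ : Joined S (T i) d) (h₂ : Joined S d (T (i + 2))) :
    Zigzag S (Function.update T (i + 1) d) h := by
  intro j hj
  by_cases hji : j = i
  · subst hji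
    simpa using h₁
  · by_cases hji' : j = i + 1
    · subst hji'
      simpa using h₂
    · rw [Function.update_of_ne hji', Function.update_of_ne (by omega)]
      exact hT j hj

/-- From the first step that does not go down, all later steps go strictly up. So there are at most
n strict descents, one possibly flat step, and at most n strict ascents. -/
theorem length_le_of_no_local_max {f : ℕ → ℕ} {n h : ℕ} (hn : ∀ i, f i ≤ n)
    (hf : ∀ i, i + 2 ≤ h → f i ≤ f (i + 1) → f (i + 1) < f (i + 2)) : h ≤ 2 * n + 1 := by
  have up : ∀ i m, i + 1 + m ≤ h → f i ≤ f (i + 1) →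
      f (i + 1) + m ≤ f (i + 1 + m) ∧ f (i + m) ≤ f (i + m + 1) := by
    intro i m
    induction m with
    | zero => intro _ h; exact ⟨le_rfl, h⟩
    | succ m ih =>
      intro h₁ h₂
      obtain ⟨h₃, h₄⟩ := ih (by omega) h₂
      have h₅ := hf (i + m) (by omega) h₄
      have e : i + 1 + m = i + m + 1 := by omega
      rw [e] at h₃
      exact ⟨by rw [show i + 1 + (m + 1) = i + m + 2 by omega]; omega, h₅.le⟩
  have down : ∀ i, i ≤ h → (∀ j < i, f (j + 1) < f j) → f i + i ≤ f 0 := by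
    intro i
    induction i with
    | zero => intro _ _; exact le_rfl
    | succ i ih =>
      intro h₁ h₂
      have := ih (by omega) fun j hj => h₂ j (by omega)
      have := h₂ i (by omega)
      omega
  by_contra! hh
  by_cases hex : ∃ i, i < h ∧ f i ≤ f (i + 1)
  · classical
    have h₁ := Nat.find_spec hex
    have h₂ := down (Nat.find hex) h₁.1.le fun j hj => by
      have := Nat.find_min hex hj
      have hlt := h₁.1
      by_contra! h₃
      exact this ⟨by omega, h₃⟩
    have h₃ := (up _ (h - Nat.find hex - 1) (by omega) h₁.2).1
    have := hn 0
    have := hn (Nat.find hex + 1 + (h - Nat.find hex - 1))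
    omega
  · push Not at hex
    have := down h le_rfl hex
    have := hn 0
    omega

/-- Any two elements connected by steps are connected by few monotone chains. -/
theorem Exchange.exists_short_zigzag (h : Exchange w S) {n : ℕ} (hn : ∀ p, w p ≤ n) {a b : L}
    (hab : ReflTransGen (fun p q => S p q ∨ S q p) a b) :
    ∃ T : ℕ → L, ∃ m ≤ 2 * n + 2, Zigzag S T m ∧ T 0 = a ∧ T m = b := by
  classical
  have hex : ∃ m, ∃ T : ℕ → L, Zigzag S T m ∧ T 0 = a ∧ T m = b := by
    induction hab with
    | refl => exact ⟨0, fun _ => a, fun i hi => absurd hi (by omega), rfl, rfl⟩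
    | @tail p q _ h₂ ih =>
      obtain ⟨m, T, hT, h0, hm⟩ := ih
      refine ⟨m + 1, fun i => if i ≤ m then T i else q, fun i hi => ?_, by simp [h0], by simp⟩
      rcases Nat.lt_succ_iff_lt_or_eq.1 hi with hi | rfl
      · simpa [hi.le, Nat.succ_le_of_lt hi] using hT i hi
      · simpa [hm, Joined] using h₂.imp ReflTransGen.single ReflTransGen.single
  obtain ⟨T₀, hT₀⟩ := Nat.find_spec hex
  have hmin := fun m (hm : m < Nat.find hex) => Nat.find_min hex hm
  generalize Nat.find hex = m at hT₀ hmin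
  -- Among the zigzags with the fewest chains, one of least total weight. The last turning point is
  -- fixed, so the sum may omit it.
  obtain ⟨T, ⟨hT, hTa, hTb⟩, hTw⟩ := WellFounded.has_min
    (InvImage.wf (fun T : ℕ → L => ∑ i ∈ Finset.range m, w (T i)) Nat.lt_wfRel.wf)
    {T | Zigzag S T m ∧ T 0 = a ∧ T m = b} ⟨T₀, hT₀⟩
  refine ⟨T, m, ?_, hT, hTa, hTb⟩
  have noshort : ∀ T', Zigzag S T' m → T' 0 = a → T' m = b → ∀ i, i + 2 ≤ m →
      ¬ Joined S (T' i) (T' (i + 2)) := by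
    intro T' hT' h0 hm i hi hJ
    obtain ⟨m', rfl⟩ : ∃ m', m = m' + 1 := ⟨m - 1, by omega⟩
    obtain ⟨T'', h₁, h₂, h₃⟩ := hT'.remove (by omega) hJ
    exact hmin m' (by omega) ⟨T'', h₁, h₂.trans h0, h₃.trans hm⟩
  -- This gives m ≥ 3 even for n = 0, so three consecutive turning points always have a further
  -- neighbour on at least one side.
  by_contra! hm
  have hupd : ∀ i, i + 2 ≤ m → ∀ d, Joined S (T i) d → Joined S d (T (i + 2)) →
      w (T (i + 1)) ≤ w d ∧ (∀ j, j + 2 ≤ m →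
        ¬ Joined S (Function.update T (i + 1) d j) (Function.update T (i + 1) d (j + 2))) := by
    intro i hi d h₁ h₂
    have hz := hT.update h₁ h₂
    have e0 : Function.update T (i + 1) d 0 = a := by
      rw [Function.update_of_ne (by omega), hTa]
    have em : Function.update T (i + 1) d m = b ∨ m = i + 1 := by
      by_cases hmi : m = i + 1
      · exact .inr hmi
      · rw [Function.update_of_ne hmi, hTb]
        exact .inl rfl
    have em : Function.update T (i + 1) d m = b := em.resolve_right (by omega)
    refine ⟨?_, noshort _ hz e0 em⟩
    have hs := hTw _ ⟨hz, e0, em⟩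
    by_contra! hlt
    refine hs (Finset.sum_lt_sum (fun j _ => ?_) ⟨i + 1, Finset.mem_range.2 (by omega), ?_⟩)
    · by_cases hj : j = i + 1
      · subst hj
        simpa using hlt.le
      · rw [Function.update_of_ne hj]
    · simpa using hlt
  have nomax : ∀ i, i + 2 ≤ m → w (T i) ≤ w (T (i + 1)) → w (T (i + 1)) < w (T (i + 2)) := by
    intro i hi hw₁
    by_contra! hw₂
    have hno := noshort T hT hTa hTb
    -- The element d replaces T (i + 1) on the other side of both neighbours. A chain that arrives
    -- at T i or leaves T (i + 2) is then continued monotonically either by T (i + 1) or by d, which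
    -- would save a turning point.
    suffices hd : ∃ d, Joined S (T i) d ∧ Joined S d (T (i + 2)) ∧
        (∀ c, Joined S c (T i) → Joined S c (T (i + 1)) ∨ Joined S c d) ∧
        (∀ c, Joined S (T (i + 2)) c → Joined S (T (i + 1)) c ∨ Joined S d c) by
      obtain ⟨d, h₁, h₂, h₃, h₄⟩ := hd
      obtain ⟨-, hno'⟩ := hupd i hi d h₁ h₂
      by_cases hi0 : i = 0
      · have hJ := hT (i + 2) (by omega)
        rcases h₄ _ hJ with h | h
        · exact hno (i + 1) (by omega) h
        · refine hno' (i + 1) (by omega) ?_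
          rwa [Function.update_self, Function.update_of_ne (by omega)]
      · obtain ⟨j, rfl⟩ : ∃ j, i = j + 1 := ⟨i - 1, by omega⟩
        rcases h₃ _ (hT j (by omega)) with h | h
        · exact hno j (by omega) h
        · refine hno' j (by omega) ?_
          rwa [Function.update_self, Function.update_of_ne (by omega)]
    rcases hT i (by omega) with h₁ | h₁ <;> rcases hT (i + 1) (by omega) with h₂ | h₂
    · exact absurd (.inl (h₁.trans h₂)) (hno i hi)
    · obtain ⟨d, h₃, h₄⟩ := h.valley_of_peak h₁ h₂
        (fun y h₁ h₂ => (hupd i hi y (.inl h₁) (.inr h₂)).1) hw₁ hw₂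
      refine ⟨d, .inr h₃, .inl h₄, ?_, ?_⟩
      · rintro c (hc | hc)
        · exact .inl (.inl (hc.trans h₁))
        · exact .inr (.inr (h₃.trans hc))
      · rintro c (hc | hc)
        · exact .inr (.inl (h₄.trans hc))
        · exact .inl (.inr (hc.trans h₂))
    · obtain ⟨d, h₃, h₄⟩ := h.peak_of_valley h₁ h₂
        (fun y h₁ h₂ => (hupd i hi y (.inr h₁) (.inl h₂)).1) hw₁ hw₂
      refine ⟨d, .inl h₃, .inr h₄, ?_, ?_⟩
      · rintro c (hc | hc)
        · exact .inr (.inl (hc.trans h₃))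
        · exact .inl (.inr (h₁.trans hc))
      · rintro c (hc | hc)
        · exact .inl (.inl (h₂.trans hc))
        · exact .inr (.inr (hc.trans h₄))
    · exact absurd (.inr (h₂.trans h₁)) (hno i hi)
  have := length_le_of_no_local_max (f := fun i => w (T i)) (fun i => hn _) nomax
  omega

/-! ### Bounded numbers of moves -/

/-- `b` can be reached from `a` by at most `m` steps of `r`. -/
inductive Within {α : Type*} (r : α → α → Prop) : ℕ → α → α → Prop
  | refl (m a) : Within r m a a
  | head {m a b c} : r a b → Within r m b c → Within r (m + 1) a c

theorem Within.mono {α : Type*} {r : α → α → Prop} {m m' : ℕ} {a b : α} (h : Within r m a b)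
    (hm : m ≤ m') : Within r m' a b := by
  induction h generalizing m' with
  | refl => exact .refl _ _
  | head h₁ _ ih =>
    obtain ⟨m', rfl⟩ : ∃ k, m' = k + 1 := ⟨m' - 1, by omega⟩
    exact .head h₁ (ih (by omega))

theorem Within.trans {α : Type*} {r : α → α → Prop} {m m' : ℕ} {a b c : α} (h : Within r m a b)
    (h' : Within r m' b c) : Within r (m + m') a c := by
  induction h with
  | refl => exact h'.mono (by omega)
  | head h₁ _ ih => exact (Within.head h₁ (ih h')).mono (by omega)

/-- A monotone chain becomes short after removing trivial steps. -/
theorem within_of_chain {α : Type*} {r : α → α → Prop} {g : L → α} (h : Exchange w S)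
    {ρ : L → ℕ} (hρ : ∀ {p q}, p < q → ρ p < ρ q) {l : ℕ}
    (hS : ∀ {p q}, S p q → Within r l (g p) (g q) ∧ Within r l (g q) (g p)) {p q : L}
    (hpq : ReflTransGen S p q) :
    Within r (l * (ρ q - ρ p)) (g p) (g q) ∧ Within r (l * (ρ q - ρ p)) (g q) (g p) := by
  induction hpq with
  | refl => exact ⟨.refl _ _, .refl _ _⟩
  | @tail x y h₁ h₂ ih =>
    rcases (h.le h₂).eq_or_lt with rfl | hlt
    · exact ih
    · have hxy := hρ hlt
      have hpx : ρ p ≤ ρ x := by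
        rcases (h.le_of_chain h₁).eq_or_lt with rfl | h
        · exact le_rfl
        · exact (hρ h).le
      have hle : l * (ρ x - ρ p) + l ≤ l * (ρ y - ρ p) := by
        rw [← Nat.mul_succ]
        exact Nat.mul_le_mul_left _ (by omega)
      exact ⟨(ih.1.trans (hS h₂).1).mono hle, ((hS h₂).2.trans ih.2).mono (by omega)⟩

/-- The product counts at most 2n + 2 chains, at most N proper steps in a chain by the rank ρ, and l
moves of r for every step. -/
theorem Exchange.within {α : Type*} {r : α → α → Prop} {g : L → α} (h : Exchange w S) {n N : ℕ}
    (hn : ∀ p, w p ≤ n) {ρ : L → ℕ} (hρ : ∀ {p q}, p < q → ρ p < ρ q) (hN : ∀ p, ρ p ≤ N) {l : ℕ}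
    (hS : ∀ {p q}, S p q → Within r l (g p) (g q) ∧ Within r l (g q) (g p)) {a b : L}
    (hab : ReflTransGen (fun p q => S p q ∨ S q p) a b) :
    Within r ((2 * n + 2) * (l * N)) (g a) (g b) := by
  obtain ⟨T, m, hm, hT, rfl, rfl⟩ := h.exists_short_zigzag hn hab
  suffices ∀ i ≤ m, Within r (i * (l * N)) (g (T 0)) (g (T i)) from
    (this m le_rfl).mono (Nat.mul_le_mul_right _ hm)
  intro i
  induction i with
  | zero => intro _; exact .refl _ _
  | succ i ih =>
    intro hi
    rw [Nat.succ_mul]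
    refine (ih (by omega)).trans ?_
    have hb : ∀ p q, l * (ρ q - ρ p) ≤ l * N := fun p q =>
      Nat.mul_le_mul_left _ ((Nat.sub_le _ _).trans (hN q))
    rcases hT i (by omega) with h' | h'
    · exact (within_of_chain h hρ hS h').1.mono (hb _ _)
    · exact (within_of_chain h hρ hS h').2.mono (hb _ _)

end SeparatorChain

/-! ### Strong components and separations -/

namespace WeakDagWidth

open Relation

section Components

variable {V : Type*} {G : Digraph V} {Y Z K K' S : Set V} {u v w : V}

theorem ReachIn.refl (hu : u ∈ Y) : ReachIn G Y u u := ⟨hu, .refl⟩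

theorem ReachIn.trans (h₁ : ReachIn G Y u v) (h₂ : ReachIn G Y v w) : ReachIn G Y u w :=
  ⟨h₁.1, h₁.2.trans h₂.2⟩

theorem ReachIn.right_mem (h : ReachIn G Y u v) : v ∈ Y := by
  obtain ⟨hu, h⟩ := h
  induction h with
  | refl => exact hu
  | tail _ h₂ _ => exact h₂.2

theorem ReachIn.tail (h : ReachIn G Y u v) (hvw : G.Adj v w) (hw : w ∈ Y) : ReachIn G Y u w :=
  ⟨h.1, h.2.tail ⟨hvw, hw⟩⟩

theorem ReachIn.mono (hYZ : Y ⊆ Z) (h : ReachIn G Y u v) : ReachIn G Z u v :=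
  ⟨hYZ h.1, ReflTransGen.mono (fun _ _ h => ⟨h.1, hYZ h.2⟩) _ _ h.2⟩

theorem reachSet_mono (hYZ : Y ⊆ Z) : reachSet G Y S ⊆ reachSet G Z S :=
  fun _ ⟨u, hu, h⟩ => ⟨u, hu, h.mono hYZ⟩

/-- Every vertex of a walk in `G[Y]` is reachable from its start and reaches its end. -/
theorem ReachIn.of_between {P : Set V} (h : ReachIn G Y u w)
    (hP : ∀ x, ReachIn G Y u x → ReachIn G Y x w → x ∈ P) : ReachIn G (P ∩ Y) u w := by
  obtain ⟨hu, h⟩ := h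
  induction h with
  | refl => exact .refl ⟨hP _ (.refl hu) (.refl hu), hu⟩
  | @tail x y h₁ h₂ ih =>
    have hx : ReachIn G Y u x := ⟨hu, h₁⟩
    have hy : ReachIn G Y u y := hx.tail h₂.1 h₂.2
    refine (ih fun z hz hzx => hP z hz (hzx.tail h₂.1 h₂.2)).tail h₂.1 ⟨?_, h₂.2⟩
    exact hP y hy (.refl h₂.2)

theorem IsComponent.subset (h : IsComponent G Y K) : K ⊆ Y := by
  obtain ⟨v, _, rfl⟩ := h
  exact fun w hw => hw.1.right_mem

theorem IsComponent.nonempty (h : IsComponent G Y K) : K.Nonempty := by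
  obtain ⟨v, hv, rfl⟩ := h
  exact ⟨v, .refl hv, .refl hv⟩

theorem IsComponent.eq_class (h : IsComponent G Y K) (hv : v ∈ K) :
    K = {w | ReachIn G Y v w ∧ ReachIn G Y w v} := by
  obtain ⟨u, hu, rfl⟩ := h
  ext w
  exact ⟨fun hw => ⟨hv.2.trans hw.1, hw.2.trans hv.1⟩,
    fun hw => ⟨hv.1.trans hw.1, hw.2.trans hv.2⟩⟩

theorem IsComponent.eq_of_mem (h : IsComponent G Y K) (h' : IsComponent G Y K') (hv : v ∈ K)
    (hv' : v ∈ K') : K = K' := by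
  rw [h.eq_class hv, h'.eq_class hv']

theorem IsComponent.reach (h : IsComponent G Y K) (hv : v ∈ K) (hw : w ∈ K) :
    ReachIn G Y v w := by
  rw [h.eq_class hv] at hw
  exact hw.1

theorem exists_component (G : Digraph V) (hv : v ∈ Y) : ∃ K, IsComponent G Y K ∧ v ∈ K :=
  ⟨_, ⟨v, hv, rfl⟩, .refl hv, .refl hv⟩

/-- The components of an induced subgraph of a component `K` of `G[Y]`. -/
theorem IsComponent.restrict_iff (h : IsComponent G Y K) (hZ : Z ⊆ Y) :
    IsComponent G (K ∩ Z) K' ↔ IsComponent G Z K' ∧ K' ⊆ K := by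
  -- A walk in G[Z] between mutually reachable vertices visits only their class, and this class lies
  -- in K because Z ⊆ Y.
  have key : ∀ v ∈ K, {w | ReachIn G (K ∩ Z) v w ∧ ReachIn G (K ∩ Z) w v} =
      {w | ReachIn G Z v w ∧ ReachIn G Z w v} := by
    intro v hv
    ext w
    refine ⟨fun hw => ⟨hw.1.mono Set.inter_subset_right, hw.2.mono Set.inter_subset_right⟩,
      fun hw => ⟨hw.1.of_between fun x h₁ h₂ => ?_, hw.2.of_between fun x h₁ h₂ => ?_⟩⟩ <;>
    rw [h.eq_class hv]
    · exact ⟨h₁.mono hZ, (h₂.trans hw.2).mono hZ⟩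
    · exact ⟨(hw.1.trans h₁).mono hZ, h₂.mono hZ⟩
  constructor
  · intro h'
    refine ⟨?_, h'.subset.trans Set.inter_subset_left⟩
    obtain ⟨v, hv, rfl⟩ := h'
    exact ⟨v, hv.2, key v hv.1⟩
  · rintro ⟨h', hK⟩
    obtain ⟨v, hv⟩ := h'.nonempty
    exact ⟨v, ⟨hK hv, h'.subset hv⟩, by rw [key v (hK hv), ← h'.eq_class hv]⟩

theorem IsComponent.self (h : IsComponent G Y K) : IsComponent G K K := by
  have := (h.restrict_iff Set.Subset.rfl (K' := K)).2 ⟨h, Set.Subset.rfl⟩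
  rwa [Set.inter_eq_left.2 h.subset] at this

/-- If the component `K` of `G[Y]` lies in `Z` and everything that is reachable from `K` in `G[Z]`
lies in `Y`, then `K` is a component of `G[Z]`. -/
theorem IsComponent.of_reachSet_subset (h : IsComponent G Y K) (hK : K ⊆ Z)
    (hZ : reachSet G Z K ⊆ Y) : IsComponent G Z K := by
  obtain ⟨v, hv⟩ := h.nonempty
  refine ⟨v, hK hv, ?_⟩
  ext w
  constructor
  · intro hw
    exact ⟨(h.self.reach hv hw).mono hK, (h.self.reach hw hv).mono hK⟩
  · rintro ⟨h₁, h₂⟩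
    rw [h.eq_class hv]
    refine ⟨(h₁.of_between (P := Y) fun x hx _ => hZ ⟨v, hv, hx⟩).mono Set.inter_subset_left,
      (h₂.of_between (P := Y) fun x hx _ => hZ ⟨v, hv, h₁.trans hx⟩).mono Set.inter_subset_left⟩

end Components

/-! ### The lattice of separations and the shortening of idle moves -/

section Separations

variable {V : Type*} [DecidableEq V] (G : Digraph V) (R m : Finset V) (k : ℕ)

/-- The separations `(I, J)` with `R ⊆ I ⊆ J`, `I` disjoint from `m`, and no edge from `I` to the
complement of `J`. The vertices in `J \ I` guard `m` against `R`. -/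
def separations : Sublattice (Finset V × Finset V) where
  carrier := {p | R ⊆ p.1 ∧ p.1 ⊆ p.2 ∧ Disjoint p.1 m ∧ ∀ u ∈ p.1, ∀ v, G.Adj u v → v ∈ p.2}
  supClosed' := by
    rintro ⟨I, J⟩ ⟨h₁, h₂, h₃, h₄⟩ ⟨I', J'⟩ ⟨h₁', h₂', h₃', h₄'⟩
    refine ⟨h₁.trans Finset.subset_union_left, Finset.union_subset_union h₂ h₂',
      Finset.disjoint_union_left.2 ⟨h₃, h₃'⟩, fun u hu v huv => ?_⟩
    rcases Finset.mem_union.1 hu with hu | hu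
    · exact Finset.mem_union_left _ (h₄ u hu v huv)
    · exact Finset.mem_union_right _ (h₄' u hu v huv)
  infClosed' := by
    rintro ⟨I, J⟩ ⟨h₁, h₂, h₃, h₄⟩ ⟨I', J'⟩ ⟨h₁', h₂', h₃', h₄'⟩
    refine ⟨Finset.subset_inter h₁ h₁', Finset.inter_subset_inter h₂ h₂',
      Disjoint.mono_left Finset.inter_subset_left h₃, fun u hu v huv => ?_⟩
    obtain ⟨hu, hu'⟩ := Finset.mem_inter.1 hu
    exact Finset.mem_inter.2 ⟨h₄ u hu v huv, h₄' u hu' v huv⟩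

variable {G R m k}

/-- The guards of a separation. -/
def guards (p : separations G R m) : Finset V := p.1.2 \ p.1.1

theorem mem_guards {p : separations G R m} {v : V} : v ∈ guards p ↔ v ∈ p.1.2 ∧ v ∉ p.1.1 :=
  Finset.mem_sdiff

/-- The number of guards is |J| - |I|, and both cardinalities are modular. -/
theorem card_guards_inf_add_sup (p q : separations G R m) :
    (guards (p ⊓ q)).card + (guards (p ⊔ q)).card = (guards p).card + (guards q).card := by
  have h : ∀ p : separations G R m, (guards p).card + p.1.1.card = p.1.2.card := fun p =>
    Finset.card_sdiff_add_card_eq_card p.2.2.1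
  have h₁ := h p
  have h₂ := h q
  have h₃ : (guards (p ⊓ q)).card + (p.1.1 ∩ q.1.1).card = (p.1.2 ∩ q.1.2).card := h (p ⊓ q)
  have h₄ : (guards (p ⊔ q)).card + (p.1.1 ∪ q.1.1).card = (p.1.2 ∪ q.1.2).card := h (p ⊔ q)
  have h₅ := Finset.card_union_add_card_inter p.1.1 q.1.1
  have h₆ := Finset.card_union_add_card_inter p.1.2 q.1.2
  omega

/-- The cops can move between the guards of `p ≤ q`, using at most `k` cops. -/
def SepStep (k : ℕ) (p q : separations G R m) : Prop :=
  p ≤ q ∧ (guards p ∪ guards q).card ≤ k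

theorem mem_guards_inf {p q : separations G R m} {v : V} :
    v ∈ guards (p ⊓ q) ↔ (v ∈ p.1.2 ∧ v ∈ q.1.2) ∧ ¬ (v ∈ p.1.1 ∧ v ∈ q.1.1) := by
  rw [mem_guards]
  exact and_congr Finset.mem_inter (not_congr Finset.mem_inter)

theorem mem_guards_sup {p q : separations G R m} {v : V} :
    v ∈ guards (p ⊔ q) ↔ (v ∈ p.1.2 ∨ v ∈ q.1.2) ∧ ¬ (v ∈ p.1.1 ∨ v ∈ q.1.1) := by
  rw [mem_guards]
  exact and_congr Finset.mem_union (not_congr Finset.mem_union)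

/-- The cost of a step is the size of a union of two guard sets, to which modularity does not apply.
The separation M stands in for this union: its guards are among those of p and q, and after
projection below d they contain the guards of both ends. -/
theorem exists_lower_between {p q : separations G R m} (hpq : p ≤ q) :
    ∃ M : separations G R m, p ≤ M ∧ M ≤ q ∧ guards M ⊆ guards p ∪ guards q ∧
      ∀ d, guards (p ⊓ d) ∪ guards (q ⊓ d) ⊆ guards (M ⊓ d) := by
  have hle₁ : p.1.1 ⊆ q.1.1 := hpq.1
  have hle₂ : p.1.2 ⊆ q.1.2 := hpq.2
  have hM : (q.1.1 \ guards p, q.1.2) ∈ separations G R m := by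
    refine ⟨fun v hv => Finset.mem_sdiff.2 ⟨q.2.1 hv, fun h => (mem_guards.1 h).2 (p.2.1 hv)⟩,
      Finset.sdiff_subset.trans q.2.2.1, Disjoint.mono_left Finset.sdiff_subset q.2.2.2.1,
      fun u hu v huv => q.2.2.2.2 u (Finset.sdiff_subset hu) v huv⟩
  refine ⟨⟨_, hM⟩, ⟨fun v hv => Finset.mem_sdiff.2 ⟨hle₁ hv, fun h => (mem_guards.1 h).2 hv⟩,
    hle₂⟩, ⟨Finset.sdiff_subset, Finset.Subset.refl _⟩, fun v hv => ?_, fun d v hv => ?_⟩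
  · obtain ⟨h₁, h₂⟩ := mem_guards.1 hv
    by_contra h₃
    rw [Finset.mem_union, not_or] at h₃
    refine h₂ (Finset.mem_sdiff.2 ⟨?_, h₃.1⟩)
    by_contra h₄
    exact h₃.2 (mem_guards.2 ⟨h₁, h₄⟩)
  · rw [mem_guards_inf]
    rcases Finset.mem_union.1 hv with hv | hv <;> obtain ⟨h₁, h₂⟩ := mem_guards_inf.1 hv
    · refine ⟨⟨hle₂ h₁.1, h₁.2⟩, fun h₃ => (Finset.mem_sdiff.1 h₃.1).2 (mem_guards.2 ⟨h₁.1, ?_⟩)⟩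
      exact fun h₄ => h₂ ⟨h₄, h₃.2⟩
    · exact ⟨h₁, fun h₃ => h₂ ⟨(Finset.mem_sdiff.1 h₃.1).1, h₃.2⟩⟩

/-- The counterpart for projections above d: now the guards of q are added to J, instead of removing
those of p from I. -/
theorem exists_upper_between {p q : separations G R m} (hpq : p ≤ q) :
    ∃ M : separations G R m, p ≤ M ∧ M ≤ q ∧ guards M ⊆ guards p ∪ guards q ∧
      ∀ d, guards (p ⊔ d) ∪ guards (q ⊔ d) ⊆ guards (M ⊔ d) := by
  have hle₁ : p.1.1 ⊆ q.1.1 := hpq.1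
  have hle₂ : p.1.2 ⊆ q.1.2 := hpq.2
  have hM : (p.1.1, p.1.2 ∪ guards q) ∈ separations G R m :=
    ⟨p.2.1, p.2.2.1.trans Finset.subset_union_left, p.2.2.2.1,
      fun u hu v huv => Finset.mem_union_left _ (p.2.2.2.2 u hu v huv)⟩
  refine ⟨⟨_, hM⟩, ⟨Finset.Subset.refl _, Finset.subset_union_left⟩,
    ⟨hle₁, Finset.union_subset hle₂ Finset.sdiff_subset⟩, fun v hv => ?_, fun d v hv => ?_⟩
  · obtain ⟨h₁, h₂⟩ := mem_guards.1 hv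
    rcases Finset.mem_union.1 h₁ with h₁ | h₁
    · exact Finset.mem_union_left _ (mem_guards.2 ⟨h₁, h₂⟩)
    · exact Finset.mem_union_right _ h₁
  · rw [mem_guards_sup]
    rcases Finset.mem_union.1 hv with hv | hv <;> obtain ⟨h₁, h₂⟩ := mem_guards_sup.1 hv
    · exact ⟨h₁.imp_left fun h => Finset.mem_union_left _ h, h₂⟩
    · refine ⟨h₁.imp_left fun h => Finset.mem_union_right _ (mem_guards.2 ⟨h, fun h' => ?_⟩),
        fun h => h₂ (h.imp_left fun h => hle₁ h)⟩
      exact h₂ (.inl h')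

/-- By modularity, w(M ⊓ d) = w(M) + w(d) - w(M ⊔ d) ≤ w(M) ≤ k, since d is not heavier than M ⊔ d.
The guards of M ⊓ d contain those of both ends of the projected step. -/
theorem sepStep_exchange :
    SeparatorChain.Exchange (fun p : separations G R m => (guards p).card) (SepStep k) where
  le h := h.1
  inf {p q} d h hw := by
    obtain ⟨M, h₁, h₂, h₃, h₄⟩ := exists_lower_between h.1
    have h₅ := card_guards_inf_add_sup M d
    have h₆ := hw (M ⊔ d) (sup_le_sup_right h₁ _) (sup_le_sup_right h₂ _)
    have h₇ := (Finset.card_le_card h₃).trans h.2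
    have h₈ := Finset.card_le_card (h₄ d)
    exact ⟨inf_le_inf_right _ h.1, by omega⟩
  sup {p q} d h hw := by
    obtain ⟨M, h₁, h₂, h₃, h₄⟩ := exists_upper_between h.1
    have h₅ := card_guards_inf_add_sup M d
    have h₆ := hw (M ⊓ d) (inf_le_inf_right _ h₁) (inf_le_inf_right _ h₂)
    have h₇ := (Finset.card_le_card h₃).trans h.2
    have h₈ := Finset.card_le_card (h₄ d)
    exact ⟨sup_le_sup_right h.1 _, by omega⟩

variable (G R m k) in
/-- A cop move `C → C'` that does not enter the robber component `R`, uses at most `k` cops and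
keeps `m` separated from `R`. -/
def IdleMove (C C' : Finset V) : Prop :=
  Disjoint C' R ∧ C'.card ≤ k ∧ Disjoint (↑m : Set V) (reachSet G (↑(C ∩ C') : Set V)ᶜ ↑R)

theorem not_mem_of_mem_reachSet {V : Type*} {G : Digraph V} {R C : Finset V} {v : V}
    (h : v ∈ reachSet G (↑C : Set V)ᶜ (↑R : Set V)) : v ∉ C := by
  obtain ⟨u, _, h⟩ := h
  exact h.right_mem

/-- An edge that leaves I ends in J, hence on a guard. -/
theorem reachSet_guards_subset {C : Finset V} (p : separations G R m) (hC : guards p ⊆ C) :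
    reachSet G (↑C : Set V)ᶜ ↑R ⊆ ↑p.1.1 := by
  rintro v ⟨u, hu, _, h⟩
  induction h with
  | refl => exact p.2.1 hu
  | @tail x y _ h₂ ih =>
    by_contra hy
    exact h₂.2 (hC (mem_guards.2 ⟨p.2.2.2.2 x ih y h₂.1, hy⟩))

theorem disjoint_guards (p : separations G R m) : Disjoint (guards p) R :=
  Finset.disjoint_left.2 fun _ h h' => (mem_guards.1 h).2 (p.2.1 h')

/-- The cops first add the new guards and then withdraw the old ones. In both moves a complete set
of guards stays in place. -/
theorem within_of_sepStep {p q : separations G R m} (h : SepStep k p q) :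
    SeparatorChain.Within (IdleMove G R m k) 2 (guards p) (guards q) ∧
      SeparatorChain.Within (IdleMove G R m k) 2 (guards q) (guards p) := by
  have hsep : ∀ (p : separations G R m) (C : Finset V), guards p ⊆ C →
      Disjoint (↑m : Set V) (reachSet G (↑C : Set V)ᶜ ↑R) := fun p C hC =>
    Disjoint.mono_right (reachSet_guards_subset p hC) (Finset.disjoint_coe.2 p.2.2.2.1.symm)
  have key : ∀ p q : separations G R m, (guards p ∪ guards q).card ≤ k →
      SeparatorChain.Within (IdleMove G R m k) 2 (guards p) (guards q) := fun p q hk =>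
    .head (b := guards p ∪ guards q)
      ⟨Finset.disjoint_union_left.2 ⟨disjoint_guards p, disjoint_guards q⟩, hk,
        hsep p _ (Finset.subset_inter (Finset.Subset.refl _) Finset.subset_union_left)⟩
      (.head ⟨disjoint_guards q, (Finset.card_le_card Finset.subset_union_right).trans hk,
        hsep q _ (Finset.subset_inter Finset.subset_union_right (Finset.Subset.refl _))⟩
        (.refl _ _))
  exact ⟨key p q h.2, key q p (by rw [Finset.union_comm]; exact h.2)⟩

variable [Fintype V]

variable (G R) in
open Classical in
/-- The separation with guards `C` whose first part is reachable from `R`. -/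
noncomputable def sepPair (C : Finset V) : Finset V × Finset V :=
  ((reachSet G (↑C : Set V)ᶜ ↑R).toFinset, (reachSet G (↑C : Set V)ᶜ ↑R).toFinset ∪ C)

theorem mem_sepPair_fst {C : Finset V} {v : V} :
    v ∈ (sepPair G R C).1 ↔ v ∈ reachSet G (↑C : Set V)ᶜ ↑R := by
  simp [sepPair]

theorem mem_sepPair_snd {C : Finset V} {v : V} :
    v ∈ (sepPair G R C).2 ↔ v ∈ reachSet G (↑C : Set V)ᶜ ↑R ∨ v ∈ C := by
  simp [sepPair]

theorem sepPair_mem {C : Finset V} (hC : Disjoint C R)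
    (hm : Disjoint (↑m : Set V) (reachSet G (↑C : Set V)ᶜ ↑R)) :
    sepPair G R C ∈ separations G R m := by
  refine ⟨fun v hv => mem_sepPair_fst.2 ⟨v, hv, .refl (Finset.disjoint_right.1 hC hv)⟩,
    fun v hv => mem_sepPair_snd.2 (.inl (mem_sepPair_fst.1 hv)),
    Finset.disjoint_right.2 fun v hv hv' => Set.disjoint_left.1 hm hv (mem_sepPair_fst.1 hv'),
    fun u hu v huv => mem_sepPair_snd.2 ?_⟩
  obtain ⟨x, hx, h⟩ := mem_sepPair_fst.1 hu
  by_cases hv : v ∈ C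
  · exact .inr hv
  · exact .inl ⟨x, hx, h.tail huv hv⟩

theorem guards_sepPair {C : Finset V} (h : sepPair G R C ∈ separations G R m) :
    guards ⟨_, h⟩ = C := by
  ext v
  rw [mem_guards, mem_sepPair_snd, mem_sepPair_fst]
  refine ⟨fun h => h.1.resolve_left h.2, fun h => ⟨.inr h, fun h' => ?_⟩⟩
  exact not_mem_of_mem_reachSet h' h

/-- Separations whose guards are nested are connected by two steps. -/
theorem steps_of_subset {C D : Finset V} (hD : D ⊆ C) (hk : C.card ≤ k)
    (h : sepPair G R C ∈ separations G R m) (h' : sepPair G R D ∈ separations G R m) :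
    SepStep k (⟨_, h⟩ ⊓ ⟨_, h'⟩ : separations G R m) ⟨_, h⟩ ∧
      SepStep k (⟨_, h⟩ ⊓ ⟨_, h'⟩ : separations G R m) ⟨_, h'⟩ := by
  -- The separations of C and D need not be comparable: fewer guards enlarge the reachable part, but
  -- J loses vertices of C \ D. Their infimum is below both, and its guards lie in C.
  have hsub : guards (⟨_, h⟩ ⊓ ⟨_, h'⟩ : separations G R m) ⊆ C := by
    intro v hv
    obtain ⟨h₁, h₂⟩ := mem_guards.1 hv
    have h₁ := Finset.mem_inter.1 h₁
    have h₂ : ¬ v ∈ (sepPair G R C).1 ∩ (sepPair G R D).1 := h₂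
    rw [Finset.mem_inter, mem_sepPair_fst, mem_sepPair_fst] at h₂
    have h₃ := mem_sepPair_snd.1 h₁.1
    refine h₃.resolve_left fun h₄ => h₂ ⟨h₄, reachSet_mono ?_ h₄⟩
    exact Set.compl_subset_compl.2 (Finset.coe_subset.2 hD)
  refine ⟨⟨inf_le_left, ?_⟩, inf_le_right, ?_⟩ <;> rw [guards_sepPair]
  · exact (Finset.card_le_card (Finset.union_subset hsub (Finset.Subset.refl _))).trans hk
  · exact (Finset.card_le_card (Finset.union_subset hsub hD)).trans hk

/-- A move from D to D' is split at D ∩ D', which still separates m from R. Both halves are between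
nested placements and pass through an infimum, so one move becomes four lattice steps. -/
theorem separations_of_idleMoves {C C' : Finset V} (h : ReflTransGen (IdleMove G R m k) C C')
    (hC : Disjoint C R) (hk : C.card ≤ k) (hm : sepPair G R C ∈ separations G R m) :
    (Disjoint C' R ∧ C'.card ≤ k) ∧ ∃ hm' : sepPair G R C' ∈ separations G R m,
      ReflTransGen (fun p q => SepStep k p q ∨ SepStep k q p) (⟨_, hm⟩ : separations G R m)
        ⟨_, hm'⟩ := by
  induction h with
  | refl => exact ⟨⟨hC, hk⟩, hm, .refl⟩
  | @tail D D' _ h₂ ih =>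
    obtain ⟨⟨hD, hDk⟩, hmD, hch⟩ := ih
    obtain ⟨h₃, h₄, h₅⟩ := h₂
    have hm₁ : sepPair G R (D ∩ D') ∈ separations G R m :=
      sepPair_mem (Disjoint.mono_left Finset.inter_subset_left hD) h₅
    have hm₂ : sepPair G R D' ∈ separations G R m := sepPair_mem h₃ (Disjoint.mono_right
      (reachSet_mono (Set.compl_subset_compl.2 (Finset.coe_subset.2 Finset.inter_subset_right))) h₅)
    obtain ⟨s₁, s₂⟩ := steps_of_subset Finset.inter_subset_left hDk hmD hm₁
    obtain ⟨s₃, s₄⟩ := steps_of_subset Finset.inter_subset_right h₄ hm₂ hm₁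
    exact ⟨⟨h₃, h₄⟩, hm₂, (((hch.tail (.inr s₁)).tail (.inl s₂)).tail (.inr s₄)).tail (.inl s₃)⟩

/-- A sequence of idle moves can be replaced by a short one. -/
theorem exists_short_idleMoves {C C' : Finset V} (hC : Disjoint C R) (hk : C.card ≤ k)
    (h : ReflTransGen (IdleMove G R m k) C C') :
    SeparatorChain.Within (IdleMove G R m k)
      ((2 * Fintype.card V + 2) * (2 * (2 * Fintype.card V))) C C' := by
  rcases ReflTransGen.cases_head h with rfl | ⟨D, hD, -⟩
  · exact .refl _ _
  -- That C itself separates m from R is known only through the first move; an empty sequence needs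
  -- no argument.
  · have hm : sepPair G R C ∈ separations G R m := sepPair_mem hC (Disjoint.mono_right
      (reachSet_mono (Set.compl_subset_compl.2 (Finset.coe_subset.2 Finset.inter_subset_left)))
      hD.2.2)
    obtain ⟨-, hm', hch⟩ := separations_of_idleMoves h hC hk hm
    have := (sepStep_exchange (G := G) (R := R) (m := m) (k := k)).within (g := guards)
      (n := Fintype.card V) (fun p => Finset.card_le_univ _)
      (ρ := fun p => p.1.1.card + p.1.2.card) (N := 2 * Fintype.card V)
      (fun {p q} hpq => ?_) (fun p => ?_) (fun h => within_of_sepStep h) hch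
    · rwa [guards_sepPair, guards_sepPair] at this
    · have h₁ : p.1.1 ⊆ q.1.1 := hpq.le.1
      have h₂ : p.1.2 ⊆ q.1.2 := hpq.le.2
      have h₃ := Finset.card_le_card h₁
      have h₄ := Finset.card_le_card h₂
      by_contra! hlt
      refine hpq.ne (Subtype.ext (Prod.ext ?_ ?_))
      · exact Finset.eq_of_subset_of_card_le h₁ (by omega)
      · exact Finset.eq_of_subset_of_card_le h₂ (by omega)
    · have h₁ := Finset.card_le_univ p.1.1
      have h₂ := Finset.card_le_univ p.1.2
      change p.1.1.card + p.1.2.card ≤ _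
      omega

end Separations

end WeakDagWidth

/-! ### From winning strategies to decompositions -/

namespace WeakDagWidth

open Relation

section Game

variable {V : Type*} [DecidableEq V] {G : Digraph V} {k : ℕ}

/-- The cops win from the position `(C, R)`, if the chasers have been placed on `m` so far. -/
inductive WinsFrom (G : Digraph V) (k : ℕ) : Finset V → Finset V → Finset V → Prop
  | move {C R m : Finset V} (C' : Finset V) (card_le : C'.card ≤ k)
      (separated : Disjoint (↑m : Set V) (reachSet G (↑(C ∩ C') : Set V)ᶜ ↑R))
      (next : ∀ R' : Finset V, IsComponent G (↑(R \ C') : Set V) ↑R' →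
        WinsFrom G k C' R' (m ∪ (C' ∩ R))) : WinsFrom G k C R m

/-- Before the next chaser is placed, the cops make idle moves. -/
theorem WinsFrom.exists_chase {C R m : Finset V} (h : WinsFrom G k C R m)
    (hR : IsComponent G (↑R : Set V) ↑R) :
    ∃ D C' : Finset V, ReflTransGen (IdleMove G R m k) C D ∧ C'.card ≤ k ∧
      Disjoint (↑m : Set V) (reachSet G (↑(D ∩ C') : Set V)ᶜ ↑R) ∧ ¬ Disjoint C' R ∧
      ∀ R' : Finset V, IsComponent G (↑(R \ C') : Set V) ↑R' →
        WinsFrom G k C' R' (m ∪ (C' ∩ R)) := by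
  induction h with
  | @move C R m C' hk hsep hnext ih =>
    by_cases hd : Disjoint C' R
    · have hR' : IsComponent G (↑(R \ C') : Set V) ↑R := by
        rwa [Finset.sdiff_eq_self_of_disjoint hd.symm]
      have ih := ih R hR' hR
      rw [Finset.disjoint_iff_inter_eq_empty.1 hd, Finset.union_empty] at ih
      obtain ⟨D, C'', h₁, h₂⟩ := ih
      exact ⟨D, C'', .head ⟨hd, hk, hsep⟩ h₁, h₂⟩
    · exact ⟨C, C', .refl, hk, hsep, hd, hnext⟩

/-- The component of `G - (C ∩ C')` that contains `R` is `R` itself, if `m` is separated. -/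
theorem isComponent_of_separated {C C' R m : Finset V} (hR : IsComponent G (↑m : Set V)ᶜ ↑R)
    (hC : Disjoint C R) (hsep : Disjoint (↑m : Set V) (reachSet G (↑(C ∩ C') : Set V)ᶜ ↑R)) :
    IsComponent G (↑(C ∩ C') : Set V)ᶜ ↑R :=
  hR.of_reachSet_subset
    (fun _ hv hv' => Finset.disjoint_right.1 hC hv (Finset.mem_inter.1 hv').1)
    fun _ hv hv' => Set.disjoint_left.1 hsep hv' hv

/-- R is itself the component of G - (C ∩ C') in which the robber moves. So he ends in a component
of G - C' inside R, and these are the components of G[R \ C']. -/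
theorem legalRobberMove_iff {C C' R m : Finset V} (hR : IsComponent G (↑m : Set V)ᶜ ↑R)
    (hC : Disjoint C R) (hsep : Disjoint (↑m : Set V) (reachSet G (↑(C ∩ C') : Set V)ᶜ ↑R))
    (R' : Finset V) :
    LegalRobberMove G C C' R R' ↔ IsComponent G (↑(R \ C') : Set V) ↑R' := by
  have hK := isComponent_of_separated hR hC hsep
  have e : (↑(R \ C') : Set V) = ↑R ∩ (↑C' : Set V)ᶜ := by
    rw [Finset.coe_sdiff, Set.sdiff_eq]
  rw [e, hK.restrict_iff (Set.compl_subset_compl.2 (Finset.coe_subset.2 Finset.inter_subset_right))]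
  constructor
  · rintro ⟨⟨v, hv⟩, h', K, hK', hRK, hRK'⟩
    rw [hK'.eq_of_mem hK (hRK hv) hv] at hRK'
    exact ⟨h', hRK'⟩
  · rintro ⟨h', hRR'⟩
    exact ⟨hK.nonempty, h', _, hK, Set.Subset.rfl, hRR'⟩

/-- Preserves the invariant that the robber's set is a component of G - m when the new chasers are
added to m. -/
theorem isComponent_compl_union {C' R R' m : Finset V} (hR : IsComponent G (↑m : Set V)ᶜ ↑R)
    (hR' : IsComponent G (↑(R \ C') : Set V) ↑R') :
    IsComponent G (↑(m ∪ (C' ∩ R)) : Set V)ᶜ ↑R' := by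
  have e : (↑(R \ C') : Set V) = ↑R ∩ (↑(m ∪ (C' ∩ R)) : Set V)ᶜ := by
    ext v
    have : v ∈ R → v ∉ m := fun h h' => hR.subset h h'
    simp only [Finset.coe_sdiff, Set.mem_sdiff, Finset.mem_coe, Set.mem_inter_iff, Set.mem_compl_iff,
      Finset.mem_union, Finset.mem_inter]
    tauto
  rw [e, hR.restrict_iff (Set.compl_subset_compl.2
    (Finset.coe_subset.2 Finset.subset_union_left))] at hR'
  exact hR'.1

/-- The answer of a robber who avoids the positions in which the cops win. -/
theorem exists_robberMove (G : Digraph V) (k : ℕ) (C C' R m : Finset V) :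
    ∃ R', RobberMove G C C' R R' ∧
      ((∃ R'', LegalRobberMove G C C' R R'' ∧ ¬ WinsFrom G k C' R'' m) →
        LegalRobberMove G C C' R R' ∧ ¬ WinsFrom G k C' R' m) := by
  by_cases h : ∃ R'', LegalRobberMove G C C' R R'' ∧ ¬ WinsFrom G k C' R'' m
  · obtain ⟨R', h₁, h₂⟩ := h
    exact ⟨R', .inl h₁, fun _ => ⟨h₁, h₂⟩⟩
  · by_cases h' : ∃ R'', LegalRobberMove G C C' R R''
    · obtain ⟨R', h₁⟩ := h'
      exact ⟨R', .inl h₁, fun h'' => absurd h'' h⟩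
    · exact ⟨∅, .inr ⟨rfl, h'⟩, fun h'' => absurd h'' h⟩

/-- A cop strategy, a first component and the robber's answers determine a play. The second part
of the state is the set of vertices on which chasers have been placed. -/
theorem exists_play (σ : List (Finset V × Finset V) → Finset V)
    (ρ : Finset V → Finset V → Finset V → Finset V → Finset V) (R₀ : Finset V) :
    ∃ C R m : ℕ → Finset V, C 0 = ∅ ∧ R 0 = R₀ ∧ m 0 = ∅ ∧
      (∀ i, C (i + 1) = σ ((List.range (i + 1)).map fun j => (C j, R j))) ∧
      (∀ i, m (i + 1) = m i ∪ (C (i + 1) ∩ R i)) ∧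
      ∀ i, R (i + 1) = ρ (C i) (C (i + 1)) (R i) (m (i + 1)) := by
  let next : List (Finset V × Finset V) × (Finset V × Finset V) × Finset V →
      List (Finset V × Finset V) × (Finset V × Finset V) × Finset V := fun s =>
    (s.1 ++ [s.2.1], (σ (s.1 ++ [s.2.1]), ρ s.2.1.1 (σ (s.1 ++ [s.2.1])) s.2.1.2
      (s.2.2 ∪ (σ (s.1 ++ [s.2.1]) ∩ s.2.1.2))), s.2.2 ∪ (σ (s.1 ++ [s.2.1]) ∩ s.2.1.2))
  let st : ℕ → List (Finset V × Finset V) × (Finset V × Finset V) × Finset V :=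
    fun i => next^[i] ([], (∅, R₀), ∅)
  have hst : ∀ i, st (i + 1) = next (st i) := fun i => Function.iterate_succ_apply' _ _ _
  have hist : ∀ i, (st i).1 = (List.range i).map fun j => (st j).2.1 := by
    intro i
    induction i with
    | zero => rfl
    | succ i ih => rw [hst, List.range_succ, List.map_append, ← ih]; rfl
  have hist' : ∀ i, (st i).1 ++ [(st i).2.1] = (List.range (i + 1)).map fun j => (st j).2.1 := by
    intro i
    rw [hist, List.range_succ, List.map_append]
    rfl
  refine ⟨fun i => (st i).2.1.1, fun i => (st i).2.1.2, fun i => (st i).2.2, rfl, rfl, rfl,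
    fun i => ?_, fun i => ?_, fun i => ?_⟩
  · change _ = σ ((List.range (i + 1)).map fun j => (st j).2.1)
    rw [← hist' i]
    exact congrArg (fun s => s.2.1.1) (hst i)
  · change (st (i + 1)).2.2 = (st i).2.2 ∪ ((st (i + 1)).2.1.1 ∩ (st i).2.1.2)
    rw [hst]
  · change (st (i + 1)).2.1.2 =
      ρ (st i).2.1.1 (st (i + 1)).2.1.1 (st i).2.1.2 (st (i + 1)).2.2
    rw [hst]

/-- Otherwise let the robber always answer by a position outside `WinsFrom` if there is one. Weak
monotonicity makes every move before the capture a separating one, and a separating move from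
outside `WinsFrom` always leaves such an answer. So at the time of capture his component would still
be nonempty. -/
theorem winsFrom_of_copsWin (h : CopsWin G k) {R₀ : Finset V}
    (hR₀ : IsComponent G Set.univ ↑R₀) : WinsFrom G k ∅ R₀ ∅ := by
  obtain ⟨σ, hσ, hwin⟩ := h
  by_contra hnot
  choose ρ hρ using exists_robberMove G k
  obtain ⟨C, R, m, hC0, hR0, hm0, hC, hm, hR⟩ := exists_play σ ρ R₀
  have hmove : ∀ i, RobberMove G (C i) (C (i + 1)) (R i) (R (i + 1)) := fun i => by
    rw [hR i]
    exact (hρ _ _ _ _).1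
  obtain ⟨N, hN, hmono⟩ := hwin C R ⟨hC0, hR0 ▸ .inl hR₀, hC, hmove⟩
  have hm' : ∀ i, ∀ v ∈ m i, ∃ j < i, v ∈ chasers C R j := by
    intro i
    induction i with
    | zero => simp [hm0]
    | succ i ih =>
      intro v hv
      rw [hm, Finset.mem_union] at hv
      rcases hv with hv | hv
      · obtain ⟨j, hj, h⟩ := ih v hv
        exact ⟨j, by omega, h⟩
      · exact ⟨i, by omega, hv⟩
  have hsep : ∀ i < N, Disjoint (↑(m i) : Set V)
      (reachSet G (↑(C i ∩ C (i + 1)) : Set V)ᶜ ↑(R i)) := by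
    intro i hi
    refine Set.disjoint_left.2 fun v hv => ?_
    obtain ⟨j, hj, h⟩ := hm' i v hv
    exact Set.disjoint_left.1 (hmono i hi j hj) h
  have key : ∀ i ≤ N, IsComponent G (↑(m i) : Set V)ᶜ ↑(R i) ∧ Disjoint (C i) (R i) ∧
      ¬ WinsFrom G k (C i) (R i) (m i) := by
    intro i
    induction i with
    | zero =>
      intro _
      rw [hC0, hR0, hm0, Finset.coe_empty, Set.compl_empty]
      exact ⟨hR₀, Finset.disjoint_empty_left _, hnot⟩
    | succ i ih =>
      intro hi
      obtain ⟨h₁, h₂, h₃⟩ := ih (by omega)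
      have hs := hsep i (by omega)
      have hlegal := legalRobberMove_iff h₁ h₂ hs
      have hex : ∃ R'', LegalRobberMove G (C i) (C (i + 1)) (R i) R'' ∧
          ¬ WinsFrom G k (C (i + 1)) R'' (m (i + 1)) := by
        by_contra! hall
        refine h₃ (.move (C (i + 1)) (hC i ▸ hσ _) hs fun R' hR' => ?_)
        rw [← hm]
        exact hall R' ((hlegal R').2 hR')
      have h₄ := (hρ (C i) (C (i + 1)) (R i) (m (i + 1))).2 hex
      rw [← hR i] at h₄
      have h₅ := (hlegal _).1 h₄.1
      rw [hm]
      refine ⟨isComponent_compl_union h₁ h₅, ?_, hm i ▸ h₄.2⟩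
      exact Finset.disjoint_right.2 fun v hv => (Finset.mem_sdiff.1 (h₅.subset hv)).2
  obtain ⟨v, hv⟩ := (key N le_rfl).1.nonempty
  rw [hN] at hv
  exact absurd hv (Finset.notMem_empty v)

end Game

/-! ### Assembling small trees -/

section Trees

variable {n : ℕ} {G : Digraph (Fin n)} {k : ℕ}

theorem length_treeCode_node (C R : Finset (Fin n)) (ts : List (LabelledTree (Fin n))) :
    (treeCode (.node C R ts)).length =
      2 * n + 2 + (ts.map fun t => (treeCode t).length).sum := by
  have := congrArg List.length (treeCode_node C R ts [])
  simp only [List.append_nil, List.length_cons, List.length_append, length_setCode,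
    List.length_flatten, List.map_map, List.length_nil] at this
  rw [this]
  change _ + (_ + ((ts.map fun t => (treeCode t).length).sum + _)) + _ = _
  omega

/-- The components of `G[X]` as the list of children of a node. -/
theorem exists_children {X : Finset (Fin n)} {P : LabelledTree (Fin n) → Prop} {b : ℕ}
    (h : ∀ R' : Finset (Fin n), IsComponent G (↑X : Set (Fin n)) ↑R' →
      ∃ t, t.rootR = R' ∧ P t ∧ (treeCode t).length ≤ b * R'.card) :
    ∃ ts : List (LabelledTree (Fin n)),
      (∀ t ∈ ts, IsComponent G (↑X : Set (Fin n)) ↑t.rootR ∧ P t) ∧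
      (∀ v ∈ X, ∃ t ∈ ts, v ∈ t.rootR) ∧
      (ts.map fun t => (treeCode t).length).sum ≤ b * X.card := by
  classical
  have : Nonempty (LabelledTree (Fin n)) := ⟨.node ∅ ∅ []⟩
  choose! f hf hP hlen using h
  let K : Finset (Finset (Fin n)) := Finset.univ.filter fun R' => IsComponent G (↑X) ↑R'
  have hK : ∀ R', R' ∈ K ↔ IsComponent G (↑X : Set (Fin n)) ↑R' := fun R' => by simp [K]
  refine ⟨K.toList.map f, fun t ht => ?_, fun v hv => ?_, ?_⟩
  · obtain ⟨R', hR', rfl⟩ := List.mem_map.1 ht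
    rw [Finset.mem_toList, hK] at hR'
    exact ⟨by rwa [hf R' hR'], hP R' hR'⟩
  · obtain ⟨Y, hY, hvY⟩ := exists_component G (Finset.mem_coe.2 hv)
    have e : (↑Y.toFinset : Set (Fin n)) = Y := Set.coe_toFinset Y
    rw [← e] at hY
    refine ⟨f Y.toFinset, List.mem_map_of_mem (Finset.mem_toList.2 ((hK _).2 hY)), ?_⟩
    rw [hf _ hY]
    exact Set.mem_toFinset.2 hvY
  · rw [List.map_map, Finset.sum_map_toList]
    have hdisj : (↑K : Set (Finset (Fin n))).PairwiseDisjoint id := by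
      intro A hA B hB hAB
      refine Finset.disjoint_left.2 fun v hv hv' => hAB ?_
      exact Finset.coe_injective (((hK A).1 hA).eq_of_mem ((hK B).1 hB) hv hv')
    calc ∑ R' ∈ K, (treeCode (f R')).length ≤ ∑ R' ∈ K, b * R'.card :=
          Finset.sum_le_sum fun R' hR' => hlen R' ((hK R').1 hR')
      _ = b * (K.biUnion id).card := by
          rw [← Finset.mul_sum, Finset.card_biUnion hdisj]
          rfl
      _ ≤ b * X.card := by
          refine Nat.mul_le_mul_left _ (Finset.card_le_card fun v hv => ?_)
          obtain ⟨A, hA, hvA⟩ := Finset.mem_biUnion.1 hv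
          exact ((hK A).1 hA).subset hvA

variable (G k) in
/-- `t` is a decomposition of `R` that continues a decomposition in which `C` is the cop position
and the chasers have been placed on `m`. -/
structure Continues (C R m : Finset (Fin n)) (t : LabelledTree (Fin n)) : Prop where
  rootR : t.rootR = R
  shyMonotone : ShyMonotoneBelow G m t
  width_le : t.width ≤ k
  separated : Disjoint (↑m : Set (Fin n)) (reachSet G (↑(C ∩ t.rootC) : Set (Fin n))ᶜ ↑R)

theorem Continues.node {C R m C' : Finset (Fin n)} {ts : List (LabelledTree (Fin n))}
    (hk : C'.card ≤ k)
    (hsep : Disjoint (↑m : Set (Fin n)) (reachSet G (↑(C ∩ C') : Set (Fin n))ᶜ ↑R))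
    (hts : ∀ t ∈ ts, IsComponent G (↑(R \ C') : Set (Fin n)) ↑t.rootR ∧
      Continues G k C' t.rootR (m ∪ (C' ∩ R)) t)
    (hcover : ∀ v ∈ R \ C', ∃ t ∈ ts, v ∈ t.rootR) :
    Continues G k C R m (.node C' R ts) := by
  have e : R \ (C' ∩ R) = R \ C' := by rw [Finset.inter_comm, Finset.sdiff_inter_self_left]
  refine ⟨rfl, .node m C' R ts (fun t ht => e ▸ (hts t ht).1) (fun v => ?_)
    (fun t ht => (hts t ht).2.separated) fun t ht => (hts t ht).2.shyMonotone,
    width_node_le.2 ⟨hk, fun t ht => (hts t ht).2.width_le⟩, hsep⟩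
  constructor
  · intro hv
    by_cases hv' : v ∈ C'
    · exact .inl (Finset.mem_inter.2 ⟨hv', hv⟩)
    · exact .inr (hcover v (Finset.mem_sdiff.2 ⟨hv, hv'⟩))
  · rintro (hv | ⟨t, ht, hv⟩)
    · exact (Finset.mem_inter.1 hv).2
    · exact (Finset.mem_sdiff.1 ((hts t ht).1.subset hv)).1

/-- An idle move becomes a node with ch(t) = ∅ and a single child with the same set R, at the price
of 2n + 2 bits: two bit vectors and two brackets. -/
theorem exists_continues_of_idleMoves {C D R m : Finset (Fin n)} {l : ℕ}
    (hR : IsComponent G (↑R : Set (Fin n)) ↑R)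
    (h : SeparatorChain.Within (IdleMove G R m k) l C D) {t : LabelledTree (Fin n)}
    (ht : Continues G k D R m t) :
    ∃ t', Continues G k C R m t' ∧
      (treeCode t').length ≤ l * (2 * n + 2) + (treeCode t).length := by
  induction h with
  | refl => exact ⟨t, ht, by omega⟩
  | @head l C C' D h₁ _ ih =>
    obtain ⟨t', ht', hlen⟩ := ih ht
    obtain ⟨hd, hk, hsep⟩ := h₁
    have e : R \ C' = R := Finset.sdiff_eq_self_of_disjoint hd.symm
    refine ⟨.node C' R [t'], .node hk hsep ?_ ?_, ?_⟩
    · intro s hs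
      rw [List.mem_singleton.1 hs, e, ht'.rootR, Finset.disjoint_iff_inter_eq_empty.1 hd,
        Finset.union_empty]
      exact ⟨hR, ht'⟩
    · intro v hv
      exact ⟨t', List.mem_singleton_self _, ht'.rootR ▸ (Finset.mem_sdiff.1 hv).1⟩
    · rw [length_treeCode_node]
      simp only [List.map_cons, List.map_nil, List.sum_cons, List.sum_nil]
      rw [Nat.add_mul, Nat.one_mul]
      omega

/-- The bound on the number of consecutive idle moves. -/
def idleBound (n : ℕ) : ℕ := (2 * n + 2) * (2 * (2 * n))

/-- Induction on |R|. At most `idleBound n` idle nodes and one chasing node are paid for by a vertex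
that the chasers remove from R; the children share the remaining vertices, as their sets are
disjoint. -/
theorem exists_continues_of_winsFrom (N : ℕ) : ∀ {C R m : Finset (Fin n)}, R.card ≤ N →
    WinsFrom G k C R m → IsComponent G (↑R : Set (Fin n)) ↑R → Disjoint C R → C.card ≤ k →
    ∃ t, Continues G k C R m t ∧
      (treeCode t).length ≤ (idleBound n + 1) * (2 * n + 2) * R.card := by
  induction N with
  | zero =>
    intro C R m hN _ hR _ _
    obtain ⟨v, hv⟩ := hR.nonempty
    have := Finset.card_pos.2 ⟨v, hv⟩
    omega
  | succ N ih =>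
    intro C R m hN hwin hR hCR hCk
    obtain ⟨D, C', hCD, hk, hsep, hd, hnext⟩ := hwin.exists_chase hR
    have hlt : (R \ C').card < R.card := by
      obtain ⟨v, hv, hv'⟩ := Finset.not_disjoint_iff.1 hd
      refine Finset.card_lt_card ⟨Finset.sdiff_subset, fun h => ?_⟩
      exact (Finset.mem_sdiff.1 (h hv')).2 hv
    obtain ⟨ts, hts, hcover, hlen⟩ := exists_children (G := G) (X := R \ C')
      (P := fun t => Continues G k C' t.rootR (m ∪ (C' ∩ R)) t)
      (b := (idleBound n + 1) * (2 * n + 2)) fun R' hR' => by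
        have hsub : R' ⊆ R \ C' := Finset.coe_subset.1 hR'.subset
        obtain ⟨t, ht, hlen⟩ := ih (by have := Finset.card_le_card hsub; omega) (hnext R' hR')
          hR'.self (Finset.disjoint_right.2 fun v hv => (Finset.mem_sdiff.1 (hsub hv)).2) hk
        exact ⟨t, ht.rootR, ht.rootR.symm ▸ ht, hlen⟩
    have hnode : Continues G k D R m (.node C' R ts) := .node hk hsep hts hcover
    have hshort := exists_short_idleMoves hCR hCk hCD
    rw [Fintype.card_fin] at hshort
    obtain ⟨t, ht, hlen'⟩ := exists_continues_of_idleMoves hR hshort hnode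
    refine ⟨t, ht, hlen'.trans ?_⟩
    rw [length_treeCode_node]
    change idleBound n * (2 * n + 2) + _ ≤ _
    calc idleBound n * (2 * n + 2) +
          (2 * n + 2 + (ts.map fun t => (treeCode t).length).sum)
        ≤ idleBound n * (2 * n + 2) + (2 * n + 2 +
          (idleBound n + 1) * (2 * n + 2) * (R \ C').card) := by omega
      _ = (idleBound n + 1) * (2 * n + 2) * ((R \ C').card + 1) := by ring
      _ ≤ _ := Nat.mul_le_mul_left _ hlt

theorem exists_decomposition_of_copsWin (h : CopsWin G k) :
    ∃ D : LabelledTree (Fin n), IsShyMonotoneTreeDecomposition G D ∧ D.width ≤ k ∧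
      (treeCode D).length ≤ 18 * (n ^ 2 + n + 1) ^ 2 := by
  have e : Finset.univ \ (∅ : Finset (Fin n)) = Finset.univ := Finset.sdiff_empty
  obtain ⟨ts, hts, hcover, hlen⟩ := exists_children (G := G) (X := Finset.univ \ ∅)
    (P := fun t => Continues G k ∅ t.rootR (∅ ∪ (∅ ∩ Finset.univ)) t)
    (b := (idleBound n + 1) * (2 * n + 2)) fun R' hR' => by
      have hR₀ : IsComponent G Set.univ (↑R' : Set (Fin n)) := by
        rwa [e, Finset.coe_univ] at hR'
      obtain ⟨t, ht, hlen⟩ := exists_continues_of_winsFrom R'.card le_rfl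
        (winsFrom_of_copsWin h hR₀) hR'.self (Finset.disjoint_empty_left _) (Nat.zero_le _)
      exact ⟨t, ht.rootR, by rw [ht.rootR]; exact ht, hlen⟩
  -- The bag of the root is empty, so its children are the components of G among which the robber
  -- chooses his start.
  have hnode : Continues G k ∅ Finset.univ ∅ (.node ∅ Finset.univ ts) :=
    .node (Nat.zero_le _) (by simp) hts hcover
  refine ⟨.node ∅ Finset.univ ts, ⟨fun v => Finset.mem_univ v, hnode.shyMonotone⟩, hnode.width_le, ?_⟩
  rw [length_treeCode_node]
  rw [e, Finset.card_univ, Fintype.card_fin] at hlen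
  refine (Nat.add_le_add_left hlen _).trans ?_
  -- The left side is 16n⁴ + 32n³ + 18n² + 4n + 2, which explains the factor 18.
  rw [idleBound]
  nlinarith [Nat.zero_le n, Nat.zero_le (n ^ 2), Nat.zero_le (n ^ 3), Nat.zero_le (n ^ 4)]

end Trees

end WeakDagWidth

/-! ### From decompositions to winning strategies -/

namespace WeakDagWidth

section Strategy

variable {V : Type} [DecidableEq V] {G : Digraph V} {k : ℕ}

/-- The subtrees below the root. -/
def LabelledTree.children : LabelledTree V → List (LabelledTree V)
  | .node _ _ ts => ts

/-- The subtree below the root that decomposes `R'`. -/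
def LabelledTree.descend (t : LabelledTree V) (R' : Finset V) : LabelledTree V :=
  (t.children.find? fun s => s.rootR = R').getD t

/-- The strategy that follows the robber down the tree `D`. -/
def LabelledTree.strategy (D : LabelledTree V) (h : List (Finset V × Finset V)) : Finset V :=
  ((h.tail.map Prod.snd).foldl LabelledTree.descend D).rootC

theorem LabelledTree.descend_spec {t s : LabelledTree V} (hs : s ∈ t.children) :
    t.descend s.rootR ∈ t.children ∧ (t.descend s.rootR).rootR = s.rootR := by
  obtain ⟨s', hs'⟩ : ∃ s', (t.children.find? fun s' => s'.rootR = s.rootR) = some s' :=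
    Option.isSome_iff_exists.1 (List.find?_isSome.2 ⟨s, hs, by simp⟩)
  rw [descend, hs', Option.getD_some]
  exact ⟨List.mem_of_find?_eq_some hs', by simpa using List.find?_some hs'⟩

/-- If no child decomposes R', `descend` stays at t. This default matters because a strategy must
respect the bound k on all histories, including impossible ones. -/
theorem LabelledTree.width_descend {t : LabelledTree V} (ht : t.width ≤ k) (R' : Finset V) :
    (t.descend R').width ≤ k := by
  rw [descend]
  cases h : t.children.find? fun s => s.rootR = R' with
  | none => exact ht
  | some s =>
    have hs := List.mem_of_find?_eq_some h
    rcases t with ⟨C, R, ts⟩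
    exact (width_node_le.1 ht).2 s hs

theorem LabelledTree.card_strategy {D : LabelledTree V} (hD : D.width ≤ k)
    (h : List (Finset V × Finset V)) : (D.strategy h).card ≤ k := by
  rw [strategy]
  generalize h.tail.map Prod.snd = l
  induction l generalizing D with
  | nil =>
    rcases D with ⟨C, R, ts⟩
    exact (width_node_le.1 hD).1
  | cons R' l ih => exact ih (width_descend hD R')

theorem weaklyMonotone_succ {C R : ℕ → Finset V} {i : ℕ} (h : WeaklyMonotone G C R i)
    (hi : ∀ j < i,
      Disjoint (↑(chasers C R j) : Set V) (reachSet G (↑(C i ∩ C (i + 1)) : Set V)ᶜ ↑(R i))) :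
    WeaklyMonotone G C R (i + 1) := by
  intro i' hi' j hj
  rcases Nat.lt_succ_iff_lt_or_eq.1 hi' with h' | rfl
  · exact h i' h' j hj
  · exact hi j hj

/-- The child that the strategy selects after the move of the robber to `R'`. -/
theorem descend_of_isComponent {t : LabelledTree V} {C R R' : Finset V}
    {ts : List (LabelledTree V)} (ht : t = .node C R ts)
    (hts : ∀ t ∈ ts, IsComponent G (↑(R \ (C ∩ R)) : Set V) ↑t.rootR)
    (hcover : ∀ v, v ∈ R ↔ v ∈ C ∩ R ∨ ∃ t ∈ ts, v ∈ t.rootR)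
    (hR' : IsComponent G (↑(R \ (C ∩ R)) : Set V) ↑R') :
    t.descend R' ∈ ts ∧ (t.descend R').rootR = R' := by
  subst ht
  obtain ⟨v, hv⟩ := hR'.nonempty
  have hv' := Finset.mem_sdiff.1 (hR'.subset hv)
  obtain ⟨s, hs, hvs⟩ := ((hcover v).1 hv'.1).resolve_left hv'.2
  have e : s.rootR = R' := Finset.coe_injective ((hts s hs).eq_of_mem hR' hvs hv)
  subst e
  exact LabelledTree.descend_spec (t := .node C R ts) hs

/-- Induction on the decomposition, one level per round, so the finite depth forces the capture.
Along the play, R i is the set of the current node and a component of G - m, m contains all earlier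
chasers, and the coming move keeps m separated. -/
theorem captured_of_shyMonotoneBelow {C R : ℕ → Finset V} {T : ℕ → LabelledTree V}
    (hT : ∀ i, T (i + 1) = (T i).descend (R (i + 1))) (hC : ∀ i, C (i + 1) = (T i).rootC)
    (hmove : ∀ i, RobberMove G (C i) (C (i + 1)) (R i) (R (i + 1))) {m : Finset V}
    {t : LabelledTree V} (h : ShyMonotoneBelow G m t) :
    ∀ i, T i = t → R i = t.rootR → IsComponent G (↑m : Set V)ᶜ ↑(R i) → Disjoint (C i) (R i) →
      (∀ j < i, chasers C R j ⊆ m) →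
      Disjoint (↑m : Set V) (reachSet G (↑(C i ∩ C (i + 1)) : Set V)ᶜ ↑(R i)) →
      WeaklyMonotone G C R i → ∃ N, R N = ∅ ∧ WeaklyMonotone G C R N := by
  induction h with
  | node m C' R' ts hts hcover hblocked _ ih =>
    intro i hTi hRi hcomp hdisj hch hsep hmono
    have hC' : C (i + 1) = C' := by rw [hC, hTi]; rfl
    have hRi : R i = R' := hRi
    have hmono' := weaklyMonotone_succ hmono fun j hj =>
      Disjoint.mono_left (Finset.coe_subset.2 (hch j hj)) hsep
    rcases hmove i with hl | ⟨hl, -⟩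
    · rw [legalRobberMove_iff hcomp hdisj hsep] at hl
      have hl' : IsComponent G (↑(R' \ (C' ∩ R')) : Set V) ↑(R (i + 1)) := by
        rwa [Finset.inter_comm, Finset.sdiff_inter_self_left, ← hRi, ← hC']
      obtain ⟨h₁, h₂⟩ := descend_of_isComponent hTi hts hcover hl'
      rw [← hT] at h₁ h₂
      refine ih _ h₁ (i + 1) rfl h₂.symm ?_ ?_ ?_ ?_ hmono'
      · rw [← hC', ← hRi]
        exact isComponent_compl_union hcomp hl
      · exact Finset.disjoint_right.2 fun v hv => (Finset.mem_sdiff.1 (hl.subset hv)).2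
      · intro j hj
        rcases Nat.lt_succ_iff_lt_or_eq.1 hj with hj | rfl
        · exact (hch j hj).trans Finset.subset_union_left
        · rw [chasers, hC', hRi]
          exact Finset.subset_union_right
      · have := hblocked _ h₁
        rw [h₂, ← hC] at this
        rwa [hC']
    · exact ⟨i + 1, hl, hmono'⟩

theorem copsWin_of_decomposition {D : LabelledTree V}
    (hD : IsShyMonotoneTreeDecomposition G D) (hk : D.width ≤ k) : CopsWin G k := by
  refine ⟨D.strategy, D.card_strategy hk, fun C R hplay => ?_⟩
  let T : ℕ → LabelledTree V := fun i =>
    ((List.range i).map fun j => R (j + 1)).foldl LabelledTree.descend D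
  have hT : ∀ i, T (i + 1) = (T i).descend (R (i + 1)) := fun i => by
    simp [T, List.range_succ]
  have hC : ∀ i, C (i + 1) = (T i).rootC := fun i => by
    rw [hplay.cops_move, LabelledTree.strategy, List.range_succ_eq_map, List.map_cons,
      List.tail_cons, List.map_map, List.map_map]
    rfl
  have h0 : WeaklyMonotone G C R 0 := fun i hi => absurd hi (by omega)
  have h1 : WeaklyMonotone G C R 1 := weaklyMonotone_succ h0 fun j hj => absurd hj (by omega)
  rcases hplay.robber_start with hstart | ⟨-, hstart⟩
  · obtain ⟨hV, hbelow⟩ := hD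
    -- The first round is special: R 0 is a component of G, whereas the root carries all of V(G).
    -- From round 1 on, the robber's component is the set of the current node.
    rcases hplay.robber_move 0 with hl | ⟨hl, -⟩
    · rcases D with ⟨C', R', ts⟩
      obtain ⟨hts, hcover, hblocked, hts'⟩ := shyMonotoneBelow_node_iff.1 hbelow
      have hC' : C 1 = C' := hC 0
      have e : (↑(R' \ (C' ∩ R')) : Set V) = (↑C' : Set V)ᶜ := by
        ext v
        have : v ∈ R' := hV v
        simp [this]
      have hl' := hl.2.1
      rw [zero_add, hC', ← e] at hl'
      obtain ⟨h₁, h₂⟩ := descend_of_isComponent rfl hts hcover hl'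
      have hT1 : T 1 = (LabelledTree.node C' R' ts).descend (R 1) := hT 0
      rw [← hT1] at h₁ h₂
      refine captured_of_shyMonotoneBelow hT hC hplay.robber_move (hts' _ h₁) 1 rfl h₂.symm
        ?_ ?_ ?_ ?_ h1
      · rw [e] at hl'
        convert hl' using 2
        ext v
        have : v ∈ R' := hV v
        simp [this]
      · exact Finset.disjoint_right.2 fun v hv => hl.2.1.subset hv
      · intro j hj v hv
        obtain rfl : j = 0 := by omega
        rw [chasers, zero_add, hC'] at hv
        exact Finset.mem_union_right _
          (Finset.mem_inter.2 ⟨(Finset.mem_inter.1 hv).1, hV v⟩)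
      · have := hblocked _ h₁
        rw [h₂, ← hC] at this
        rwa [hC']
    · exact ⟨1, hl, h1⟩
  · exact ⟨0, hstart, h0⟩

end Strategy

/-! ### The main theorem -/

section Main

variable {n : ℕ} {G : Digraph (Fin n)} {k : ℕ}

/-- Occupying all vertices at once wins. Hence the set of sufficient numbers is nonempty and its
infimum is attained. -/
theorem copsWin_card (G : Digraph (Fin n)) : CopsWin G n := by
  refine copsWin_of_decomposition (D := .node Finset.univ Finset.univ [])
    ⟨fun v => Finset.mem_univ v, .node _ _ _ _ ?_ ?_ ?_ ?_⟩ ?_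
  · simp
  · simp
  · simp
  · simp
  · exact width_node_le.2 ⟨by simp, by simp⟩

theorem copsWin_weakDagWidth (G : Digraph (Fin n)) : CopsWin G (weakDagWidth G) :=
  Nat.sInf_mem (s := {k | CopsWin G k}) ⟨n, copsWin_card G⟩

theorem length_graphCode (G : Digraph (Fin n)) : (graphCode G).length = n ^ 2 + n + 1 := by
  rw [graphCode, List.length_append, List.length_cons, List.length_replicate,
    length_flatMap_const _ n (fun _ => by simp), List.length_finRange]
  ring

theorem exists_small_decomposition (h : weakDagWidth G ≤ k) :
    ∃ D : LabelledTree (Fin n), IsShyMonotoneTreeDecomposition G D ∧ D.width ≤ k ∧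
      (treeCode D).length ≤ 18 * (graphCode G).length ^ 2 := by
  obtain ⟨D, h₁, h₂, h₃⟩ := exists_decomposition_of_copsWin (copsWin_weakDagWidth G)
  exact ⟨D, h₁, h₂.trans h, length_graphCode G ▸ h₃⟩

theorem weakDagWidth_le_iff : weakDagWidth G ≤ k ↔
    ∃ D : LabelledTree (Fin n), IsShyMonotoneTreeDecomposition G D ∧ D.width ≤ k := by
  constructor
  · intro h
    obtain ⟨D, h₁, h₂, -⟩ := exists_small_decomposition h
    exact ⟨D, h₁, h₂⟩
  · rintro ⟨D, h₁, h₂⟩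
    exact Nat.sInf_le (copsWin_of_decomposition h₁ h₂)

/-- The graph code is a prefix of the instance code, so the quadratic bound on certificates is also
one in the length of the instance. -/
theorem inNP_weakDagWidthProblem : InNP weakDagWidthProblem := by
  refine ⟨Polynomial.C 18 * Polynomial.X ^ 2, decompositionRelation,
    decidable_decompositionRelation, fun x => ⟨?_, ?_⟩⟩
  · rintro ⟨n, G, k, hG, hk, rfl⟩
    obtain ⟨D, h₁, h₂, h₃⟩ := exists_small_decomposition hk
    refine ⟨treeCode D, ?_, n, G, k, D, hG, h₁, h₂, rfl⟩
    rw [Polynomial.eval_mul, Polynomial.eval_C, Polynomial.eval_pow, Polynomial.eval_X]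
    refine h₃.trans (Nat.mul_le_mul_left _ (Nat.pow_le_pow_left ?_ 2))
    rw [instanceCode, List.length_append]
    exact Nat.le_add_right _ _
  · rintro ⟨w, -, n, G, k, D, hG, h₁, h₂, h⟩
    exact ⟨n, G, k, hG, weakDagWidth_le_iff.2 ⟨D, h₁, h₂⟩, congrArg Prod.fst h⟩

end Main

end WeakDagWidth

theorem mainTheorem10 :
    WeakDagWidth.InNP WeakDagWidth.weakDagWidthProblem ∧
    WeakDagWidth.DecidableInPolyTime WeakDagWidth.pairCode WeakDagWidth.decompositionRelation ∧
    (∀ (n : ℕ) (G : Digraph (Fin n)) (k : ℕ), (∀ v, ¬ G.Adj v v) →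
      (WeakDagWidth.weakDagWidth G ≤ k ↔
        ∃ D : WeakDagWidth.LabelledTree (Fin n),
          WeakDagWidth.IsShyMonotoneTreeDecomposition G D ∧ D.width ≤ k)) ∧
    (∃ c : ℕ, ∀ (n : ℕ) (G : Digraph (Fin n)) (k : ℕ), (∀ v, ¬ G.Adj v v) →
      WeakDagWidth.weakDagWidth G ≤ k →
        ∃ D : WeakDagWidth.LabelledTree (Fin n),
          WeakDagWidth.IsShyMonotoneTreeDecomposition G D ∧ D.width ≤ k ∧
          (WeakDagWidth.treeCode D).length ≤ c * (WeakDagWidth.graphCode G).length ^ 2) :=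
  ⟨WeakDagWidth.inNP_weakDagWidthProblem, WeakDagWidth.decidable_decompositionRelation,
    fun _ _ _ _ => WeakDagWidth.weakDagWidth_le_iff,
    18, fun _ _ _ _ h => WeakDagWidth.exists_small_decomposition h⟩
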